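/- Let $\mathbb H$ be the real quaternions and let $E$ be a finite-dimensional quaternionic inner product space: a right $\mathbb H$-vector space with a biadditive map $\langle\cdot,\cdot\rangle:E\times E\to\mathbb H$ such that $\langle vq,wr\rangle=\bar q\langle v,w\rangle r$ and such that $\langle v,v\rangle$ is a nonnegative real number, equal to $0$ only if $v=0$. Let $\sigma=(E_1,\dots,E_s)$ be a splitting of $E$, i.e. a finite sequence of pairwise orthogonal subspaces of positive dimension with $E=E_1\oplus\dots\oplus E_s$, and let $\mathsf k$ be a kernel on $E$, i.e. a self-adjoint endomorphism with $0\le \mathsf k\le 1$, meaning that all its right eigenvalues are real numbers in $[0,1]$. Let $\mathsf{Gr}(E,\sigma)$ be the compact space of all subspaces $Q$ of $E$ with $Q=\bigoplus_i (Q\cap E_i)$, and let $\nu^{E,\sigma}$ be the Borel measure on it that is invariant under the group $\mathsf U(E,\sigma)$ of linear isometries of $E$ preserving each $E_i$ and gives mass $\prod_i\binom{\dim E_i}{n_i}$ to the set of all $Q$ with $\dim (Q\cap E_i)=n_i$ for all $i$; explicitly, $\nu^{E,\sigma}=\int_{\mathsf U(E,\sigma)}\sum_{J}\delta_{u(E_J)}\,du$,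 where $du$ is the normalised Haar measure, $J$ runs over the subsets of an orthonormal basis of $E$ consisting of vectors of the $E_i$, and $E_J$ is the span of $J$. For $Q\in\mathsf{Gr}(E,\sigma)$ put $\sigma_Q=(Q\cap E_1,\dots,Q\cap E_s)$ (null subspaces being allowed here) and regard $\nu^{Q,\sigma_Q}$ as a measure on $\mathsf{Gr}(E,\sigma)$. The incidence measure of a Borel probability measure $\mu$ on $\mathsf{Gr}(E,\sigma)$ is $Z\mu=\int\nu^{Q,\sigma_Q}\,d\mu(Q)$. For $R\in\mathsf{Gr}(E,\sigma)$ let $\mathsf k^R_R:R\to R$ be the restriction of $\mathsf k$ to $R$ followed by the orthogonal projection onto $R$, and let $\det_\Re(\mathsf k^R_R)$ be its Moore determinant, i.e. the value $$\textstyle\det_\Re(M)=\sum_{\pi\in\mathfrak S_n}\varepsilon(\pi)\prod_{(i_1\,\dots\, i_r)\text{ cycle of }\pi}\Re\big(M_{i_1i_2}M_{i_2i_3}\cdots M_{i_ri_1}\big)$$ for the matrix $M$ of $\mathsf k^R_R$ in any orthonormal basis of $R$. **Theorem.** The determinants $\det_\Re(\mathsf k_R^R)$ do not depend on the orthonormal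 bases, they are nonnegative and depend measurably on $R$, and there exists a unique Borel probability measure $\mu$ on $\mathsf{Gr}(E,\sigma)$ such that $$d(Z\mu)(R)={\det}_\Re(\mathsf k^R_R)\,d\nu^{E,\sigma}(R).$$ -/

import Mathlib

open scoped Quaternion ENNReal
open MeasureTheory

noncomputable section

namespace QuatDLP

/-! ### Quaternionic inner product spaces -/

/-- A quaternionic inner product space: a right `ℍ`-module (that is, a module over `ℍᵐᵒᵖ`, the
vector `v q` being `MulOpposite.op q • v`) with a biadditive pairing `⟨v, w⟩ = inner ℍ v w` with
values in `ℍ` such that `⟨v q, w r⟩ = conj q * ⟨v, w⟩ * r`, and such that `⟨v, v⟩` is a nonnegative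
real number which vanishes only for `v = 0`; the norm of the space is the associated norm
`‖v‖ = √⟨v, v⟩`. -/
class QuaternionicInnerProductSpace (V : Type*) [NormedAddCommGroup V] [Module ℍᵐᵒᵖ V]
    extends Inner ℍ V where
  hinner_add_left : ∀ u v w : V, inner (u + v) w = inner u w + inner v w
  hinner_add_right : ∀ u v w : V, inner u (v + w) = inner u v + inner u w
  hinner_smul_smul : ∀ (v w : V) (q r : ℍ),
    inner (MulOpposite.op q • v) (MulOpposite.op r • w) = star q * inner v w * r
  hinner_self : ∀ v : V, inner v v = ((‖v‖ ^ 2 : ℝ) : ℍ)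

/-- A subspace of a quaternionic inner product space, with the restricted inner product. -/
instance submoduleInner {V : Type*} [NormedAddCommGroup V] [Module ℍᵐᵒᵖ V]
    [QuaternionicInnerProductSpace V] (Q : Submodule ℍᵐᵒᵖ V) : QuaternionicInnerProductSpace Q where
  inner v w := inner ℍ (v : V) (w : V)
  hinner_add_left u v w := QuaternionicInnerProductSpace.hinner_add_left (u : V) v w
  hinner_add_right u v w := QuaternionicInnerProductSpace.hinner_add_right (u : V) v w
  hinner_smul_smul v w q r := QuaternionicInnerProductSpace.hinner_smul_smul (v : V) w q r
  hinner_self v := QuaternionicInnerProductSpace.hinner_self (v : V)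

/-- The quaternion units. -/
def unitI : ℍ := ⟨0, 1, 0, 0⟩

/-- The quaternion units. -/
def unitJ : ℍ := ⟨0, 0, 1, 0⟩

/-- The quaternion units. -/
def unitK : ℍ := ⟨0, 0, 0, 1⟩

theorem unitI_comp : unitI.re = 0 ∧ unitI.imI = 1 ∧ unitI.imJ = 0 ∧ unitI.imK = 0 :=
  ⟨rfl, rfl, rfl, rfl⟩

theorem unitJ_comp : unitJ.re = 0 ∧ unitJ.imI = 0 ∧ unitJ.imJ = 1 ∧ unitJ.imK = 0 :=
  ⟨rfl, rfl, rfl, rfl⟩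

theorem unitK_comp : unitK.re = 0 ∧ unitK.imI = 0 ∧ unitK.imJ = 0 ∧ unitK.imK = 1 :=
  ⟨rfl, rfl, rfl, rfl⟩

section Basic

variable {V : Type*} [NormedAddCommGroup V] [Module ℍᵐᵒᵖ V] [QuaternionicInnerProductSpace V]

open QuaternionicInnerProductSpace

theorem inner_smul_right (v w : V) (r : ℍ) :
    inner ℍ v (MulOpposite.op r • w) = inner ℍ v w * r := by
  simpa using hinner_smul_smul v w 1 r

theorem inner_smul_left (v w : V) (q : ℍ) :
    inner ℍ (MulOpposite.op q • v) w = star q * inner ℍ v w := by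
  simpa using hinner_smul_smul v w q 1

theorem inner_zero_left (w : V) : inner ℍ (0 : V) w = 0 := by
  simpa using inner_smul_left (0 : V) w 0

theorem inner_zero_right (w : V) : inner ℍ w (0 : V) = 0 := by
  simpa using inner_smul_right w (0 : V) 0

theorem inner_neg_right (v w : V) : inner ℍ v (-w) = -inner ℍ v w := by
  have := hinner_add_right v w (-w)
  rw [add_neg_cancel, inner_zero_right] at this
  exact (neg_eq_of_add_eq_zero_right this.symm).symm

theorem inner_sub_right (u v w : V) : inner ℍ u (v - w) = inner ℍ u v - inner ℍ u w := by
  rw [sub_eq_add_neg, hinner_add_right, inner_neg_right, sub_eq_add_neg]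

theorem inner_sum_right {ι : Type*} (s : Finset ι) (v : V) (f : ι → V) :
    inner ℍ v (∑ i ∈ s, f i) = ∑ i ∈ s, inner ℍ v (f i) := by
  classical
  induction s using Finset.induction_on with
  | empty => simp [inner_zero_right]
  | insert a s ha ih => rw [Finset.sum_insert ha, Finset.sum_insert ha, hinner_add_right, ih]

theorem inner_add_self (v w : V) :
    inner ℍ v w + inner ℍ w v = ((‖v + w‖ ^ 2 - ‖v‖ ^ 2 - ‖w‖ ^ 2 : ℝ) : ℍ) := by
  have h := hinner_self (v + w)
  rw [hinner_add_left, hinner_add_right, hinner_add_right, hinner_self, hinner_self] at h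
  push_cast at h ⊢
  rw [← h]; abel

/-- Conjugate symmetry follows from sesquilinearity and the reality of `⟨v, v⟩`. -/
theorem star_inner (v w : V) : star (inner ℍ v w) = inner ℍ w v := by
  have key : ∀ q : ℍ, ∃ t : ℝ, inner ℍ v w * q + star q * inner ℍ w v = (t : ℍ) := fun q => by
    rw [← inner_smul_right, ← inner_smul_left]
    exact ⟨_, inner_add_self _ _⟩
  generalize inner ℍ v w = a at key ⊢
  generalize inner ℍ w v = b at key ⊢
  obtain ⟨t0, h0⟩ := key 1
  obtain ⟨t1, h1⟩ := key unitI
  obtain ⟨t2, h2⟩ := key unitJ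
  rw [Quaternion.ext_iff] at h0 h1 h2 ⊢
  simp [Quaternion.re_mul, Quaternion.imI_mul, Quaternion.imJ_mul, Quaternion.imK_mul, unitI_comp,
    unitJ_comp] at h0 h1 h2 ⊢
  refine ⟨?_, ?_, ?_, ?_⟩ <;> linarith [h0.1, h0.2.1, h1.2.1, h1.2.2.1, h2.2.1]

theorem norm_smul_op (q : ℍ) (v : V) : ‖MulOpposite.op q • v‖ = ‖q‖ * ‖v‖ := by
  have h := hinner_self (MulOpposite.op q • v)
  rw [hinner_smul_smul, hinner_self] at h
  have h2 : star q * ((‖v‖ ^ 2 : ℝ) : ℍ) * q = ((‖q‖ ^ 2 * ‖v‖ ^ 2 : ℝ) : ℍ) := by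
    rw [mul_assoc, Quaternion.coe_commutes, ← mul_assoc, Quaternion.star_mul_self,
      Quaternion.normSq_eq_norm_mul_self]
    push_cast; rw [sq (‖q‖ : ℍ)]
  rw [h2] at h
  have h3 := Quaternion.coe_injective h
  rw [← mul_pow] at h3
  exact ((pow_left_inj₀ (by positivity) (by positivity) two_ne_zero).1 h3).symm

theorem continuous_smul_op (q : ℍ) : Continuous fun v : V => MulOpposite.op q • v := by
  refine (LipschitzWith.of_dist_le_mul (K := ‖q‖₊) fun v w => ?_).continuous
  rw [dist_eq_norm, dist_eq_norm, ← smul_sub, norm_smul_op]; rfl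

theorem re_inner (v w : V) :
    (inner ℍ v w).re = (‖v + w‖ ^ 2 - ‖v‖ ^ 2 - ‖w‖ ^ 2) / 2 := by
  have h := congrArg (fun x : ℍ => x.re) (inner_add_self v w)
  rw [← star_inner v w] at h
  simp only [Quaternion.re_add, Quaternion.re_star, Quaternion.re_coe] at h
  linarith

theorem continuous_inner_fun : Continuous fun p : V × V => inner ℍ p.1 p.2 := by
  have hre : ∀ q : ℍ, Continuous fun p : V × V =>
      (inner ℍ p.1 (MulOpposite.op q • p.2)).re := fun q => by
    simp only [re_inner]
    have := (continuous_smul_op (V := V) q).comp (continuous_snd (X := V))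
    simp only [Function.comp_def] at this
    fun_prop
  have h : (fun p : V × V => inner ℍ p.1 p.2) = fun p : V × V =>
      ((inner ℍ p.1 (MulOpposite.op (1 : ℍ) • p.2)).re : ℍ)
        - ((inner ℍ p.1 (MulOpposite.op unitI • p.2)).re : ℍ) * unitI
        - ((inner ℍ p.1 (MulOpposite.op unitJ • p.2)).re : ℍ) * unitJ
        - ((inner ℍ p.1 (MulOpposite.op unitK • p.2)).re : ℍ) * unitK := by
    funext p
    simp only [inner_smul_right]
    rw [Quaternion.ext_iff]
    simp [Quaternion.re_mul, Quaternion.imI_mul, Quaternion.imJ_mul, Quaternion.imK_mul,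
      unitI_comp, unitJ_comp, unitK_comp]
  rw [h]
  have hc : ∀ q : ℍ, Continuous fun p : V × V =>
      ((inner ℍ p.1 (MulOpposite.op q • p.2)).re : ℍ) := fun q =>
    Quaternion.continuous_coe.comp (hre q)
  exact (((hc 1).sub ((hc _).mul continuous_const)).sub ((hc _).mul continuous_const)).sub
    ((hc _).mul continuous_const)

/-- The real vector space underlying a quaternionic vector space. -/
abbrev realModule (V : Type*) [NormedAddCommGroup V] [Module ℍᵐᵒᵖ V] : Module ℝ V :=
  Module.compHom V (algebraMap ℝ ℍᵐᵒᵖ)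

/-- The real normed space underlying a quaternionic inner product space. -/
abbrev realNormedSpace (V : Type*) [NormedAddCommGroup V] [Module ℍᵐᵒᵖ V]
    [QuaternionicInnerProductSpace V] : NormedSpace ℝ V :=
  { realModule V with
    norm_smul_le := fun r v => by
      change ‖MulOpposite.op ((r : ℝ) : ℍ) • v‖ ≤ _
      rw [norm_smul_op]; simp }

theorem real_finite (V : Type*) [NormedAddCommGroup V] [Module ℍᵐᵒᵖ V] [Module.Finite ℍᵐᵒᵖ V] :
    let _ := realModule V
    Module.Finite ℝ V := by
  let _ := realModule V
  have : IsScalarTower ℝ ℍᵐᵒᵖ V := IsScalarTower.of_algebraMap_smul fun _ _ => rfl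
  exact Module.Finite.trans ℍᵐᵒᵖ V

theorem properSpace [Module.Finite ℍᵐᵒᵖ V] : ProperSpace V := by
  let _ := realNormedSpace V
  have : FiniteDimensional ℝ V := real_finite V
  exact FiniteDimensional.proper ℝ V

theorem isClosed_submodule [Module.Finite ℍᵐᵒᵖ V] (Q : Submodule ℍᵐᵒᵖ V) :
    IsClosed (Q : Set V) := by
  let _ := realNormedSpace V
  have : FiniteDimensional ℝ V := real_finite V
  have : IsScalarTower ℝ ℍᵐᵒᵖ V := IsScalarTower.of_algebraMap_smul fun _ _ => rfl
  exact (Q.restrictScalars ℝ).closed_of_finiteDimensional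

/-! ### Orthonormal bases and orthogonal projections -/

/-- `b` is an orthonormal basis of `V`. -/
def IsOrthonormalBasis {n : ℕ} (b : Fin n → V) : Prop :=
  (∀ i j, inner ℍ (b i) (b j) = if i = j then 1 else 0) ∧
    Submodule.span ℍᵐᵒᵖ (Set.range b) = ⊤

theorem linearIndependent_of_orthonormal {n : ℕ} {b : Fin n → V}
    (h : ∀ i j, inner ℍ (b i) (b j) = if i = j then 1 else 0) : LinearIndependent ℍᵐᵒᵖ b := by
  rw [Fintype.linearIndependent_iff]
  intro g hg i
  have h1 := congrArg (inner ℍ (b i)) hg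
  rw [inner_sum_right, inner_zero_right] at h1
  have h2 : ∀ j, inner ℍ (b i) (g j • b j) = if i = j then (g j).unop else 0 := fun j => by
    have := inner_smul_right (b i) (b j) (g j).unop
    rw [MulOpposite.op_unop, h] at this
    rw [this]; split_ifs <;> simp
  simp only [h2, Finset.sum_ite_eq, Finset.mem_univ, if_true] at h1
  simpa using congrArg MulOpposite.op h1

theorem exists_orthonormal [Module.Finite ℍᵐᵒᵖ V] (n : ℕ) (hn : n ≤ Module.finrank ℍᵐᵒᵖ V) :
    ∃ b : Fin n → V, ∀ i j, inner ℍ (b i) (b j) = if i = j then 1 else 0 := by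
  induction n with
  | zero => exact ⟨Fin.elim0, fun i => i.elim0⟩
  | succ n ih =>
    obtain ⟨b, hb⟩ := ih (by omega)
    have hne : Submodule.span ℍᵐᵒᵖ (Set.range b) ≠ ⊤ := fun htop => by
      have h1 := finrank_span_eq_card (linearIndependent_of_orthonormal hb)
      rw [htop, finrank_top, Fintype.card_fin] at h1
      omega
    obtain ⟨v, -, hv⟩ := SetLike.exists_of_lt (lt_top_iff_ne_top.2 hne)
    set w : V := v - ∑ i, MulOpposite.op (inner ℍ (b i) v) • b i with hw
    have hw0 : w ≠ 0 := fun h0 => hv <| by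
      rw [sub_eq_zero.1 (hw.symm.trans h0)]
      exact Submodule.sum_mem _ fun i _ =>
        Submodule.smul_mem _ _ (Submodule.subset_span ⟨i, rfl⟩)
    have horth : ∀ i, inner ℍ (b i) w = 0 := fun i => by
      rw [hw, inner_sub_right, inner_sum_right]
      simp [inner_smul_right, hb]
    have horth' : ∀ i, inner ℍ w (b i) = 0 := fun i => by rw [← star_inner, horth, star_zero]
    have hnw : ‖w‖ ≠ 0 := norm_ne_zero_iff.2 hw0
    refine ⟨Fin.snoc b (MulOpposite.op ((‖w‖⁻¹ : ℝ) : ℍ) • w), fun i j => ?_⟩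
    induction i using Fin.lastCases with
    | last =>
      induction j using Fin.lastCases with
      | last =>
        rw [Fin.snoc_last, hinner_smul_smul, hinner_self, Quaternion.star_coe,
          ← Quaternion.coe_mul, ← Quaternion.coe_mul, if_pos rfl]
        rw [show ‖w‖⁻¹ * ‖w‖ ^ 2 * ‖w‖⁻¹ = 1 by field_simp, Quaternion.coe_one]
      | cast j =>
        rw [Fin.snoc_last, Fin.snoc_castSucc, inner_smul_left, horth', mul_zero,
          if_neg (Fin.castSucc_lt_last j).ne']
    | cast i =>
      induction j using Fin.lastCases with
      | last =>
        rw [Fin.snoc_last, Fin.snoc_castSucc, inner_smul_right, horth, zero_mul,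
          if_neg (Fin.castSucc_lt_last i).ne]
      | cast j => simp [hb]

variable (V) in
theorem exists_isOrthonormalBasis [Module.Finite ℍᵐᵒᵖ V] :
    ∃ b : Fin (Module.finrank ℍᵐᵒᵖ V) → V, IsOrthonormalBasis b := by
  obtain ⟨b, hb⟩ := exists_orthonormal (V := V) _ le_rfl
  refine ⟨b, hb, ?_⟩
  exact (linearIndependent_of_orthonormal hb).span_eq_top_of_card_eq_finrank' (by simp)

variable (V) in
/-- Some orthonormal basis of `V`. -/
def onb [Module.Finite ℍᵐᵒᵖ V] : Fin (Module.finrank ℍᵐᵒᵖ V) → V :=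
  (exists_isOrthonormalBasis V).choose

/-- The orthogonal projection `V → Q`, computed in some orthonormal basis of `Q`; it is
characterised by `inner_sub_orthProj` and does not depend on the basis. -/
def orthProj [Module.Finite ℍᵐᵒᵖ V] (Q : Submodule ℍᵐᵒᵖ V) : V →ₗ[ℍᵐᵒᵖ] Q where
  toFun v := ∑ i, MulOpposite.op (inner ℍ (onb Q i : V) v) • onb Q i
  map_add' v w := by
    simp only [hinner_add_right, MulOpposite.op_add, add_smul, Finset.sum_add_distrib]
  map_smul' q v := by
    have h : ∀ u : V, inner ℍ u (q • v) = inner ℍ u v * q.unop := fun u => by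
      rw [← inner_smul_right, MulOpposite.op_unop]
    simp only [h, MulOpposite.op_mul, MulOpposite.op_unop, mul_smul, Finset.smul_sum,
      RingHom.id_apply]

theorem inner_sub_orthProj [Module.Finite ℍᵐᵒᵖ V] (Q : Submodule ℍᵐᵒᵖ V) (v r : V) (hr : r ∈ Q) :
    inner ℍ (v - orthProj Q v) r = 0 := by
  have hb : IsOrthonormalBasis (onb Q) := (exists_isOrthonormalBasis Q).choose_spec
  have hi : ∀ i, inner ℍ (onb Q i : V) (v - orthProj Q v) = 0 := fun i => by
    have h1 : ∀ j, inner ℍ (onb Q i : V) (onb Q j : V) = if i = j then 1 else 0 := hb.1 i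
    have h2 : ((orthProj Q v : Q) : V) =
        ∑ j, MulOpposite.op (inner ℍ (onb Q j : V) v) • (onb Q j : V) := by
      simp [orthProj]
    rw [inner_sub_right, h2, inner_sum_right]
    simp [inner_smul_right, h1]
  have hr' : (⟨r, hr⟩ : Q) ∈ Submodule.span ℍᵐᵒᵖ (Set.range (onb Q)) := hb.2 ▸ Submodule.mem_top
  suffices h : ∀ x ∈ Submodule.span ℍᵐᵒᵖ (Set.range (onb Q)),
      inner ℍ (v - orthProj Q v) (x : V) = 0 from h _ hr'
  intro x hx
  induction hx using Submodule.span_induction with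
  | mem x hx =>
    obtain ⟨i, rfl⟩ := hx
    rw [← star_inner, hi, star_zero]
  | zero => exact inner_zero_right _
  | add x y _ _ hx hy => rw [Submodule.coe_add, hinner_add_right, hx, hy, add_zero]
  | smul a x _ hx =>
    have := inner_smul_right (v - orthProj Q v : V) (x : V) a.unop
    rwa [hx, zero_mul, MulOpposite.op_unop] at this

/-- The compression `k_R^R : R → R` of an endomorphism `k` to the subspace `R`. -/
def compression [Module.Finite ℍᵐᵒᵖ V] (k : V →ₗ[ℍᵐᵒᵖ] V) (R : Submodule ℍᵐᵒᵖ V) :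
    R →ₗ[ℍᵐᵒᵖ] R :=
  orthProj R ∘ₗ k ∘ₗ R.subtype

end Basic

/-! ### The quaternion determinant -/

/-- The real part of `M i₁ i₂ * M i₂ i₃ * ⋯ * M iᵣ i₁`, where `(i₁ i₂ ⋯ iᵣ)` is the cycle of `σ`
that starts at `i₁ = i`. -/
def cycleWeight {n : ℕ} (M : Matrix (Fin n) (Fin n) ℍ) (σ : Equiv.Perm (Fin n)) (i : Fin n) : ℝ :=
  ((List.range (Function.minimalPeriod σ i)).map
    fun t => M ((σ ^ t) i) ((σ ^ (t + 1)) i)).prod.re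

/-- The weight of a cycle does not depend on the point at which one starts. -/
theorem cycleWeight_apply {n : ℕ} (M : Matrix (Fin n) (Fin n) ℍ) (σ : Equiv.Perm (Fin n))
    (i : Fin n) : cycleWeight M σ (σ i) = cycleWeight M σ i := by
  have hper : i ∈ Function.periodicPts σ := by
    refine ⟨orderOf σ, orderOf_pos σ, ?_⟩
    rw [Function.IsPeriodicPt, Function.IsFixedPt, ← Equiv.Perm.coe_pow, pow_orderOf_eq_one]; rfl
  have hp := Function.minimalPeriod_pos_of_mem_periodicPts hper
  have hend : (σ ^ Function.minimalPeriod σ i) i = i := by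
    rw [Equiv.Perm.coe_pow]; exact Function.isPeriodicPt_minimalPeriod σ i
  have hs : ∀ t : ℕ, (σ ^ t) (σ i) = (σ ^ (t + 1)) i := fun t => by
    rw [pow_succ, Equiv.Perm.mul_apply]
  unfold cycleWeight
  rw [Function.minimalPeriod_apply hper]
  obtain ⟨p, hpp⟩ := Nat.exists_eq_succ_of_ne_zero hp.ne'
  rw [hpp] at hend ⊢
  conv_rhs => rw [Nat.succ_eq_add_one, List.range_succ_eq_map, List.map_cons, List.prod_cons,
    List.map_map]
  rw [List.range_succ, List.map_append, List.prod_append]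
  simp only [hs, Function.comp_def, List.map_cons, List.map_nil, List.prod_singleton,
    Nat.succ_eq_add_one] at hend ⊢
  have h2 : (σ ^ (p + 1 + 1)) i = σ i := by rw [pow_succ', Equiv.Perm.mul_apply, hend]
  rw [hend, h2, Quaternion.re_mul, Quaternion.re_mul]
  simp only [pow_zero, zero_add, pow_one, Equiv.Perm.one_apply]
  ring

theorem cycleWeight_eq_of_sameCycle {n : ℕ} (M : Matrix (Fin n) (Fin n) ℍ)
    (σ : Equiv.Perm (Fin n)) {i j : Fin n} (h : σ.SameCycle i j) :
    cycleWeight M σ i = cycleWeight M σ j := by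
  obtain ⟨t, -, rfl⟩ := h.exists_pow_eq'
  induction t with
  | zero => rfl
  | succ t ih =>
    rw [pow_succ', Equiv.Perm.mul_apply, cycleWeight_apply]
    exact ih ⟨t, by simp⟩

open Classical in
/-- The Moore determinant `det_ℜ M = ∑_σ ε(σ) ∏_c Re (M i₁ i₂ * ⋯ * M iᵣ i₁)`, the product being
over all the cycles `c = (i₁ ⋯ iᵣ)` of `σ`, fixed points included. -/
def mooreDet {n : ℕ} (M : Matrix (Fin n) (Fin n) ℍ) : ℝ :=
  ∑ σ : Equiv.Perm (Fin n), ((Equiv.Perm.sign σ : ℤ) : ℝ) *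
    ∏ c : Quotient (Equiv.Perm.SameCycle.setoid σ),
      Quotient.lift (cycleWeight M σ) (fun _ _ h => cycleWeight_eq_of_sameCycle M σ h) c

section Main

variable {V : Type*} [NormedAddCommGroup V] [Module ℍᵐᵒᵖ V] [QuaternionicInnerProductSpace V]

/-- The matrix `(⟨bᵢ, f bⱼ⟩)ᵢⱼ` of the endomorphism `f` in the orthonormal basis `b`. -/
def matrixOf {n : ℕ} (b : Fin n → V) (f : V →ₗ[ℍᵐᵒᵖ] V) : Matrix (Fin n) (Fin n) ℍ :=
  Matrix.of fun i j => inner ℍ (b i) (f (b j))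

/-- `det_ℜ f = x`: the Moore determinant of the matrix of `f` is `x` in every orthonormal basis. -/
def HasMooreDet (f : V →ₗ[ℍᵐᵒᵖ] V) (x : ℝ) : Prop :=
  ∀ (n : ℕ) (b : Fin n → V), IsOrthonormalBasis b → mooreDet (matrixOf b f) = x

/-- A kernel: a self-adjoint endomorphism, all of whose right eigenvalues are real numbers between
`0` and `1`. -/
structure IsKernel (k : V →ₗ[ℍᵐᵒᵖ] V) : Prop where
  selfAdjoint : ∀ v w : V, inner ℍ (k v) w = inner ℍ v (k w)
  eigenvalue : ∀ (q : ℍ) (v : V), v ≠ 0 → k v = MulOpposite.op q • v →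
    ∃ t : ℝ, 0 ≤ t ∧ t ≤ 1 ∧ q = (t : ℍ)

/-! ### Split Grassmannians -/

variable (V) in
/-- A splitting `(E₁, …, E_s)` of `V`: pairwise orthogonal subspaces of positive dimension
with sum `V`. -/
structure Splitting (s : ℕ) where
  parts : Fin s → Submodule ℍᵐᵒᵖ V
  ne_bot : ∀ i, parts i ≠ ⊥
  orthogonal : ∀ i j, i ≠ j → ∀ v ∈ parts i, ∀ w ∈ parts j, inner ℍ v w = 0
  iSup_eq_top : ⨆ i, parts i = ⊤

/-- The Grassmannian of all the subspaces of `V` adapted to the family `F = (F₁, …, F_s)`: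
those `Q` that are the sum of the `Q ∩ Fᵢ`. -/
def Gr {s : ℕ} (F : Fin s → Submodule ℍᵐᵒᵖ V) : Type _ :=
  {Q : Submodule ℍᵐᵒᵖ V // Q = ⨆ i, Q ⊓ F i}

theorem adapted_of_le {W : Type*} [NormedAddCommGroup W] [Module ℍᵐᵒᵖ W] {s : ℕ}
    {F : Fin s → Submodule ℍᵐᵒᵖ W} {Q : Submodule ℍᵐᵒᵖ W}
    (h : Q ≤ ⨆ i, Q ⊓ F i) : Q = ⨆ i, Q ⊓ F i :=
  le_antisymm h (iSup_le fun _ => inf_le_left)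

/-- The usual topology of the Grassmannian: subspaces converge when the orthogonal projections
onto them do. -/
instance grTopology [Module.Finite ℍᵐᵒᵖ V] {s : ℕ} (F : Fin s → Submodule ℍᵐᵒᵖ V) :
    TopologicalSpace (Gr F) :=
  TopologicalSpace.induced (fun (Q : Gr F) (v : V) => ((orthProj Q.1 v : Q.1) : V)) inferInstance

instance grMeasurableSpace [Module.Finite ℍᵐᵒᵖ V] {s : ℕ} (F : Fin s → Submodule ℍᵐᵒᵖ V) :
    MeasurableSpace (Gr F) := borel (Gr F)

/-- The family `(Q ∩ F₁, …, Q ∩ F_s)` of subspaces of `Q` induced by `F`. -/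
def induced {s : ℕ} (F : Fin s → Submodule ℍᵐᵒᵖ V) (Q : Submodule ℍᵐᵒᵖ V) :
    Fin s → Submodule ℍᵐᵒᵖ Q :=
  fun i => (F i).comap Q.subtype

/-- The inclusion of the Grassmannian of `Q` in the Grassmannian of `V`. -/
def Gr.incl {s : ℕ} (F : Fin s → Submodule ℍᵐᵒᵖ V) (Q : Submodule ℍᵐᵒᵖ V)
    (R : Gr (induced F Q)) : Gr F :=
  ⟨R.1.map Q.subtype, adapted_of_le <| by
    conv_lhs => rw [R.2, Submodule.map_iSup]
    refine iSup_mono fun i => le_inf (Submodule.map_mono inf_le_left) ?_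
    rw [Submodule.map_le_iff_le_comap]
    exact inf_le_right⟩

/-! ### The invariant measures -/

/-- The group `U(V, F)` of linear isometries of `V` that preserve each `Fᵢ`. -/
def isometryGroup {s : ℕ} (F : Fin s → Submodule ℍᵐᵒᵖ V) : Subgroup (V ≃ₗ[ℍᵐᵒᵖ] V) where
  carrier := {u | (∀ v w, inner ℍ (u v) (u w) = inner ℍ v w) ∧
    ∀ i, (F i).map (u : V →ₗ[ℍᵐᵒᵖ] V) = F i}
  mul_mem' := by
    rintro u u' ⟨h1, h2⟩ ⟨h1', h2'⟩
    refine ⟨fun v w => ?_, fun i => ?_⟩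
    · rw [LinearEquiv.mul_apply, LinearEquiv.mul_apply, h1, h1']
    · have : ((u * u' : V ≃ₗ[ℍᵐᵒᵖ] V) : V →ₗ[ℍᵐᵒᵖ] V) =
        (u : V →ₗ[ℍᵐᵒᵖ] V) ∘ₗ (u' : V →ₗ[ℍᵐᵒᵖ] V) := rfl
      rw [this, Submodule.map_comp, h2', h2]
  one_mem' := ⟨fun _ _ => rfl, fun i => Submodule.map_id _⟩
  inv_mem' := by
    rintro u ⟨h1, h2⟩
    refine ⟨fun v w => ?_, fun i => ?_⟩
    · rw [← h1]; simp
    · conv_lhs => rw [← h2 i]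
      rw [← Submodule.map_comp]
      have : ((u⁻¹ : V ≃ₗ[ℍᵐᵒᵖ] V) : V →ₗ[ℍᵐᵒᵖ] V) ∘ₗ (u : V →ₗ[ℍᵐᵒᵖ] V) = LinearMap.id :=
        LinearMap.ext fun v => u.symm_apply_apply v
      rw [this, Submodule.map_id]

/-- The topology of pointwise convergence on `U(V, F)`. -/
instance isometryGroupTopology {s : ℕ} (F : Fin s → Submodule ℍᵐᵒᵖ V) :
    TopologicalSpace (isometryGroup F) :=
  TopologicalSpace.induced (fun u (v : V) => u.1 v) inferInstance

theorem norm_isometryGroup {s : ℕ} {F : Fin s → Submodule ℍᵐᵒᵖ V} (u : isometryGroup F) (v : V) :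
    ‖u.1 v‖ = ‖v‖ := by
  have h := u.2.1 v v
  rw [QuaternionicInnerProductSpace.hinner_self, QuaternionicInnerProductSpace.hinner_self] at h
  exact (pow_left_inj₀ (by positivity) (by positivity) two_ne_zero).1 (Quaternion.coe_injective h)

instance isometryGroup_isTopologicalGroup {s : ℕ} (F : Fin s → Submodule ℍᵐᵒᵖ V) :
    IsTopologicalGroup (isometryGroup F) := by
  have hev : ∀ v : V, Continuous fun u : isometryGroup F => u.1 v := fun v =>
    (continuous_apply v).comp continuous_induced_dom
  have hsub : ∀ (u : isometryGroup F) (v w : V), u.1 v - u.1 w = u.1 (v - w) := fun u v w =>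
    (map_sub u.1 v w).symm
  refine { continuous_mul := ?_, continuous_inv := ?_ }
  · refine continuous_induced_rng.2 (continuous_pi fun v => ?_)
    refine continuous_iff_continuousAt.2 fun p => ?_
    refine tendsto_iff_norm_sub_tendsto_zero.2 ?_
    have h1 : Filter.Tendsto (fun q : isometryGroup F × isometryGroup F =>
        ‖q.2.1 v - p.2.1 v‖ + ‖q.1.1 (p.2.1 v) - p.1.1 (p.2.1 v)‖) (nhds p) (nhds 0) := by
      have hc : Continuous fun q : isometryGroup F × isometryGroup F =>
          ‖q.2.1 v - p.2.1 v‖ + ‖q.1.1 (p.2.1 v) - p.1.1 (p.2.1 v)‖ :=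
        ((((hev v).comp continuous_snd).sub continuous_const).norm).add
          ((((hev (p.2.1 v)).comp continuous_fst).sub continuous_const).norm)
      simpa using hc.tendsto p
    refine squeeze_zero (fun _ => norm_nonneg _) (fun q => ?_) h1
    have h2 : q.1.1 (q.2.1 v) - p.1.1 (p.2.1 v) =
        q.1.1 (q.2.1 v - p.2.1 v) + (q.1.1 (p.2.1 v) - p.1.1 (p.2.1 v)) := by
      rw [← hsub]; abel
    calc ‖q.1.1 (q.2.1 v) - p.1.1 (p.2.1 v)‖
        ≤ ‖q.1.1 (q.2.1 v - p.2.1 v)‖ + ‖q.1.1 (p.2.1 v) - p.1.1 (p.2.1 v)‖ := by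
          rw [h2]; exact norm_add_le _ _
      _ = _ := by rw [norm_isometryGroup]
  · refine continuous_induced_rng.2 (continuous_pi fun v => ?_)
    refine continuous_iff_continuousAt.2 fun p => ?_
    refine tendsto_iff_norm_sub_tendsto_zero.2 ?_
    have hc : Continuous fun q : isometryGroup F => ‖v - q.1 (p⁻¹.1 v)‖ :=
      (continuous_const.sub (hev _)).norm
    have h1 := hc.tendsto p
    have h0 : p.1 (p⁻¹.1 v) = v := p.1.apply_symm_apply v
    rw [h0, sub_self, norm_zero] at h1
    refine h1.congr fun q => ?_
    rw [← norm_isometryGroup q⁻¹, ← hsub]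
    have h3 : q⁻¹.1 (q.1 (p⁻¹.1 v)) = p⁻¹.1 v := q.1.symm_apply_apply _
    rw [h3]; rfl

instance isometryGroup_compactSpace [Module.Finite ℍᵐᵒᵖ V] {s : ℕ}
    (F : Fin s → Submodule ℍᵐᵒᵖ V) : CompactSpace (isometryGroup F) := by
  have hind : Topology.IsInducing fun (u : isometryGroup F) (v : V) => u.1 v := ⟨rfl⟩
  have := properSpace (V := V)
  let S : Set (V → V) := {g | (∀ v w, g (v + w) = g v + g w) ∧
    (∀ (q : ℍ) (v : V), g (MulOpposite.op q • v) = MulOpposite.op q • g v) ∧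
    (∀ v w, inner ℍ (g v) (g w) = inner ℍ v w) ∧ ∀ i, ∀ v ∈ F i, g v ∈ F i}
  have hSc : IsClosed S := by
    simp only [S, Set.ofPred_and, Set.ofPred_forall]
    refine .inter ?_ (.inter ?_ (.inter ?_ ?_))
    · exact isClosed_iInter fun v => isClosed_iInter fun w =>
        isClosed_eq (continuous_apply _) (by fun_prop)
    · exact isClosed_iInter fun q => isClosed_iInter fun v =>
        isClosed_eq (continuous_apply _) ((continuous_smul_op q).comp (continuous_apply v))
    · exact isClosed_iInter fun v => isClosed_iInter fun w =>
        isClosed_eq (continuous_inner_fun.comp (f := fun g : V → V => (g v, g w)) (by fun_prop))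
          continuous_const
    · exact isClosed_iInter fun i => isClosed_iInter fun v => isClosed_iInter fun _ =>
        (isClosed_submodule (F i)).preimage (continuous_apply v)
  have hnorm : ∀ g ∈ S, ∀ v, ‖g v‖ = ‖v‖ := fun g hg v => by
    have h := hg.2.2.1 v v
    rw [QuaternionicInnerProductSpace.hinner_self,
      QuaternionicInnerProductSpace.hinner_self] at h
    exact (pow_left_inj₀ (by positivity) (by positivity) two_ne_zero).1
      (Quaternion.coe_injective h)
  have hScpt : IsCompact S :=
    (isCompact_univ_pi fun v : V => isCompact_closedBall (0 : V) ‖v‖).of_isClosed_subset hSc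
      fun g hg v _ => by simp [hnorm g hg v]
  have hrange : (fun (u : isometryGroup F) (v : V) => u.1 v) '' Set.univ = S := by
    ext g
    constructor
    · rintro ⟨u, -, rfl⟩
      refine ⟨fun v w => map_add u.1 v w, fun q v => map_smul u.1 _ v, u.2.1, fun i v hv => ?_⟩
      have : u.1 v ∈ (F i).map (u.1 : V →ₗ[ℍᵐᵒᵖ] V) := ⟨v, hv, rfl⟩
      rwa [u.2.2 i] at this
    · intro hg
      let f : V →ₗ[ℍᵐᵒᵖ] V :=
        { toFun := g
          map_add' := hg.1
          map_smul' := fun q v => hg.2.1 q.unop v }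
      have hinj : Function.Injective f := by
        refine (injective_iff_map_eq_zero f).2 fun v hv => ?_
        rw [← norm_eq_zero, ← hnorm g hg v]
        exact norm_eq_zero.2 hv
      refine ⟨⟨LinearEquiv.ofInjectiveEndo f hinj, hg.2.2.1, fun i => ?_⟩, trivial, rfl⟩
      refine Submodule.eq_of_le_of_finrank_eq ?_ ?_
      · rintro _ ⟨v, hv, rfl⟩
        exact hg.2.2.2 i v hv
      · exact LinearEquiv.finrank_map_eq _ _
  rw [← isCompact_univ_iff, hind.isCompact_iff, hrange]
  exact hScpt

instance isometryGroupMeasurableSpace {s : ℕ} (F : Fin s → Submodule ℍᵐᵒᵖ V) :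
    MeasurableSpace (isometryGroup F) := borel _

instance isometryGroup_borelSpace {s : ℕ} (F : Fin s → Submodule ℍᵐᵒᵖ V) :
    BorelSpace (isometryGroup F) := ⟨rfl⟩

/-- The Haar probability measure of the compact group `U(V, F)`. -/
def haarProb [Module.Finite ℍᵐᵒᵖ V] {s : ℕ} (F : Fin s → Submodule ℍᵐᵒᵖ V) :
    Measure (isometryGroup F) :=
  Measure.haarMeasure ⊤

/-- An orthonormal basis of `V` adapted to the family `F`, obtained from orthonormal bases of
the `Fᵢ`. -/
def adaptedBasis [Module.Finite ℍᵐᵒᵖ V] {s : ℕ} (F : Fin s → Submodule ℍᵐᵒᵖ V)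
    (a : Σ i, Fin (Module.finrank ℍᵐᵒᵖ (F i))) : V :=
  (onb (F a.1) a.2 : V)

/-- The subspace `u(E_J)`, where `E_J` is spanned by the vectors of the adapted basis indexed
by `J`. -/
def Gr.coord [Module.Finite ℍᵐᵒᵖ V] {s : ℕ} (F : Fin s → Submodule ℍᵐᵒᵖ V)
    (J : Finset (Σ i, Fin (Module.finrank ℍᵐᵒᵖ (F i)))) (u : isometryGroup F) : Gr F :=
  ⟨(Submodule.span ℍᵐᵒᵖ (adaptedBasis F '' J)).map (u.1 : V →ₗ[ℍᵐᵒᵖ] V), adapted_of_le <| by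
    rw [Submodule.map_span, Submodule.span_le]
    rintro _ ⟨_, ⟨a, ha, rfl⟩, rfl⟩
    refine Submodule.mem_iSup_of_mem a.1 ⟨Submodule.subset_span ⟨_, ⟨a, ha, rfl⟩, rfl⟩, ?_⟩
    rw [← u.2.2 a.1]
    exact ⟨_, (onb (F a.1) a.2).2, rfl⟩⟩

/-- The invariant measure `ν^{V,F}` of the Grassmannian, for a family `F` of pairwise orthogonal
subspaces with sum `V`: the average `∫ ∑_J δ_{u(E_J)} du` over the group `U(V, F)`. On
the component of all `Q` with `dim (Q ∩ Fᵢ) = nᵢ`, it is the invariant measure of total mass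
`∏ᵢ binom(dim Fᵢ, nᵢ)`. -/
def invariantMeasure [Module.Finite ℍᵐᵒᵖ V] {s : ℕ} (F : Fin s → Submodule ℍᵐᵒᵖ V) :
    Measure (Gr F) :=
  ∑ J : Finset (Σ i, Fin (Module.finrank ℍᵐᵒᵖ (F i))), (haarProb F).map (Gr.coord F J)

/-! ### Determinantal linear processes -/

/-- The incidence measure `Zμ = ∫ ν^{Q, F_Q} dμ(Q)`, where `ν^{Q, F_Q}` is seen as a measure on the
Grassmannian of `V`. -/
def incidenceMeasure [Module.Finite ℍᵐᵒᵖ V] {s : ℕ} {F : Fin s → Submodule ℍᵐᵒᵖ V}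
    (μ : Measure (Gr F)) : Measure (Gr F) :=
  μ.bind fun Q => (invariantMeasure (induced F Q.1)).map (Gr.incl F Q.1)

/-- `μ` is determinantal with kernel `k`: it is a probability measure, the determinants
`D R = det_ℜ (k_R^R)` are well defined, nonnegative and depend measurably on `R`, and
`dZμ(R) = det_ℜ (k_R^R) dν(R)`. -/
def IsDLP [Module.Finite ℍᵐᵒᵖ V] {s : ℕ} (σ : Splitting V s) (k : V →ₗ[ℍᵐᵒᵖ] V)
    (μ : Measure (Gr σ.parts)) : Prop :=
  IsProbabilityMeasure μ ∧
    ∃ D : Gr σ.parts → ℝ, (∀ R, HasMooreDet (compression k R.1) (D R)) ∧ (∀ R, 0 ≤ D R) ∧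
      Measurable D ∧
      incidenceMeasure μ = (invariantMeasure σ.parts).withDensity fun R => ENNReal.ofReal (D R)

end Main

end QuatDLP

end

noncomputable section

/-! ### Combinatorics of the Moore determinant of a matrix -/

namespace QuatDLP

/-! ### Products over the cycles of a permutation -/

/-! Existence. Fix an isometry `u` in `U(E, σ)` and the orthonormal basis `u(e_a)`. The determinants
of the compressions of `k` to the spans `u(E_J)` are the principal Moore minors of the matrix of `k`
in this basis. A determinantal process on the index set should therefore select `K` with the weight
given by Möbius inversion, `∑_{J ⊇ K} (-1)^|J \ K| det k_{u(E_J)}`; this is `orbitDensity`. The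
alternating sum collapses to `(-1)^|Kᶜ| det (k - P)`, where `P` is the orthogonal projection onto
the span of the basis vectors outside `K` (`sum_mooreDet_principalMatrix`). Since `0 ≤ k ≤ 1`, the
quadratic form of `k - P` is nonpositive on that span and nonnegative on its complement, so the
number of negative eigenvalues is forced unless `0` is an eigenvalue, and the weights are
nonnegative (`IsKernel.mooreDet_sub_diagonal_nonneg`). They add up to the minor with `J = ∅`, which
is `1`. The measure `μ` is the law of `u(E_K)` when `u` is Haar distributed and, given `u`, the set
`K` is selected with these weights.

Incidence. The measure `ν` of the Grassmannian of `u(E_K)` is the sum over `L ⊆ K` of the laws of `u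
h (E_L)`, where `h` is a Haar distributed isometry of `E_K` extended by the identity
(`incidenceKernel_coord`). The weight of `K` involves only the `E_J` with `J ⊇ K`, all of which are
preserved by `h`, so right invariance of the Haar measure absorbs `h`
(`lintegral_mul_incidenceKernel`). Thus `Zμ` is the sum over `L` of the images of `du` by `u ↦
u(E_L)`, weighted by the sum of the weights of all `K ⊇ L`, and this sum is `det k_{u(E_L)}` by
Möbius inversion.

Uniqueness. Among the subspaces of `Q` of dimension at least `dim Q` there is only `Q` itself, with
mass `1`. So `Z` is unitriangular for the grading by dimension, and `μ` is recovered from `Zμ` by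
descending induction (`incidenceMeasure_injective`).

Linear algebra. What remains is that the Moore determinant of a self-adjoint endomorphism does not
depend on the orthonormal basis; it is then the product of the eigenvalues. The sum of the
determinants over all families `b ∘ f` drawn from a basis `b` is a combination of iterated real
traces, hence independent of `b`. On the other hand, it is `n!` times the determinant in the basis
`b`, because a Hermitian matrix with two equal rows has Moore determinant zero
(`mooreDet_eq_zero_of_row_eq`). -/

/-- The product of the matrix entries along the first `p` steps of the orbit of `i`. -/
def pathProd {n : ℕ} (M : Matrix (Fin n) (Fin n) ℍ) (π : Equiv.Perm (Fin n)) (i : Fin n) (p : ℕ) :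
    ℍ :=
  ((List.range p).map fun t => M ((π ^ t) i) ((π ^ (t + 1)) i)).prod

theorem cycleWeight_eq {n : ℕ} (M : Matrix (Fin n) (Fin n) ℍ) (π : Equiv.Perm (Fin n)) (i : Fin n) :
    cycleWeight M π i = (pathProd M π i (Function.minimalPeriod π i)).re := rfl

theorem pathProd_congr {n : ℕ} {M N : Matrix (Fin n) (Fin n) ℍ} {π ρ : Equiv.Perm (Fin n)}
    {i j : Fin n} {p : ℕ}
    (h : ∀ t < p, M ((π ^ t) i) ((π ^ (t + 1)) i) = N ((ρ ^ t) j) ((ρ ^ (t + 1)) j)) :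
    pathProd M π i p = pathProd N ρ j p := by
  unfold pathProd
  congr 1
  exact List.map_congr_left fun t ht => h t (List.mem_range.1 ht)

theorem pathProd_add {n : ℕ} (M : Matrix (Fin n) (Fin n) ℍ) (π : Equiv.Perm (Fin n)) (i : Fin n)
    (p q : ℕ) : pathProd M π i (p + q) = pathProd M π i p * pathProd M π ((π ^ p) i) q := by
  unfold pathProd
  rw [List.range_add, List.map_append, List.prod_append, List.map_map]
  congr 2
  refine List.map_congr_left fun t _ => ?_
  simp only [Function.comp_apply, ← Equiv.Perm.mul_apply, ← pow_add]
  congr 3 <;> ring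

theorem pathProd_succ {n : ℕ} (M : Matrix (Fin n) (Fin n) ℍ) (π : Equiv.Perm (Fin n)) (i : Fin n)
    (p : ℕ) :
    pathProd M π i (p + 1) = pathProd M π i p * M ((π ^ p) i) ((π ^ (p + 1)) i) := by
  simp [pathProd, List.range_succ]

theorem pathProd_succ' {n : ℕ} (M : Matrix (Fin n) (Fin n) ℍ) (π : Equiv.Perm (Fin n)) (i : Fin n)
    (p : ℕ) :
    pathProd M π i (p + 1) = M i (π i) * pathProd M π (π i) p := by
  rw [add_comm, pathProd_add, pathProd_succ]
  simp [pathProd]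

theorem isPeriodicPt_perm_iff {n : ℕ} (π : Equiv.Perm (Fin n)) (i : Fin n) (t : ℕ) :
    Function.IsPeriodicPt π t i ↔ (π ^ t) i = i := by
  rw [Function.IsPeriodicPt, Function.IsFixedPt, Equiv.Perm.coe_pow]

theorem minimalPeriod_perm_pos {n : ℕ} (π : Equiv.Perm (Fin n)) (i : Fin n) :
    0 < Function.minimalPeriod π i :=
  Function.minimalPeriod_pos_of_mem_periodicPts
    ⟨orderOf π, orderOf_pos π, (isPeriodicPt_perm_iff _ _ _).2 (by rw [pow_orderOf_eq_one]; rfl)⟩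

theorem pow_minimalPeriod_apply {n : ℕ} (π : Equiv.Perm (Fin n)) (i : Fin n) :
    (π ^ Function.minimalPeriod π i) i = i :=
  (isPeriodicPt_perm_iff _ _ _).1 (Function.isPeriodicPt_minimalPeriod π i)

theorem minimalPeriod_congr {n : ℕ} {π ρ : Equiv.Perm (Fin n)} {i j : Fin n}
    (h : ∀ t : ℕ, (π ^ t) i = i ↔ (ρ ^ t) j = j) :
    Function.minimalPeriod π i = Function.minimalPeriod ρ j :=
  Function.minimalPeriod_eq_minimalPeriod_iff.2 fun t => by
    rw [isPeriodicPt_perm_iff, isPeriodicPt_perm_iff, h]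

theorem minimalPeriod_eq_of_forall {n : ℕ} {π : Equiv.Perm (Fin n)} {i : Fin n} {p : ℕ}
    (h0 : 0 < p) (hp : (π ^ p) i = i) (h : ∀ t, 0 < t → t < p → (π ^ t) i ≠ i) :
    Function.minimalPeriod π i = p := by
  refine le_antisymm (Function.IsPeriodicPt.minimalPeriod_le h0
    ((isPeriodicPt_perm_iff _ _ _).2 hp)) (not_lt.1 fun hlt => ?_)
  exact h _ (minimalPeriod_perm_pos π i) hlt (pow_minimalPeriod_apply π i)

theorem pow_apply_ne_self {n : ℕ} {π : Equiv.Perm (Fin n)} {i : Fin n} {t : ℕ}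
    (h0 : 0 < t) (h : t < Function.minimalPeriod π i) : (π ^ t) i ≠ i := fun he =>
  absurd (Function.IsPeriodicPt.minimalPeriod_le h0 ((isPeriodicPt_perm_iff _ _ _).2 he))
    (not_le.2 h)

theorem cycleWeight_congr {n : ℕ} {M N : Matrix (Fin n) (Fin n) ℍ} {π ρ : Equiv.Perm (Fin n)}
    {i : Fin n} (h : ∀ t : ℕ, (π ^ t) i = (ρ ^ t) i)
    (hMN : ∀ t : ℕ, M ((π ^ t) i) ((π ^ (t + 1)) i) = N ((π ^ t) i) ((π ^ (t + 1)) i)) :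
    cycleWeight M π i = cycleWeight N ρ i := by
  rw [cycleWeight_eq, cycleWeight_eq, minimalPeriod_congr (ρ := ρ) (j := i) (fun t => by rw [h t])]
  refine congrArg (fun x : ℍ => x.re) (pathProd_congr fun t _ => ?_)
  rw [hMN, h, h]

open Classical in
/-- The product of the weights of the cycles of `π`. -/
def permWeight {n : ℕ} (M : Matrix (Fin n) (Fin n) ℍ) (π : Equiv.Perm (Fin n)) : ℝ :=
  ∏ c : Quotient (Equiv.Perm.SameCycle.setoid π),
    Quotient.lift (cycleWeight M π) (fun _ _ h => cycleWeight_eq_of_sameCycle M π h) c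

theorem mooreDet_eq {n : ℕ} (M : Matrix (Fin n) (Fin n) ℍ) :
    mooreDet M = ∑ π : Equiv.Perm (Fin n), ((Equiv.Perm.sign π : ℤ) : ℝ) * permWeight M π := by
  unfold mooreDet permWeight
  refine Finset.sum_congr rfl fun π _ => ?_
  congr!

/-- `R` contains exactly one point of each cycle of `π`. -/
def IsTransversal {n : ℕ} (π : Equiv.Perm (Fin n)) (R : Finset (Fin n)) : Prop :=
  (∀ i, ∃ r ∈ R, π.SameCycle r i) ∧ ∀ r ∈ R, ∀ r' ∈ R, π.SameCycle r r' → r = r'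

/-- A set of representatives turns the product over a quotient into a product over points, from
which the factors of chosen points can be split off. -/
theorem IsTransversal.permWeight_eq {n : ℕ} {π : Equiv.Perm (Fin n)} {R : Finset (Fin n)}
    (hR : IsTransversal π R) (M : Matrix (Fin n) (Fin n) ℍ) :
    permWeight M π = ∏ i ∈ R, cycleWeight M π i := by
  classical
  symm
  refine Finset.prod_bij (fun i _ => (Quotient.mk _ i : Quotient (Equiv.Perm.SameCycle.setoid π)))
    (fun _ _ => Finset.mem_univ _) (fun r hr r' hr' h => hR.2 r hr r' hr' (Quotient.exact h))
    (fun c _ => ?_) (fun i _ => rfl)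
  induction c using Quotient.inductionOn with
  | h i =>
    obtain ⟨r, hr, h⟩ := hR.1 i
    exact ⟨r, hr, Quotient.sound h⟩

/-- The cycles that miss `S` are represented by `Quotient.out`. Prescribing `S` makes it possible to
start the cycles under study at given points. -/
theorem exists_isTransversal {n : ℕ} (π : Equiv.Perm (Fin n)) (S : Finset (Fin n))
    (hS : ∀ r ∈ S, ∀ r' ∈ S, π.SameCycle r r' → r = r') : ∃ R, S ⊆ R ∧ IsTransversal π R := by
  classical
  let o : Fin n → Fin n := fun i =>
    (Quotient.mk _ i : Quotient (Equiv.Perm.SameCycle.setoid π)).out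
  have ho : ∀ i, π.SameCycle (o i) i := fun i =>
    Quotient.exact (Quotient.out_eq (Quotient.mk (Equiv.Perm.SameCycle.setoid π) i))
  have ho' : ∀ i j, π.SameCycle i j → o i = o j := fun i j h => by
    have : (Quotient.mk (Equiv.Perm.SameCycle.setoid π) i) = Quotient.mk _ j := Quotient.sound h
    simp only [o, this]
  have hoo : ∀ i, o (o i) = o i := fun i => ho' _ _ (ho i)
  refine ⟨S ∪ Finset.univ.filter fun i => o i = i ∧ ∀ s ∈ S, ¬ π.SameCycle s i,
    Finset.subset_union_left, fun i => ?_, fun r hr r' hr' h => ?_⟩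
  · by_cases h : ∃ s ∈ S, π.SameCycle s i
    · obtain ⟨s, hs, h⟩ := h
      exact ⟨s, Finset.mem_union_left _ hs, h⟩
    · push Not at h
      refine ⟨o i, Finset.mem_union_right _ ?_, ho i⟩
      simp only [Finset.mem_filter, Finset.mem_univ, true_and]
      exact ⟨hoo i, fun s hs hsi => h s hs (hsi.trans (ho i))⟩
  · simp only [Finset.mem_union, Finset.mem_filter, Finset.mem_univ, true_and] at hr hr'
    rcases hr with hr | hr <;> rcases hr' with hr' | hr'
    · exact hS r hr r' hr' h
    · exact absurd h (hr'.2 r hr)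
    · exact absurd h.symm (hr.2 r' hr')
    · rw [← hr.1, ← hr'.1, ho' _ _ h]

theorem sameCycle_of_pow_congr {n : ℕ} {π ρ : Equiv.Perm (Fin n)} {i j : Fin n}
    (h : ∀ t : ℕ, (π ^ t) i = (ρ ^ t) i) (hij : π.SameCycle i j) : ρ.SameCycle i j := by
  obtain ⟨t, -, rfl⟩ := hij.exists_pow_eq'
  exact ⟨t, by rw [zpow_natCast, h]⟩

/-! ### Merging two cycles -/

/-- The transposition acts first, so a step from `b` is a step of `π` from `a`. The orbit then
follows the cycle of `a`, which avoids `b`, until it closes up at `a`; the next step jumps into the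
cycle of `b`. Thus the two cycles become one. -/
theorem mul_swap_pow_apply {n : ℕ} {π : Equiv.Perm (Fin n)} {a b : Fin n}
    (hab : ¬ π.SameCycle a b) {t : ℕ} (ht : t < Function.minimalPeriod π a) :
    ((π * Equiv.swap a b) ^ (t + 1)) b = (π ^ (t + 1)) a := by
  induction t with
  | zero => simp
  | succ t ih =>
    rw [pow_succ', Equiv.Perm.mul_apply, ih (by omega), Equiv.Perm.mul_apply,
      Equiv.swap_apply_of_ne_of_ne (pow_apply_ne_self (Nat.succ_pos t) ht), pow_succ' π (t + 1),
      Equiv.Perm.mul_apply]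
    exact fun h => hab ⟨(t + 1 : ℕ), by rw [zpow_natCast, h]⟩

theorem mul_swap_pow_apply' {n : ℕ} {π : Equiv.Perm (Fin n)} {a b : Fin n}
    (hab : ¬ π.SameCycle a b) {t : ℕ} (ht : t < Function.minimalPeriod π b) :
    ((π * Equiv.swap a b) ^ (t + 1)) a = (π ^ (t + 1)) b := by
  rw [Equiv.swap_comm]
  exact mul_swap_pow_apply (fun h => hab h.symm) ht

theorem mul_swap_pow_minimalPeriod {n : ℕ} {π : Equiv.Perm (Fin n)} {a b : Fin n}
    (hab : ¬ π.SameCycle a b) :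
    ((π * Equiv.swap a b) ^ Function.minimalPeriod π a) b = a := by
  obtain ⟨p, hp⟩ := Nat.exists_eq_succ_of_ne_zero (minimalPeriod_perm_pos π a).ne'
  have h := mul_swap_pow_apply hab (t := p) (by omega)
  rw [← Nat.succ_eq_add_one, ← hp, pow_minimalPeriod_apply] at h
  exact h

theorem mul_swap_pow_minimalPeriod' {n : ℕ} {π : Equiv.Perm (Fin n)} {a b : Fin n}
    (hab : ¬ π.SameCycle a b) :
    ((π * Equiv.swap a b) ^ Function.minimalPeriod π b) a = b := by
  rw [Equiv.swap_comm]
  exact mul_swap_pow_minimalPeriod (fun h => hab h.symm)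

theorem minimalPeriod_mul_swap {n : ℕ} {π : Equiv.Perm (Fin n)} {a b : Fin n}
    (hab : ¬ π.SameCycle a b) :
    Function.minimalPeriod (π * Equiv.swap a b) b =
      Function.minimalPeriod π a + Function.minimalPeriod π b := by
  refine minimalPeriod_eq_of_forall (Nat.add_pos_left (minimalPeriod_perm_pos _ _) _) ?_ ?_
  · rw [add_comm, pow_add, Equiv.Perm.mul_apply, mul_swap_pow_minimalPeriod hab,
      mul_swap_pow_minimalPeriod' hab]
  · intro t ht0 ht h
    obtain ⟨t, rfl⟩ := Nat.exists_eq_succ_of_ne_zero ht0.ne'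
    rw [Nat.succ_eq_add_one] at *
    rcases lt_or_ge t (Function.minimalPeriod π a) with hta | hta
    · rw [mul_swap_pow_apply hab hta] at h
      exact hab ⟨(t + 1 : ℕ), by rw [zpow_natCast, h]⟩
    · obtain ⟨u, rfl⟩ := Nat.exists_eq_add_of_le' hta
      rw [add_right_comm, pow_add, Equiv.Perm.mul_apply, mul_swap_pow_minimalPeriod hab,
        mul_swap_pow_apply' hab (by omega)] at h
      exact pow_apply_ne_self (Nat.succ_pos u) (by omega) h

/-- The two paths differ only in their first entry, which is in row `b` for one and in row `a` for
the other. -/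
theorem pathProd_mul_swap {n : ℕ} {N : Matrix (Fin n) (Fin n) ℍ} {π : Equiv.Perm (Fin n)}
    {a b : Fin n} (hN : ∀ i, N a i = N b i) (hab : ¬ π.SameCycle a b) :
    pathProd N (π * Equiv.swap a b) b (Function.minimalPeriod π a) =
      pathProd N π a (Function.minimalPeriod π a) := by
  refine pathProd_congr fun t ht => ?_
  rw [mul_swap_pow_apply hab ht]
  cases t with
  | zero => simp [hN]
  | succ t => rw [mul_swap_pow_apply hab (by omega)]

theorem cycleWeight_mul_swap {n : ℕ} {N : Matrix (Fin n) (Fin n) ℍ} {π : Equiv.Perm (Fin n)}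
    {a b : Fin n} (hN : ∀ i, N a i = N b i) (hab : ¬ π.SameCycle a b) :
    cycleWeight N (π * Equiv.swap a b) b =
      (pathProd N π a (Function.minimalPeriod π a) *
        pathProd N π b (Function.minimalPeriod π b)).re := by
  rw [cycleWeight_eq, minimalPeriod_mul_swap hab, pathProd_add, pathProd_mul_swap hN hab,
    mul_swap_pow_minimalPeriod hab]
  congr 2
  rw [Equiv.swap_comm]
  exact pathProd_mul_swap (fun i => (hN i).symm) (fun h => hab h.symm)

theorem mul_swap_pow_of_not_sameCycle {n : ℕ} {π : Equiv.Perm (Fin n)} {a b r : Fin n}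
    (ha : ¬ π.SameCycle a r) (hb : ¬ π.SameCycle b r) (t : ℕ) :
    ((π * Equiv.swap a b) ^ t) r = (π ^ t) r := by
  induction t with
  | zero => rfl
  | succ t ih =>
    rw [pow_succ', Equiv.Perm.mul_apply, ih, Equiv.Perm.mul_apply, Equiv.swap_apply_of_ne_of_ne,
      pow_succ' π, Equiv.Perm.mul_apply]
    · exact fun h => ha (Equiv.Perm.SameCycle.symm ⟨t, by rw [zpow_natCast, h]⟩)
    · exact fun h => hb (Equiv.Perm.SameCycle.symm ⟨t, by rw [zpow_natCast, h]⟩)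

theorem sameCycle_mul_swap {n : ℕ} {π : Equiv.Perm (Fin n)} {a b : Fin n}
    (hab : ¬ π.SameCycle a b) : (π * Equiv.swap a b).SameCycle a b :=
  ⟨(Function.minimalPeriod π b : ℕ), by rw [zpow_natCast, mul_swap_pow_minimalPeriod' hab]⟩

theorem sameCycle_mul_swap_of_sameCycle {n : ℕ} {π : Equiv.Perm (Fin n)} {a b i : Fin n}
    (hab : ¬ π.SameCycle a b) (h : π.SameCycle a i) : (π * Equiv.swap a b).SameCycle b i := by
  obtain ⟨s, -, rfl⟩ := h.exists_pow_eq'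
  rw [Equiv.Perm.coe_pow, ← Function.iterate_mod_minimalPeriod_eq, ← Equiv.Perm.coe_pow]
  have hlt := Nat.mod_lt s (minimalPeriod_perm_pos π a)
  rcases Nat.eq_zero_or_pos (s % Function.minimalPeriod π a) with h0 | h0
  · rw [h0]
    exact (sameCycle_mul_swap hab).symm
  · obtain ⟨t, ht⟩ := Nat.exists_eq_succ_of_ne_zero h0.ne'
    rw [ht]
    exact ⟨(t + 1 : ℕ), by rw [zpow_natCast, mul_swap_pow_apply hab (by omega)]⟩

/-- Converse to merging. With `k` the least exponent for which `π ^ k` maps `a` to `b`, the orbit of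
`b` under the product follows the orbit of `a` under `π` and closes up at `b` after `k` steps
without meeting `a`: the cycle splits. -/
theorem not_sameCycle_mul_swap {n : ℕ} {π : Equiv.Perm (Fin n)} {a b : Fin n} (hne : a ≠ b)
    (h : π.SameCycle a b) : ¬ (π * Equiv.swap a b).SameCycle a b := by
  have hex : ∃ k : ℕ, (π ^ k) a = b := by
    obtain ⟨k, -, hk⟩ := h.exists_pow_eq'
    exact ⟨k, hk⟩
  classical
  set k := Nat.find hex with hkdef
  have hk : (π ^ k) a = b := Nat.find_spec hex
  have hmin : ∀ t < k, (π ^ t) a ≠ b := fun t ht => Nat.find_min hex ht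
  have hk0 : 0 < k := Nat.pos_of_ne_zero fun h0 => hne (by rw [← hk, h0]; rfl)
  have hmin' : ∀ t, 0 < t → t < k → (π ^ t) a ≠ a := fun t ht0 ht hta => by
    refine hmin (k - t) (by omega) ?_
    rw [← hk]
    conv_rhs => rw [← Nat.sub_add_cancel ht.le, pow_add, Equiv.Perm.mul_apply, hta]
  have hpow : ∀ t < k, ((π * Equiv.swap a b) ^ (t + 1)) b = (π ^ (t + 1)) a := by
    intro t
    induction t with
    | zero => simp
    | succ t ih =>
      intro ht
      rw [pow_succ', Equiv.Perm.mul_apply, ih (by omega), Equiv.Perm.mul_apply,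
        Equiv.swap_apply_of_ne_of_ne (hmin' _ (Nat.succ_pos t) ht) (hmin _ ht), pow_succ' π (t + 1),
        Equiv.Perm.mul_apply]
  obtain ⟨m, hm⟩ := Nat.exists_eq_succ_of_ne_zero hk0.ne'
  have hper : Function.IsPeriodicPt (π * Equiv.swap a b) k b := by
    rw [isPeriodicPt_perm_iff, hm, Nat.succ_eq_add_one, hpow m (by omega), ← Nat.succ_eq_add_one,
      ← hm, hk]
  intro hs
  obtain ⟨t, -, ht⟩ := hs.symm.exists_pow_eq'
  rw [Equiv.Perm.coe_pow, ← hper.iterate_mod_apply, ← Equiv.Perm.coe_pow] at ht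
  have hlt := Nat.mod_lt t hk0
  rcases Nat.eq_zero_or_pos (t % k) with h0 | h0
  · rw [h0] at ht
    exact hne ht.symm
  · obtain ⟨r, hr⟩ := Nat.exists_eq_succ_of_ne_zero h0.ne'
    rw [hr, Nat.succ_eq_add_one, hpow r (by omega)] at ht
    exact hmin' (r + 1) (Nat.succ_pos r) (by omega) ht

theorem IsTransversal.mul_swap {n : ℕ} {π : Equiv.Perm (Fin n)} {a b : Fin n}
    (hab : ¬ π.SameCycle a b) {R : Finset (Fin n)} (hR : IsTransversal π R) (ha : a ∈ R)
    (hb : b ∈ R) : IsTransversal (π * Equiv.swap a b) (R.erase a) := by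
  have hne : b ≠ a := fun h => hab (h ▸ Equiv.Perm.SameCycle.refl _ _)
  have hout : ∀ r ∈ R.erase a, r ≠ b → ∀ t : ℕ, ((π * Equiv.swap a b) ^ t) r = (π ^ t) r :=
    fun r hr hrb => mul_swap_pow_of_not_sameCycle
      (fun h => (Finset.mem_erase.1 hr).1 (hR.2 a ha r (Finset.mem_of_mem_erase hr) h).symm)
      (fun h => hrb (hR.2 b hb r (Finset.mem_of_mem_erase hr) h).symm)
  refine ⟨fun i => ?_, ?_⟩
  · obtain ⟨r, hr, h⟩ := hR.1 i
    by_cases hra : r = a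
    · subst hra
      exact ⟨b, Finset.mem_erase.2 ⟨hne, hb⟩, sameCycle_mul_swap_of_sameCycle hab h⟩
    have hr' := Finset.mem_erase.2 ⟨hra, hr⟩
    by_cases hrb : r = b
    · subst hrb
      refine ⟨r, hr', (sameCycle_mul_swap hab).symm.trans ?_⟩
      rw [Equiv.swap_comm]
      exact sameCycle_mul_swap_of_sameCycle (fun h => hab h.symm) h
    · exact ⟨r, hr', sameCycle_of_pow_congr (fun t => (hout r hr' hrb t).symm) h⟩
  · intro r hr r' hr' h
    by_cases hrb : r = b
    · by_cases hrb' : r' = b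
      · rw [hrb, hrb']
      · exact hR.2 _ (Finset.mem_of_mem_erase hr) _ (Finset.mem_of_mem_erase hr')
          (sameCycle_of_pow_congr (hout r' hr' hrb') h.symm).symm
    · exact hR.2 _ (Finset.mem_of_mem_erase hr) _ (Finset.mem_of_mem_erase hr')
        (sameCycle_of_pow_congr (hout r hr hrb) h)

theorem IsTransversal.permWeight_mul_swap {n : ℕ} {N : Matrix (Fin n) (Fin n) ℍ}
    {π : Equiv.Perm (Fin n)} {a b : Fin n} (hN : ∀ i, N a i = N b i) (hab : ¬ π.SameCycle a b)
    {R : Finset (Fin n)} (hR : IsTransversal π R) (ha : a ∈ R) (hb : b ∈ R) :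
    permWeight N (π * Equiv.swap a b) =
      (pathProd N π a (Function.minimalPeriod π a) *
        pathProd N π b (Function.minimalPeriod π b)).re *
        ∏ i ∈ (R.erase a).erase b, cycleWeight N π i := by
  have hne : b ≠ a := fun h => hab (h ▸ Equiv.Perm.SameCycle.refl _ _)
  rw [(hR.mul_swap hab ha hb).permWeight_eq, ← Finset.mul_prod_erase _ _
    (Finset.mem_erase.2 ⟨hne, hb⟩), cycleWeight_mul_swap hN hab]
  congr 1
  refine Finset.prod_congr rfl fun r hr => ?_
  simp only [Finset.mem_erase] at hr
  exact cycleWeight_congr (mul_swap_pow_of_not_sameCycle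
      (fun h => hr.2.1 (hR.2 a ha r hr.2.2 h).symm)
      (fun h => hr.1 (hR.2 b hb r hr.2.2 h).symm)) fun _ => rfl

/-! ### Reversing a cycle -/

open Classical in
/-- The permutation `π` with the cycle of `b` reversed. -/
def reverseCycle {n : ℕ} (b : Fin n) (π : Equiv.Perm (Fin n)) : Equiv.Perm (Fin n) :=
  -- One factor reduces the cycle of `b` to fixed points, the other one runs through it backwards.
  -- As the factor is squared, the sign of `π` is visibly unchanged.
  π * (π.cycleOf b)⁻¹ * (π.cycleOf b)⁻¹

theorem reverseCycle_apply_of_sameCycle {n : ℕ} {b i : Fin n} {π : Equiv.Perm (Fin n)}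
    (h : π.SameCycle b i) : reverseCycle b π i = π⁻¹ i := by
  classical
  have h' : π.SameCycle b (π⁻¹ i) := by simpa using h
  rw [reverseCycle, Equiv.Perm.mul_apply, Equiv.Perm.mul_apply, Equiv.Perm.cycleOf_inv,
    Equiv.Perm.cycleOf_apply _ b i, if_pos (by simpa using h), Equiv.Perm.cycleOf_apply,
    if_pos (by simpa using h)]
  simp

theorem reverseCycle_apply_of_not_sameCycle {n : ℕ} {b i : Fin n} {π : Equiv.Perm (Fin n)}
    (h : ¬ π.SameCycle b i) : reverseCycle b π i = π i := by
  classical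
  rw [reverseCycle, Equiv.Perm.mul_apply, Equiv.Perm.mul_apply, Equiv.Perm.cycleOf_inv,
    Equiv.Perm.cycleOf_apply _ b i, if_neg (by simpa using h), Equiv.Perm.cycleOf_apply,
    if_neg (by simpa using h)]

theorem sign_reverseCycle {n : ℕ} (b : Fin n) (π : Equiv.Perm (Fin n)) :
    Equiv.Perm.sign (reverseCycle b π) = Equiv.Perm.sign π := by
  classical
  rw [reverseCycle, Equiv.Perm.sign_mul, Equiv.Perm.sign_mul, mul_assoc, Int.units_mul_self,
    mul_one]

theorem reverseCycle_pow_of_sameCycle {n : ℕ} {b i : Fin n} {π : Equiv.Perm (Fin n)}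
    (h : π.SameCycle b i) (t : ℕ) : (reverseCycle b π ^ t) i = (π⁻¹ ^ t) i := by
  induction t with
  | zero => rfl
  | succ t ih =>
    rw [pow_succ', Equiv.Perm.mul_apply, ih, reverseCycle_apply_of_sameCycle, pow_succ',
      Equiv.Perm.mul_apply]
    rw [inv_pow, ← zpow_natCast, ← zpow_neg]
    exact Equiv.Perm.sameCycle_zpow_right.2 h

theorem reverseCycle_pow_of_not_sameCycle {n : ℕ} {b i : Fin n} {π : Equiv.Perm (Fin n)}
    (h : ¬ π.SameCycle b i) (t : ℕ) : (reverseCycle b π ^ t) i = (π ^ t) i := by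
  induction t with
  | zero => rfl
  | succ t ih =>
    rw [pow_succ', Equiv.Perm.mul_apply, ih, reverseCycle_apply_of_not_sameCycle, pow_succ',
      Equiv.Perm.mul_apply]
    simpa using h

theorem sameCycle_reverseCycle {n : ℕ} {b i j : Fin n} {π : Equiv.Perm (Fin n)} :
    (reverseCycle b π).SameCycle i j ↔ π.SameCycle i j := by
  have hc : ∀ i j, (reverseCycle b π).SameCycle i j → π.SameCycle i j := by
    intro i j h
    by_cases hi : π.SameCycle b i
    · have := sameCycle_of_pow_congr (reverseCycle_pow_of_sameCycle hi) h
      simpa using this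
    · exact sameCycle_of_pow_congr (reverseCycle_pow_of_not_sameCycle hi) h
  refine ⟨hc i j, fun h => ?_⟩
  by_cases hi : π.SameCycle b i
  · exact sameCycle_of_pow_congr (π := π⁻¹) (fun t => (reverseCycle_pow_of_sameCycle hi t).symm)
      (by simpa using h)
  · exact sameCycle_of_pow_congr (fun t => (reverseCycle_pow_of_not_sameCycle hi t).symm) h

theorem reverseCycle_reverseCycle {n : ℕ} (b : Fin n) (π : Equiv.Perm (Fin n)) :
    reverseCycle b (reverseCycle b π) = π := by
  ext i
  by_cases h : π.SameCycle b i
  · rw [reverseCycle_apply_of_sameCycle (sameCycle_reverseCycle.2 h), Equiv.Perm.inv_eq_iff_eq.2]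
    rw [reverseCycle_apply_of_sameCycle]
    · simp
    · simpa using h
  · rw [reverseCycle_apply_of_not_sameCycle (mt sameCycle_reverseCycle.1 h),
      reverseCycle_apply_of_not_sameCycle h]

theorem minimalPeriod_reverseCycle {n : ℕ} (b : Fin n) (π : Equiv.Perm (Fin n)) :
    Function.minimalPeriod (reverseCycle b π) b = Function.minimalPeriod π b := by
  refine minimalPeriod_congr fun t => ?_
  rw [reverseCycle_pow_of_sameCycle (Equiv.Perm.SameCycle.refl _ _), inv_pow,
    Equiv.Perm.inv_eq_iff_eq, eq_comm]

theorem star_pathProd {n : ℕ} {N : Matrix (Fin n) (Fin n) ℍ} (hN : ∀ i j, star (N i j) = N j i)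
    (π : Equiv.Perm (Fin n)) (i : Fin n) (p : ℕ) :
    star (pathProd N π i p) = pathProd N π⁻¹ ((π ^ p) i) p := by
  induction p with
  | zero => simp [pathProd]
  | succ p ih =>
    rw [pathProd_succ, star_mul, hN, ih, pathProd_succ']
    have : π⁻¹ ((π ^ (p + 1)) i) = (π ^ p) i := by
      rw [pow_succ', Equiv.Perm.mul_apply, Equiv.Perm.inv_def, Equiv.symm_apply_apply]
    rw [this]

theorem pathProd_reverseCycle {n : ℕ} {N : Matrix (Fin n) (Fin n) ℍ}
    (hN : ∀ i j, star (N i j) = N j i) (b : Fin n) (π : Equiv.Perm (Fin n)) :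
    pathProd N (reverseCycle b π) b (Function.minimalPeriod π b) =
      star (pathProd N π b (Function.minimalPeriod π b)) := by
  rw [star_pathProd hN, pow_minimalPeriod_apply]
  refine pathProd_congr fun t _ => ?_
  rw [reverseCycle_pow_of_sameCycle (Equiv.Perm.SameCycle.refl _ _),
    reverseCycle_pow_of_sameCycle (Equiv.Perm.SameCycle.refl _ _)]

/-- Averaging over the two orientations of one of the cycles, the weight of a merged cycle is the
product of the weights of its two parts. -/
theorem permWeight_merge_average {n : ℕ} {N : Matrix (Fin n) (Fin n) ℍ}
    (hN : ∀ i j, star (N i j) = N j i) {a b : Fin n} (hab : ∀ i, N a i = N b i)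
    {π : Equiv.Perm (Fin n)} (hπ : ¬ π.SameCycle a b) :
    permWeight N (π * Equiv.swap a b) + permWeight N (reverseCycle b π * Equiv.swap a b) =
      2 * permWeight N π := by
  have hne : b ≠ a := fun h => hπ (h ▸ Equiv.Perm.SameCycle.refl _ _)
  obtain ⟨R, hSR, hR⟩ := exists_isTransversal π {a, b} (by
    simp only [Finset.mem_insert, Finset.mem_singleton]
    rintro r (rfl | rfl) r' (rfl | rfl) h
    · rfl
    · exact absurd h hπ
    · exact absurd h.symm hπ
    · rfl)
  have ha : a ∈ R := hSR (by simp)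
  have hb : b ∈ R := hSR (by simp)
  have hR' : IsTransversal (reverseCycle b π) R := by
    simpa only [IsTransversal, sameCycle_reverseCycle] using hR
  have hba : ¬ π.SameCycle b a := fun h => hπ h.symm
  rw [hR.permWeight_mul_swap hab hπ ha hb,
    hR'.permWeight_mul_swap hab (mt sameCycle_reverseCycle.1 hπ) ha hb, hR.permWeight_eq,
    ← Finset.mul_prod_erase _ _ ha, ← Finset.mul_prod_erase _ _ (Finset.mem_erase.2 ⟨hne, hb⟩),
    minimalPeriod_reverseCycle, pathProd_reverseCycle hN,
    minimalPeriod_congr (π := reverseCycle b π) (ρ := π) (i := a) (j := a)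
      (fun t => by rw [reverseCycle_pow_of_not_sameCycle hba]),
    pathProd_congr (M := N) (N := N) (π := reverseCycle b π) (ρ := π) (i := a) (j := a)
      (fun t _ => by rw [reverseCycle_pow_of_not_sameCycle hba,
        reverseCycle_pow_of_not_sameCycle hba]), cycleWeight_eq, cycleWeight_eq]
  have : ∏ i ∈ (R.erase a).erase b, cycleWeight N (reverseCycle b π) i =
      ∏ i ∈ (R.erase a).erase b, cycleWeight N π i := by
    refine Finset.prod_congr rfl fun r hr => ?_
    simp only [Finset.mem_erase] at hr
    exact cycleWeight_congr (reverseCycle_pow_of_not_sameCycle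
      (fun h => hr.1 (hR.2 b hb r hr.2.2 h).symm)) fun _ => rfl
  rw [this]
  -- Up to the common factor of the other cycles, this is `Re (p q) + Re (p q̄) = 2 Re p Re q` for
  -- the path products `p` and `q` along the cycles of `a` and `b`.
  simp only [Quaternion.re_mul, Quaternion.re_star, Quaternion.imI_star, Quaternion.imJ_star,
    Quaternion.imK_star]
  ring

/-- The Moore determinant of a Hermitian matrix with two equal rows vanishes. -/
theorem mooreDet_eq_zero_of_row_eq {n : ℕ} {N : Matrix (Fin n) (Fin n) ℍ}
    (hN : ∀ i j, star (N i j) = N j i) {a b : Fin n} (hne : a ≠ b) (hab : ∀ i, N a i = N b i) :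
    mooreDet N = 0 := by
  classical
  let e : Equiv.Perm (Fin n) → ℝ := fun π => ((Equiv.Perm.sign π : ℤ) : ℝ)
  have he : ∀ π, e (π * Equiv.swap a b) = -e π := fun π => by
    simp [e, Equiv.Perm.sign_swap hne]
  let T : Finset (Equiv.Perm (Fin n)) := Finset.univ.filter fun π => ¬ π.SameCycle a b
  have hT : ∀ π, π ∈ T ↔ ¬ π.SameCycle a b := fun π => by simp [T]
  have hsw : ∀ π : Equiv.Perm (Fin n), π * Equiv.swap a b * Equiv.swap a b = π := fun π => by
    rw [mul_assoc, Equiv.swap_mul_self, mul_one]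
  -- Multiplication by the transposition is a sign-reversing bijection between the permutations that
  -- join `a` and `b` in a cycle and those that separate them.
  have h1 : ∑ π ∈ Tᶜ, e π * permWeight N π =
      ∑ π ∈ T, -(e π * permWeight N (π * Equiv.swap a b)) := by
    refine Finset.sum_bij' (fun π _ => π * Equiv.swap a b) (fun π _ => π * Equiv.swap a b)
      ?_ ?_ (fun π _ => hsw π) (fun π _ => hsw π) ?_
    · intro π hπ
      rw [Finset.mem_compl, hT, not_not] at hπ
      exact (hT _).2 (not_sameCycle_mul_swap hne hπ)
    · intro π hπ
      rw [Finset.mem_compl, hT, not_not]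
      exact sameCycle_mul_swap ((hT π).1 hπ)
    · intro π _
      rw [hsw, he]; ring
  -- Reversing the cycle of `b` is a sign-preserving involution of `T`.
  have h2 : ∑ π ∈ T, -(e π * permWeight N (π * Equiv.swap a b)) =
      ∑ π ∈ T, -(e π * permWeight N (reverseCycle b π * Equiv.swap a b)) := by
    refine Finset.sum_bij' (fun π _ => reverseCycle b π) (fun π _ => reverseCycle b π)
      ?_ ?_ (fun π _ => reverseCycle_reverseCycle b π) (fun π _ => reverseCycle_reverseCycle b π) ?_
    · intro π hπ
      rw [hT] at hπ ⊢
      rwa [sameCycle_reverseCycle]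
    · intro π hπ
      rw [hT] at hπ ⊢
      rwa [sameCycle_reverseCycle]
    · intro π _
      simp only [e, reverseCycle_reverseCycle, sign_reverseCycle]
  -- The two equal sums of `h2` add up to minus twice the sum over `T`; hence the permutations that
  -- join `a` and `b` cancel those that separate them.
  have h3 : ∑ π ∈ T, -(e π * permWeight N (π * Equiv.swap a b)) +
      ∑ π ∈ T, -(e π * permWeight N (reverseCycle b π * Equiv.swap a b)) =
      ∑ π ∈ T, -(2 * (e π * permWeight N π)) := by
    rw [← Finset.sum_add_distrib]
    refine Finset.sum_congr rfl fun π hπ => ?_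
    have := permWeight_merge_average hN hab ((hT π).1 hπ)
    linear_combination -e π * this
  rw [mooreDet_eq, ← Finset.sum_add_sum_compl T]
  change ∑ π ∈ T, e π * permWeight N π + ∑ π ∈ Tᶜ, e π * permWeight N π = 0
  rw [Finset.sum_neg_distrib (fun π => 2 * (e π * permWeight N π)), ← Finset.mul_sum] at h3
  linarith

theorem re_mul_comm (p q : ℍ) : (p * q).re = (q * p).re := by
  rw [Quaternion.re_mul, Quaternion.re_mul]; ring

/-! ### Invariance properties of the Moore determinant -/

theorem conj_pow_apply {n : ℕ} (e π : Equiv.Perm (Fin n)) (i : Fin n) (t : ℕ) :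
    ((e * π * e⁻¹) ^ t) (e i) = e ((π ^ t) i) := by
  rw [conj_pow]
  simp

theorem permWeight_submatrix {n : ℕ} (M : Matrix (Fin n) (Fin n) ℍ) (e π : Equiv.Perm (Fin n)) :
    permWeight (M.submatrix e e) π = permWeight M (e * π * e⁻¹) := by
  obtain ⟨R, -, hR⟩ := exists_isTransversal π ∅ (by simp)
  have hsc : ∀ i j, (e * π * e⁻¹).SameCycle (e i) (e j) ↔ π.SameCycle i j := fun i j => by
    rw [Equiv.Perm.sameCycle_conj]; simp
  have hR' : IsTransversal (e * π * e⁻¹) (R.map e.toEmbedding) := by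
    refine ⟨fun i => ?_, ?_⟩
    · obtain ⟨r, hr, h⟩ := hR.1 (e.symm i)
      refine ⟨e r, Finset.mem_map_of_mem e.toEmbedding hr, ?_⟩
      rw [← e.apply_symm_apply i]
      exact (hsc _ _).2 h
    · simp only [Finset.mem_map, Equiv.coe_toEmbedding]
      rintro _ ⟨r, hr, rfl⟩ _ ⟨r', hr', rfl⟩ h
      rw [hR.2 r hr r' hr' ((hsc _ _).1 h)]
  rw [hR.permWeight_eq, hR'.permWeight_eq, Finset.prod_map]
  refine Finset.prod_congr rfl fun i _ => ?_
  rw [Equiv.coe_toEmbedding, cycleWeight_eq, cycleWeight_eq,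
    minimalPeriod_congr (π := e * π * e⁻¹) (ρ := π) (i := e i) (j := i)
      (fun t => by rw [conj_pow_apply, e.injective.eq_iff])]
  refine congrArg (fun x : ℍ => x.re) (pathProd_congr fun t _ => ?_)
  rw [conj_pow_apply, conj_pow_apply, Matrix.submatrix_apply]

theorem mooreDet_submatrix {n : ℕ} (M : Matrix (Fin n) (Fin n) ℍ) (e : Equiv.Perm (Fin n)) :
    mooreDet (M.submatrix e e) = mooreDet M := by
  rw [mooreDet_eq, mooreDet_eq]
  refine Fintype.sum_equiv (MulAut.conj e).toEquiv _ _ fun π => ?_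
  rw [permWeight_submatrix]
  change _ = ((Equiv.Perm.sign (e * π * e⁻¹) : ℤ) : ℝ) * permWeight M (e * π * e⁻¹)
  rw [Equiv.Perm.sign_mul, Equiv.Perm.sign_mul, Equiv.Perm.sign_inv, mul_comm, mul_right_comm,
    Int.units_mul_self, one_mul, mul_comm]

theorem cycleWeight_eq_zero {n : ℕ} {M : Matrix (Fin n) (Fin n) ℍ} {π : Equiv.Perm (Fin n)}
    {i : Fin n} (h : M i (π i) = 0) : cycleWeight M π i = 0 := by
  obtain ⟨p, hp⟩ := Nat.exists_eq_succ_of_ne_zero (minimalPeriod_perm_pos π i).ne'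
  rw [cycleWeight_eq, hp, Nat.succ_eq_add_one, pathProd_succ', h, zero_mul]; rfl

/-- The cycle of `i` may be started at `i`, so that the zero is the first factor of its product. -/
theorem permWeight_eq_zero {n : ℕ} {M : Matrix (Fin n) (Fin n) ℍ} {π : Equiv.Perm (Fin n)}
    {i : Fin n} (h : M i (π i) = 0) : permWeight M π = 0 := by
  obtain ⟨R, hSR, hR⟩ := exists_isTransversal π {i} (by simp)
  rw [hR.permWeight_eq]
  exact Finset.prod_eq_zero (hSR (Finset.mem_singleton_self i)) (cycleWeight_eq_zero h)

theorem cycleWeight_of_fixed {n : ℕ} (M : Matrix (Fin n) (Fin n) ℍ) {π : Equiv.Perm (Fin n)}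
    {i : Fin n} (h : π i = i) : cycleWeight M π i = (M i i).re := by
  rw [cycleWeight_eq, Function.minimalPeriod_eq_one_iff_isFixedPt.2 h, pathProd_succ']
  simp [pathProd, h]

theorem mooreDet_diagonal {n : ℕ} (d : Fin n → ℝ) :
    mooreDet (Matrix.diagonal fun i => (d i : ℍ)) = ∏ i, d i := by
  rw [mooreDet_eq, Finset.sum_eq_single 1]
  · have hR : IsTransversal (1 : Equiv.Perm (Fin n)) Finset.univ :=
      ⟨fun i => ⟨i, Finset.mem_univ _, Equiv.Perm.SameCycle.refl _ _⟩, fun r _ r' _ h => by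
        simpa using h⟩
    rw [hR.permWeight_eq, Equiv.Perm.sign_one, Units.val_one, Int.cast_one, one_mul]
    refine Finset.prod_congr rfl fun i _ => ?_
    rw [cycleWeight_of_fixed _ rfl, Matrix.diagonal_apply_eq, Quaternion.re_coe]
  · intro π _ hπ
    obtain ⟨i, hi⟩ : ∃ i, π i ≠ i := by
      by_contra! h
      exact hπ (Equiv.ext h)
    rw [permWeight_eq_zero (i := i) (Matrix.diagonal_apply_ne _ hi.symm), mul_zero]
  · simp

/-! ### Self-adjoint endomorphisms: basis independence of the Moore determinant and diagonalisation
-/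

section Basis

open QuaternionicInnerProductSpace

variable {V : Type*} [NormedAddCommGroup V] [Module ℍᵐᵒᵖ V] [QuaternionicInnerProductSpace V]

/-! ### Orthonormal families -/

theorem inner_sum_left {ι : Type*} (s : Finset ι) (v : V) (f : ι → V) :
    inner ℍ (∑ i ∈ s, f i) v = ∑ i ∈ s, inner ℍ (f i) v := by
  rw [← star_inner, inner_sum_right, star_sum]
  simp only [star_inner]

theorem eq_zero_of_inner_self {v : V} (h : inner ℍ v v = 0) : v = 0 := by
  rw [hinner_self, ← Quaternion.coe_zero] at h
  exact norm_eq_zero.1 (pow_eq_zero_iff two_ne_zero |>.1 (Quaternion.coe_injective h))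

theorem inner_eq_zero_of_mem_span {s : Set V} {w v : V} (h : ∀ x ∈ s, inner ℍ w x = 0)
    (hv : v ∈ Submodule.span ℍᵐᵒᵖ s) : inner ℍ w v = 0 := by
  induction hv using Submodule.span_induction with
  | mem x hx => exact h x hx
  | zero => exact inner_zero_right _
  | add x y _ _ hx hy => rw [hinner_add_right, hx, hy, add_zero]
  | smul a x _ hx =>
    have := inner_smul_right w x a.unop
    rwa [hx, zero_mul, MulOpposite.op_unop] at this

variable {ι : Type*} [Fintype ι] [DecidableEq ι]

/-- The expansion of a vector of the span of an orthonormal family. -/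
theorem sum_inner_smul {b : ι → V} (hb : ∀ i j, inner ℍ (b i) (b j) = if i = j then 1 else 0)
    {v : V} (hv : v ∈ Submodule.span ℍᵐᵒᵖ (Set.range b)) :
    ∑ i, MulOpposite.op (inner ℍ (b i) v) • b i = v := by
  have hmem : v - ∑ i, MulOpposite.op (inner ℍ (b i) v) • b i ∈
      Submodule.span ℍᵐᵒᵖ (Set.range b) :=
    Submodule.sub_mem _ hv (Submodule.sum_mem _ fun i _ =>
      Submodule.smul_mem _ _ (Submodule.subset_span ⟨i, rfl⟩))
  refine (sub_eq_zero.1 (eq_zero_of_inner_self (inner_eq_zero_of_mem_span ?_ hmem))).symm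
  rintro _ ⟨i, rfl⟩
  rw [← star_inner, inner_sub_right, inner_sum_right]
  simp [inner_smul_right, hb]

theorem inner_eq_sum {b : ι → V} (hb : ∀ i j, inner ℍ (b i) (b j) = if i = j then 1 else 0)
    {v : V} (hv : v ∈ Submodule.span ℍᵐᵒᵖ (Set.range b)) (w : V) :
    inner ℍ w v = ∑ i, inner ℍ w (b i) * inner ℍ (b i) v := by
  conv_lhs => rw [← sum_inner_smul hb hv, inner_sum_right]
  simp only [inner_smul_right]

/-- The right linear operator `w ↦ y ⟨z, w⟩`. -/
def rankOne (y z : V) : V →ₗ[ℍᵐᵒᵖ] V where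
  toFun w := MulOpposite.op (inner ℍ z w) • y
  map_add' v w := by rw [hinner_add_right, MulOpposite.op_add, add_smul]
  map_smul' q v := by
    rw [← MulOpposite.op_unop q, inner_smul_right, MulOpposite.op_mul, mul_smul]; rfl

/-- Over `ℍ` only the real part of the trace is intrinsic: `Re (p q) = Re (q p)` is what allows the
two basis expansions to be interchanged. -/
theorem re_trace_eq {n : ℕ} {b c : Fin n → V} (hb : IsOrthonormalBasis b)
    (hc : IsOrthonormalBasis c) (L : V →ₗ[ℍᵐᵒᵖ] V) :
    ∑ j, (inner ℍ (b j) (L (b j))).re = ∑ j, (inner ℍ (c j) (L (c j))).re := by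
  have hre : ∀ (f : Fin n → ℍ), (∑ i, f i).re = ∑ i, (f i).re := fun f =>
    map_sum (⟨⟨fun x : ℍ => x.re, rfl⟩, fun _ _ => rfl⟩ : ℍ →+ ℝ) f Finset.univ
  have h1 : ∀ j, (inner ℍ (b j) (L (b j))).re =
      ∑ k, (inner ℍ (c k) (L (b j)) * inner ℍ (b j) (c k)).re := fun j => by
    rw [inner_eq_sum hc.1 (v := L (b j)) (hc.2 ▸ Submodule.mem_top) (b j), hre]
    exact Finset.sum_congr rfl fun k _ => re_mul_comm _ _
  simp only [h1]
  rw [Finset.sum_comm]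
  refine Finset.sum_congr rfl fun k _ => ?_
  rw [← hre]
  congr 1
  have h2 : c k ∈ Submodule.span ℍᵐᵒᵖ (Set.range b) := hb.2 ▸ Submodule.mem_top
  have h3 : L (c k) = ∑ j, MulOpposite.op (inner ℍ (b j) (c k)) • L (b j) := by
    conv_lhs => rw [← sum_inner_smul hb.1 h2, map_sum]
    simp only [map_smul]
  rw [h3, inner_sum_right]
  exact Finset.sum_congr rfl fun j _ => (inner_smul_right _ _ _).symm

/-! ### Independence of the basis -/

/-- As long as the path has not returned to `i`, the vector placed there occurs only as the left
argument of the first factor. Each further factor is absorbed in the operator as a `rankOne`, by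
right linearity of the inner product. -/
theorem exists_pathProd_update {n : ℕ} (A : V →ₗ[ℍᵐᵒᵖ] V) (π : Equiv.Perm (Fin n))
    (x : Fin n → V) (i : Fin n) (p : ℕ) (hp : ∀ t, 0 < t → t ≤ p → (π ^ t) i ≠ i) :
    ∃ L : V →ₗ[ℍᵐᵒᵖ] V, ∀ v w : V, pathProd (matrixOf (Function.update x i v) A) π i p *
      inner ℍ (Function.update x i v ((π ^ p) i)) (A w) = inner ℍ v (L w) := by
  induction p with
  | zero => exact ⟨A, fun v w => by
      rw [pow_zero, Equiv.Perm.one_apply, Function.update_self]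
      exact one_mul _⟩
  | succ p ih =>
    obtain ⟨L, hL⟩ := ih fun t h0 h => hp t h0 (by omega)
    have hne := hp (p + 1) (Nat.succ_pos p) le_rfl
    refine ⟨rankOne (L (x ((π ^ (p + 1)) i))) (x ((π ^ (p + 1)) i)) ∘ₗ A, fun v w => ?_⟩
    rw [pathProd_succ, matrixOf, Matrix.of_apply, Function.update_of_ne hne]
    have := hL v (x ((π ^ (p + 1)) i))
    rw [matrixOf] at this
    rw [this]
    exact (inner_smul_right _ _ _).symm

/-- The index `i` lies on a single cycle. Started at `i`, this cycle closes up to the real part of a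
quadratic expression in the vector placed there; the other cycles do not see that vector. -/
theorem exists_permWeight_update {n : ℕ} (A : V →ₗ[ℍᵐᵒᵖ] V) (π : Equiv.Perm (Fin n))
    (x : Fin n → V) (i : Fin n) :
    ∃ (L : V →ₗ[ℍᵐᵒᵖ] V) (c : ℝ), ∀ v : V, permWeight (matrixOf (Function.update x i v) A) π =
      (inner ℍ v (L v)).re * c := by
  obtain ⟨R, hSR, hR⟩ := exists_isTransversal π {i} (by simp)
  have hi : i ∈ R := hSR (Finset.mem_singleton_self i)
  obtain ⟨p, hp⟩ := Nat.exists_eq_succ_of_ne_zero (minimalPeriod_perm_pos π i).ne'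
  rw [Nat.succ_eq_add_one] at hp
  obtain ⟨L, hL⟩ := exists_pathProd_update A π x i p fun t h0 ht =>
    pow_apply_ne_self h0 (by omega)
  refine ⟨L, ∏ r ∈ R.erase i, cycleWeight (matrixOf x A) π r, fun v => ?_⟩
  rw [hR.permWeight_eq, ← Finset.mul_prod_erase _ _ hi]
  congr 1
  · rw [cycleWeight_eq, hp, pathProd_succ, ← hL v v, ← hp, pow_minimalPeriod_apply]
    simp [matrixOf]
  · refine Finset.prod_congr rfl fun r hr => ?_
    obtain ⟨hri, hr⟩ := Finset.mem_erase.1 hr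
    have hne : ∀ t : ℕ, (π ^ t) r ≠ i := fun t h =>
      hri (hR.2 r hr i hi ⟨t, by rw [zpow_natCast, h]⟩)
    refine cycleWeight_congr (fun _ => rfl) fun t => ?_
    rw [matrixOf, matrixOf, Matrix.of_apply, Matrix.of_apply, Function.update_of_ne (hne _),
      Function.update_of_ne (hne _)]

/-- With the other values of `f` fixed, the sum over `f i` is a constant times the real part of a
trace, so one orthonormal basis may be exchanged for another at position `i`. -/
theorem sum_permWeight_update {n : ℕ} (A : V →ₗ[ℍᵐᵒᵖ] V) (π : Equiv.Perm (Fin n))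
    (X : Fin n → Fin n → V) (i : Fin n) {b : Fin n → V} (hX : IsOrthonormalBasis (X i))
    (hb : IsOrthonormalBasis b) :
    ∑ f : Fin n → Fin n, permWeight (matrixOf (fun j => X j (f j)) A) π =
      ∑ f : Fin n → Fin n, permWeight (matrixOf (fun j => Function.update X i b j (f j)) A) π := by
  rw [← (Equiv.funSplitAt i (Fin n)).symm.sum_comp, ← (Equiv.funSplitAt i (Fin n)).symm.sum_comp,
    Fintype.sum_prod_type_right, Fintype.sum_prod_type_right]
  refine Finset.sum_congr rfl fun g _ => ?_
  -- The index chosen at `j = i` is a dummy, since `Function.update` overwrites the vector there.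
  obtain ⟨L, c, hL⟩ := exists_permWeight_update A π
    (fun j => X j (if h : j = i then i else g ⟨j, h⟩)) i
  have h1 : ∀ a, (fun j => X j ((Equiv.funSplitAt i (Fin n)).symm (a, g) j)) =
      Function.update (fun j => X j (if h : j = i then i else g ⟨j, h⟩)) i (X i a) := fun a => by
    funext j
    by_cases hj : j = i
    · subst hj; simp [Equiv.funSplitAt, Equiv.piSplitAt]
    · simp [Equiv.funSplitAt, Equiv.piSplitAt, hj]
  have h2 : ∀ a, (fun j => Function.update X i b j ((Equiv.funSplitAt i (Fin n)).symm (a, g) j)) =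
      Function.update (fun j => X j (if h : j = i then i else g ⟨j, h⟩)) i (b a) := fun a => by
    funext j
    by_cases hj : j = i
    · subst hj; simp [Equiv.funSplitAt, Equiv.piSplitAt]
    · simp [Equiv.funSplitAt, Equiv.piSplitAt, hj]
  simp only [h1, h2, hL, ← Finset.sum_mul]
  rw [re_trace_eq hX hb]

/-- The basis is changed at one position at a time; this is why `sum_permWeight_update` allows a
family `X` of bases, one for each position. -/
theorem sum_permWeight_eq {n : ℕ} (A : V →ₗ[ℍᵐᵒᵖ] V) (π : Equiv.Perm (Fin n))
    {b c : Fin n → V} (hb : IsOrthonormalBasis b) (hc : IsOrthonormalBasis c) :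
    ∑ f : Fin n → Fin n, permWeight (matrixOf (fun j => b (f j)) A) π =
      ∑ f : Fin n → Fin n, permWeight (matrixOf (fun j => c (f j)) A) π := by
  classical
  have key : ∀ S : Finset (Fin n),
      ∑ f : Fin n → Fin n, permWeight (matrixOf (fun j => b (f j)) A) π =
      ∑ f : Fin n → Fin n, permWeight (matrixOf (fun j => (if j ∈ S then c else b) (f j)) A) π := by
    intro S
    induction S using Finset.induction_on with
    | empty => simp
    | insert a S ha ih =>
      rw [ih, sum_permWeight_update A π (fun j => if j ∈ S then c else b) a (b := c)
        (by simpa [ha] using hb) hc]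
      congr! 6 with f _ j
      by_cases hj : j = a
      · subst hj; simp
      · simp [hj]
  simpa using key Finset.univ

theorem star_matrixOf {n : ℕ} {A : V →ₗ[ℍᵐᵒᵖ] V}
    (hA : ∀ v w : V, inner ℍ (A v) w = inner ℍ v (A w)) (x : Fin n → V) (i j : Fin n) :
    star (matrixOf x A i j) = matrixOf x A j i := by
  simp only [matrixOf, Matrix.of_apply, star_inner, hA]

/-- A family that repeats a vector has a Hermitian matrix with two equal rows, hence determinant
zero. The bijective `f` permute rows and columns simultaneously and give `n!` equal terms. -/
theorem sum_mooreDet_eq {n : ℕ} {A : V →ₗ[ℍᵐᵒᵖ] V}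
    (hA : ∀ v w : V, inner ℍ (A v) w = inner ℍ v (A w)) (b : Fin n → V) :
    ∑ f : Fin n → Fin n, mooreDet (matrixOf (fun j => b (f j)) A) =
      n.factorial * mooreDet (matrixOf b A) := by
  classical
  have h1 : ∑ f : Fin n → Fin n, mooreDet (matrixOf (fun j => b (f j)) A) =
      ∑ f : Fin n → Fin n with Function.Bijective f,
        mooreDet (matrixOf (fun j => b (f j)) A) := by
    symm
    refine Finset.sum_subset (Finset.filter_subset _ _) fun f _ hf => ?_
    have hinj : ¬ Function.Injective f := fun h =>
      hf (Finset.mem_filter.2 ⟨Finset.mem_univ _, Finite.injective_iff_bijective.1 h⟩)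
    simp only [Function.Injective, not_forall] at hinj
    obtain ⟨i, j, hij, hne⟩ := hinj
    exact mooreDet_eq_zero_of_row_eq (star_matrixOf hA _) hne fun l => by simp [matrixOf, hij]
  have h2 : ∑ f : Fin n → Fin n with Function.Bijective f,
        mooreDet (matrixOf (fun j => b (f j)) A) =
      ∑ e : Equiv.Perm (Fin n), mooreDet ((matrixOf b A).submatrix e e) :=
    Finset.sum_bij (fun f h => Equiv.ofBijective f (Finset.mem_filter.1 h).2)
      (fun _ _ => Finset.mem_univ _) (fun f _ g _ h => congrArg DFunLike.coe h)
      (fun e _ => ⟨e, Finset.mem_filter.2 ⟨Finset.mem_univ _, e.bijective⟩, Equiv.ext fun _ => rfl⟩)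
      fun f _ => rfl
  rw [h1, h2]
  simp only [mooreDet_submatrix, Finset.sum_const, Finset.card_univ, Fintype.card_perm,
    Fintype.card_fin, nsmul_eq_mul]

/-- The Moore determinant of a self-adjoint endomorphism does not depend on the basis. -/
theorem mooreDet_matrixOf_eq {n : ℕ} {A : V →ₗ[ℍᵐᵒᵖ] V}
    (hA : ∀ v w : V, inner ℍ (A v) w = inner ℍ v (A w)) {b c : Fin n → V}
    (hb : IsOrthonormalBasis b) (hc : IsOrthonormalBasis c) :
    mooreDet (matrixOf b A) = mooreDet (matrixOf c A) := by
  have h : (n.factorial : ℝ) * mooreDet (matrixOf b A) =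
      n.factorial * mooreDet (matrixOf c A) := by
    rw [← sum_mooreDet_eq hA, ← sum_mooreDet_eq hA]
    simp only [mooreDet_eq]
    rw [Finset.sum_comm, Finset.sum_comm (s := (Finset.univ : Finset (Fin n → Fin n)))]
    refine Finset.sum_congr rfl fun π _ => ?_
    rw [← Finset.mul_sum, ← Finset.mul_sum, sum_permWeight_eq A π hb hc]
  exact mul_left_cancel₀ (Nat.cast_ne_zero.2 n.factorial_ne_zero) h

theorem card_of_isOrthonormalBasis {n : ℕ} {b : Fin n → V} (hb : IsOrthonormalBasis b) :
    n = Module.finrank ℍᵐᵒᵖ V := by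
  have := finrank_span_eq_card (linearIndependent_of_orthonormal hb.1)
  rw [hb.2, finrank_top, Fintype.card_fin] at this
  exact this.symm

theorem hasMooreDet_of_selfAdjoint {n : ℕ} {A : V →ₗ[ℍᵐᵒᵖ] V}
    (hA : ∀ v w : V, inner ℍ (A v) w = inner ℍ v (A w)) {b : Fin n → V}
    (hb : IsOrthonormalBasis b) : HasMooreDet A (mooreDet (matrixOf b A)) := by
  intro m c hc
  obtain rfl : m = n := (card_of_isOrthonormalBasis hc).trans (card_of_isOrthonormalBasis hb).symm
  exact mooreDet_matrixOf_eq hA hc hb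

theorem matrixOf_eigenbasis {n : ℕ} {A : V →ₗ[ℍᵐᵒᵖ] V} {b : Fin n → V}
    (hb : ∀ i j, inner ℍ (b i) (b j) = if i = j then 1 else 0) {d : Fin n → ℝ}
    (hd : ∀ i, A (b i) = MulOpposite.op (d i : ℍ) • b i) :
    matrixOf b A = Matrix.diagonal fun i => (d i : ℍ) := by
  ext1 i j
  rw [matrixOf, Matrix.of_apply, hd, inner_smul_right, hb]
  by_cases h : i = j
  · subst h; simp
  · simp [h]

/-- The Moore determinant of a self-adjoint endomorphism is the product of its eigenvalues. -/
theorem hasMooreDet_prod {n : ℕ} {A : V →ₗ[ℍᵐᵒᵖ] V}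
    (hA : ∀ v w : V, inner ℍ (A v) w = inner ℍ v (A w)) {b : Fin n → V}
    (hb : IsOrthonormalBasis b) {d : Fin n → ℝ}
    (hd : ∀ i, A (b i) = MulOpposite.op (d i : ℍ) • b i) : HasMooreDet A (∏ i, d i) := by
  have := hasMooreDet_of_selfAdjoint hA hb
  rwa [matrixOf_eigenbasis hb.1 hd, mooreDet_diagonal] at this

theorem HasMooreDet.unique [Module.Finite ℍᵐᵒᵖ V] {A : V →ₗ[ℍᵐᵒᵖ] V} {x y : ℝ}
    (hx : HasMooreDet A x) (hy : HasMooreDet A y) : x = y := by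
  obtain ⟨b, hb⟩ := exists_isOrthonormalBasis V
  rw [← hx _ b hb, ← hy _ b hb]

/-! ### The spectral theorem -/

variable (V) in
/-- The real inner product space underlying a quaternionic inner product space. -/
abbrev realInnerProductSpace : InnerProductSpace ℝ V :=
  { realNormedSpace V with
    inner := fun v w => (inner ℍ v w).re
    norm_sq_eq_re_inner := fun v => by
      change ‖v‖ ^ 2 = (inner ℍ v v).re
      rw [hinner_self]; exact (Quaternion.re_coe _).symm
    conj_inner_symm := fun v w => by
      change (inner ℍ w v).re = (inner ℍ v w).re
      rw [← star_inner v w, Quaternion.re_star]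
    add_left := fun u v w => by
      change (inner ℍ (u + v) w).re = _
      rw [hinner_add_left]; rfl
    smul_left := fun v w r => by
      change (inner ℍ (MulOpposite.op ((r : ℝ) : ℍ) • v) w).re = r * (inner ℍ v w).re
      rw [inner_smul_left]; simp [Quaternion.re_mul] }

/-- For the real part of the inner product, `A` is a symmetric operator on the underlying real
space, whose eigenvectors span already over `ℝ`. -/
theorem span_eigenvectors_eq_top [Module.Finite ℍᵐᵒᵖ V] {A : V →ₗ[ℍᵐᵒᵖ] V}
    (hA : ∀ v w : V, inner ℍ (A v) w = inner ℍ v (A w)) :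
    Submodule.span ℍᵐᵒᵖ {v : V | ∃ t : ℝ, A v = MulOpposite.op (t : ℍ) • v} = ⊤ := by
  let _ := realInnerProductSpace V
  have : FiniteDimensional ℝ V := real_finite V
  let T : V →ₗ[ℝ] V :=
    { toFun := A
      map_add' := map_add A
      map_smul' := fun r v => map_smul A (MulOpposite.op (r : ℍ)) v }
  have hT : T.IsSymmetric := fun v w => congrArg (fun x : ℍ => x.re) (hA v w)
  rw [eq_top_iff]
  intro v _
  rw [← (hT.eigenvectorBasis rfl).sum_repr v]
  refine Submodule.sum_mem _ fun i _ => ?_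
  refine Submodule.smul_mem _ (MulOpposite.op (((hT.eigenvectorBasis rfl).repr v i : ℝ) : ℍ))
    (Submodule.subset_span ⟨hT.eigenvalues rfl i, ?_⟩)
  exact hT.apply_eigenvectorBasis rfl i

theorem orthonormal_snoc {n : ℕ} {b : Fin n → V}
    (hb : ∀ i j, inner ℍ (b i) (b j) = if i = j then 1 else 0) {w : V} (hw : w ≠ 0)
    (h : ∀ i, inner ℍ (b i) w = 0) (i j : Fin (n + 1)) :
    inner ℍ (Fin.snoc (α := fun _ => V) b (MulOpposite.op ((‖w‖⁻¹ : ℝ) : ℍ) • w) i)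
      (Fin.snoc (α := fun _ => V) b (MulOpposite.op ((‖w‖⁻¹ : ℝ) : ℍ) • w) j) =
      if i = j then 1 else 0 := by
  have h' : ∀ i, inner ℍ w (b i) = 0 := fun i => by rw [← star_inner, h, star_zero]
  have hnw : ‖w‖ ≠ 0 := norm_ne_zero_iff.2 hw
  induction i using Fin.lastCases with
  | last =>
    induction j using Fin.lastCases with
    | last =>
      rw [Fin.snoc_last, hinner_smul_smul, hinner_self, Quaternion.star_coe,
        ← Quaternion.coe_mul, ← Quaternion.coe_mul, if_pos rfl]
      rw [show ‖w‖⁻¹ * ‖w‖ ^ 2 * ‖w‖⁻¹ = 1 by field_simp, Quaternion.coe_one]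
    | cast j =>
      rw [Fin.snoc_last, Fin.snoc_castSucc, inner_smul_left, h', mul_zero,
        if_neg (Fin.castSucc_lt_last j).ne']
  | cast i =>
    induction j using Fin.lastCases with
    | last =>
      rw [Fin.snoc_last, Fin.snoc_castSucc, inner_smul_right, h, zero_mul,
        if_neg (Fin.castSucc_lt_last i).ne]
    | cast j => simp [hb]

/-- Gram-Schmidt with eigenvectors. As the eigenvectors span, one of them lies outside the span of a
family that is too short. Subtracting its projection keeps it an eigenvector for the same `t`:
self-adjointness gives `d i * ⟨b i, v⟩ = ⟨b i, v⟩ * t`, so its components along the family are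
scaled by `t` too. -/
theorem exists_eigenfamily [Module.Finite ℍᵐᵒᵖ V] {A : V →ₗ[ℍᵐᵒᵖ] V}
    (hA : ∀ v w : V, inner ℍ (A v) w = inner ℍ v (A w)) (n : ℕ)
    (hn : n ≤ Module.finrank ℍᵐᵒᵖ V) :
    ∃ (b : Fin n → V) (d : Fin n → ℝ), (∀ i j, inner ℍ (b i) (b j) = if i = j then 1 else 0) ∧
      ∀ i, A (b i) = MulOpposite.op (d i : ℍ) • b i := by
  induction n with
  | zero => exact ⟨Fin.elim0, Fin.elim0, fun i => i.elim0, fun i => i.elim0⟩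
  | succ n ih =>
    obtain ⟨b, d, hb, hd⟩ := ih (by omega)
    have hne : Submodule.span ℍᵐᵒᵖ (Set.range b) ≠ ⊤ := fun htop => by
      have h1 := finrank_span_eq_card (linearIndependent_of_orthonormal hb)
      rw [htop, finrank_top, Fintype.card_fin] at h1
      omega
    obtain ⟨v, ⟨t, ht⟩, hv⟩ : ∃ v ∈ {v : V | ∃ t : ℝ, A v = MulOpposite.op (t : ℍ) • v},
        v ∉ Submodule.span ℍᵐᵒᵖ (Set.range b) := by
      by_contra! hcon
      exact hne (eq_top_iff.2 (span_eigenvectors_eq_top hA ▸ Submodule.span_le.2 hcon))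
    set w : V := v - ∑ i, MulOpposite.op (inner ℍ (b i) v) • b i with hw
    have hw0 : w ≠ 0 := fun h0 => hv <| by
      rw [sub_eq_zero.1 (hw.symm.trans h0)]
      exact Submodule.sum_mem _ fun i _ =>
        Submodule.smul_mem _ _ (Submodule.subset_span ⟨i, rfl⟩)
    have horth : ∀ i, inner ℍ (b i) w = 0 := fun i => by
      rw [hw, inner_sub_right, inner_sum_right]
      simp [inner_smul_right, hb]
    have hcomm : ∀ i, (d i : ℍ) * inner ℍ (b i) v = inner ℍ (b i) v * (t : ℍ) := fun i => by
      have h := hA (b i) v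
      rwa [hd, ht, inner_smul_left, inner_smul_right, Quaternion.star_coe] at h
    have hAw : A w = MulOpposite.op (t : ℍ) • w := by
      rw [hw, map_sub, ht, map_sum, smul_sub, Finset.smul_sum]
      congr 1
      refine Finset.sum_congr rfl fun i _ => ?_
      rw [map_smul, hd, smul_smul, smul_smul, ← MulOpposite.op_mul, ← MulOpposite.op_mul, hcomm]
    refine ⟨Fin.snoc (α := fun _ => V) b (MulOpposite.op ((‖w‖⁻¹ : ℝ) : ℍ) • w),
      Fin.snoc (α := fun _ => ℝ) d t, orthonormal_snoc hb hw0 horth, fun i => ?_⟩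
    induction i using Fin.lastCases with
    | last =>
      rw [Fin.snoc_last, Fin.snoc_last, map_smul, hAw, smul_smul, smul_smul, ← MulOpposite.op_mul,
        ← MulOpposite.op_mul, Quaternion.coe_commutes]
    | cast i => rw [Fin.snoc_castSucc, Fin.snoc_castSucc, hd]

theorem isOrthonormalBasis_of_card [Module.Finite ℍᵐᵒᵖ V] {n : ℕ} {b : Fin n → V}
    (hb : ∀ i j, inner ℍ (b i) (b j) = if i = j then 1 else 0)
    (hn : n = Module.finrank ℍᵐᵒᵖ V) : IsOrthonormalBasis b :=
  ⟨hb, (linearIndependent_of_orthonormal hb).span_eq_top_of_card_eq_finrank' (by simpa using hn)⟩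

/-- A self-adjoint endomorphism has an orthonormal basis of eigenvectors with real eigenvalues. -/
theorem exists_eigenbasis [Module.Finite ℍᵐᵒᵖ V] {A : V →ₗ[ℍᵐᵒᵖ] V}
    (hA : ∀ v w : V, inner ℍ (A v) w = inner ℍ v (A w)) :
    ∃ (b : Fin (Module.finrank ℍᵐᵒᵖ V) → V) (d : Fin (Module.finrank ℍᵐᵒᵖ V) → ℝ),
      IsOrthonormalBasis b ∧ ∀ i, A (b i) = MulOpposite.op (d i : ℍ) • b i := by
  obtain ⟨b, d, hb, hd⟩ := exists_eigenfamily hA _ le_rfl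
  exact ⟨b, d, isOrthonormalBasis_of_card hb rfl, hd⟩

end Basis

/-! ### Möbius inversion of principal minors -/

section Minors

/-! ### Alternating sums of principal minors -/

open Classical in
/-- The matrix `M` in which the rows and columns with index outside of `J` are replaced by those
of the identity. -/
def principalMatrix {n : ℕ} (M : Matrix (Fin n) (Fin n) ℍ) (J : Finset (Fin n)) :
    Matrix (Fin n) (Fin n) ℍ :=
  Matrix.of fun i j => if i ∈ J ∧ j ∈ J then M i j else if i = j then 1 else 0

theorem IsTransversal.mem_of_fixed {n : ℕ} {π : Equiv.Perm (Fin n)} {R : Finset (Fin n)}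
    (hR : IsTransversal π R) {i : Fin n} (hi : π i = i) : i ∈ R := by
  obtain ⟨r, hr, h⟩ := hR.1 i
  rwa [← h.symm.eq_of_left hi] at hr

/-- The diagonal of the matrix enters the weight only through the fixed points of `π`, one factor
for each. Matrices that agree with `M` along the nontrivial cycles share the remaining constant,
which can then be ignored. -/
theorem permWeight_eq_prod_fixed {n : ℕ} (π : Equiv.Perm (Fin n)) (M : Matrix (Fin n) (Fin n) ℍ) :
    ∃ c : ℝ, ∀ N : Matrix (Fin n) (Fin n) ℍ, (∀ i, π i ≠ i → N i (π i) = M i (π i)) →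
      permWeight N π = (∏ i, if π i = i then (N i i).re else 1) * c := by
  classical
  obtain ⟨R, -, hR⟩ := exists_isTransversal π ∅ (by simp)
  refine ⟨∏ r ∈ R with π r ≠ r, cycleWeight M π r, fun N hN => ?_⟩
  rw [hR.permWeight_eq, ← Finset.prod_filter_mul_prod_filter_not R (fun r => π r = r)]
  congr 1
  · rw [← Finset.prod_filter]
    have : R.filter (fun r => π r = r) = Finset.univ.filter fun r => π r = r := by
      ext r
      simpa using fun h => hR.mem_of_fixed h
    rw [this]
    refine Finset.prod_congr rfl fun r hr => cycleWeight_of_fixed N (Finset.mem_filter.1 hr).2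
  · refine Finset.prod_congr rfl fun r hr => cycleWeight_congr (fun _ => rfl) fun t => ?_
    rw [pow_succ', Equiv.Perm.mul_apply]
    refine hN _ fun h => (Finset.mem_filter.1 hr).2 ?_
    rw [← Equiv.Perm.mul_apply, ← pow_succ', pow_succ, Equiv.Perm.mul_apply] at h
    exact (π ^ t).injective h

/-- The alternating sum over `T` is the expansion of a product over `Kᶜ` of differences, with one
factor for each index that may or may not be added to `K`. -/
theorem sum_permWeight_principalMatrix {n : ℕ} (M : Matrix (Fin n) (Fin n) ℍ)
    (π : Equiv.Perm (Fin n)) (K : Finset (Fin n)) :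
    ∑ T ∈ Kᶜ.powerset, (-1 : ℝ) ^ T.card * permWeight (principalMatrix M (K ∪ T)) π =
      (-1) ^ Kᶜ.card *
        permWeight (M - Matrix.diagonal fun i => if i ∈ K then 0 else 1) π := by
  classical
  obtain ⟨c, hc⟩ := permWeight_eq_prod_fixed π M
  -- An index outside `J` contributes `1` if `π` fixes it; otherwise it meets a zero off-diagonal
  -- entry of `principalMatrix` and the whole weight vanishes.
  have hJ : ∀ J : Finset (Fin n), permWeight (principalMatrix M J) π =
      (∏ i, if i ∈ J then (if π i = i then (M i i).re else 1) else if π i = i then 1 else 0) *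
        c := by
    intro J
    by_cases h : ∃ i, i ∉ J ∧ π i ≠ i
    · obtain ⟨i, hi, hπ⟩ := h
      rw [permWeight_eq_zero (i := i) (by simp [principalMatrix, hi, hπ.symm]),
        Finset.prod_eq_zero (Finset.mem_univ i) (by simp [hi, hπ]), zero_mul]
    · push Not at h
      have hm : ∀ i, π i ≠ i → i ∈ J := fun i hi => by_contra fun hJ => hi (h i hJ)
      rw [hc]
      · congr 1
        refine Finset.prod_congr rfl fun i _ => ?_
        by_cases hi : i ∈ J
        · simp [principalMatrix, hi]
        · simp [principalMatrix, hi, h i hi]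
      · intro i hi
        have h2 : π i ∈ J := hm _ fun h => hi (π.injective h)
        simp [principalMatrix, hm i hi, h2]
  rw [hc]
  swap
  · intro i hi
    rw [Matrix.sub_apply, Matrix.diagonal_apply_ne _ hi.symm, sub_zero]
  simp only [hJ]
  set x : Fin n → ℝ := fun i => if π i = i then (M i i).re else 1 with hx
  set y : Fin n → ℝ := fun i => if π i = i then 1 else 0 with hy
  have h1 : ∀ T ∈ Kᶜ.powerset, (-1 : ℝ) ^ T.card *
      ((∏ i, if i ∈ K ∪ T then x i else y i) * c) =
      (∏ i ∈ K, x i) * c * ((∏ i ∈ T, -x i) * ∏ i ∈ Kᶜ \ T, y i) := by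
    intro T hT
    rw [Finset.mem_powerset] at hT
    rw [← Finset.prod_mul_prod_compl K]
    have h2 : ∏ i ∈ K, (if i ∈ K ∪ T then x i else y i) = ∏ i ∈ K, x i :=
      Finset.prod_congr rfl fun i hi => if_pos (Finset.mem_union_left _ hi)
    have h3 : ∏ i ∈ Kᶜ, (if i ∈ K ∪ T then x i else y i) =
        (∏ i ∈ T, x i) * ∏ i ∈ Kᶜ \ T, y i := by
      rw [← Finset.prod_sdiff hT, mul_comm]
      congr 1
      · exact Finset.prod_congr rfl fun i hi => if_pos (Finset.mem_union_right _ hi)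
      · refine Finset.prod_congr rfl fun i hi => if_neg ?_
        simpa [not_or] using hi
    rw [h2, h3, Finset.prod_neg]
    ring
  rw [Finset.sum_congr rfl h1, ← Finset.mul_sum, ← Finset.prod_add,
    ← Finset.prod_mul_prod_compl K (fun i => if π i = i then
      ((M - Matrix.diagonal fun i => if i ∈ K then (0 : ℍ) else 1) i i).re else (1 : ℝ))]
  have h4 : ∏ i ∈ K, (if π i = i then
      ((M - Matrix.diagonal fun i => if i ∈ K then (0 : ℍ) else 1) i i).re else (1 : ℝ)) =
      ∏ i ∈ K, x i := Finset.prod_congr rfl fun i hi => by simp [hx, hi]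
  -- At a fixed index the factor is `1 - Re M i i`, minus the diagonal entry of the shifted matrix;
  -- at a moved index it is `-1`. So each index of `Kᶜ` gives one sign.
  have h5 : ∏ i ∈ Kᶜ, (-x i + y i) = (-1) ^ Kᶜ.card * ∏ i ∈ Kᶜ, (if π i = i then
      ((M - Matrix.diagonal fun i => if i ∈ K then (0 : ℍ) else 1) i i).re else (1 : ℝ)) := by
    rw [← Finset.prod_neg]
    refine Finset.prod_congr rfl fun i hi => ?_
    rw [Finset.mem_compl] at hi
    by_cases h : π i = i
    · simp [hx, hy, hi, h]; ring
    · simp [hx, hy, h]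
  rw [h4, h5]
  ring

/-- This converts a Möbius sum of minors, of unclear sign, to a single determinant whose sign can be
read off eigenvalues. -/
theorem sum_mooreDet_principalMatrix {n : ℕ} (M : Matrix (Fin n) (Fin n) ℍ) (K : Finset (Fin n)) :
    ∑ T ∈ Kᶜ.powerset, (-1 : ℝ) ^ T.card * mooreDet (principalMatrix M (K ∪ T)) =
      (-1) ^ Kᶜ.card * mooreDet (M - Matrix.diagonal fun i => if i ∈ K then 0 else 1) := by
  simp only [mooreDet_eq, Finset.mul_sum]
  rw [Finset.sum_comm]
  refine Finset.sum_congr rfl fun π _ => ?_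
  have := sum_permWeight_principalMatrix M π K
  calc _ = ((Equiv.Perm.sign π : ℤ) : ℝ) * ∑ T ∈ Kᶜ.powerset,
        (-1 : ℝ) ^ T.card * permWeight (principalMatrix M (K ∪ T)) π := by
        rw [Finset.mul_sum]
        exact Finset.sum_congr rfl fun T _ => by ring
    _ = _ := by rw [this]; ring

theorem sum_alternating_eq_powerset {ι : Type*} [Fintype ι] [DecidableEq ι] (f : Finset ι → ℝ)
    (K : Finset ι) :
    ∑ J : Finset ι with K ⊆ J, (-1 : ℝ) ^ (J \ K).card * f J =
      ∑ T ∈ Kᶜ.powerset, (-1 : ℝ) ^ T.card * f (K ∪ T) := by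
  refine Finset.sum_bij' (fun J _ => J \ K) (fun T _ => K ∪ T) ?_ ?_ ?_ ?_ ?_
  · intro J _
    rw [Finset.mem_powerset]
    intro i hi
    simpa using (Finset.mem_sdiff.1 hi).2
  · intro T _; simp
  · intro J hJ; exact Finset.union_sdiff_of_subset (Finset.mem_filter.1 hJ).2
  · intro T hT
    rw [Finset.mem_powerset] at hT
    exact Finset.union_sdiff_cancel_left
      (Finset.disjoint_right.2 fun i hi => Finset.mem_compl.1 (hT hi))
  · intro J hJ
    rw [Finset.union_sdiff_of_subset (Finset.mem_filter.1 hJ).2]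

/-- Möbius inversion on the lattice of subsets. -/
theorem sum_sum_alternating {ι : Type*} [Fintype ι] [DecidableEq ι] (f : Finset ι → ℝ)
    (L : Finset ι) :
    ∑ K : Finset ι with L ⊆ K, ∑ J : Finset ι with K ⊆ J, (-1 : ℝ) ^ (J \ K).card * f J = f L := by
  have h1 : ∀ K : Finset ι, ∑ J : Finset ι with K ⊆ J, (-1 : ℝ) ^ (J \ K).card * f J =
      ∑ J : Finset ι, if K ⊆ J then (-1 : ℝ) ^ (J \ K).card * f J else 0 := fun K =>
    Finset.sum_filter _ _
  simp only [h1]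
  rw [Finset.sum_comm]
  -- For fixed `J`, the signs of the sets between `L` and `J` cancel unless the interval is reduced
  -- to one point.
  have h2 : ∀ J : Finset ι, ∑ K : Finset ι with L ⊆ K,
      (if K ⊆ J then (-1 : ℝ) ^ (J \ K).card * f J else 0) = if J = L then f L else 0 := by
    intro J
    rw [← Finset.sum_filter, Finset.filter_filter]
    by_cases hLJ : L ⊆ J
    · have h3 : ∑ K : Finset ι with L ⊆ K ∧ K ⊆ J, (-1 : ℝ) ^ (J \ K).card * f J =
          ∑ T ∈ (J \ L).powerset, (-1 : ℝ) ^ T.card * f J := by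
        refine Finset.sum_bij' (fun K _ => J \ K) (fun T _ => J \ T) ?_ ?_ ?_ ?_ ?_
        · intro K hK
          exact Finset.mem_powerset.2 (Finset.sdiff_subset_sdiff subset_rfl
            (Finset.mem_filter.1 hK).2.1)
        · intro T hT
          rw [Finset.mem_powerset] at hT
          refine Finset.mem_filter.2 ⟨Finset.mem_univ _, fun i hi => ?_, Finset.sdiff_subset⟩
          exact Finset.mem_sdiff.2 ⟨hLJ hi, fun hiT => (Finset.mem_sdiff.1 (hT hiT)).2 hi⟩
        · intro K hK
          exact Finset.sdiff_sdiff_eq_self (Finset.mem_filter.1 hK).2.2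
        · intro T hT
          exact Finset.sdiff_sdiff_eq_self ((Finset.mem_powerset.1 hT).trans Finset.sdiff_subset)
        · intro K _; rfl
      rw [h3, ← Finset.sum_mul]
      have h4 : ∑ T ∈ (J \ L).powerset, (-1 : ℝ) ^ T.card = if J \ L = ∅ then 1 else 0 := by
        have := Finset.sum_powerset_neg_one_pow_card (x := J \ L)
        exact_mod_cast this
      rw [h4]
      by_cases h : J = L
      · subst h; simp
      · rw [if_neg, if_neg h, zero_mul]
        exact fun h0 => h (Finset.Subset.antisymm (Finset.sdiff_eq_empty_iff_subset.1 h0) hLJ)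
    · rw [if_neg (fun h => hLJ h.ge), Finset.sum_eq_zero]
      intro K hK
      exact absurd ((Finset.mem_filter.1 hK).2.1.trans (Finset.mem_filter.1 hK).2.2) hLJ
  simp [h2]

end Minors

/-! ### Compressions of a kernel and positivity of the weights -/

section Projections

open QuaternionicInnerProductSpace

variable {V : Type*} [NormedAddCommGroup V] [Module ℍᵐᵒᵖ V] [QuaternionicInnerProductSpace V]
  [Module.Finite ℍᵐᵒᵖ V]

/-! ### Orthogonal projections and compressions -/

theorem coe_orthProj_eq {R : Submodule ℍᵐᵒᵖ V} {v w : V} (hw : w ∈ R)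
    (h : ∀ r ∈ R, inner ℍ (v - w) r = 0) : (orthProj R v : V) = w := by
  refine sub_eq_zero.1 (eq_zero_of_inner_self ?_)
  have hmem : (orthProj R v : V) - w ∈ R := R.sub_mem (orthProj R v).2 hw
  have h1 := h _ hmem
  have h2 := inner_sub_orthProj R v _ hmem
  have h3 : (orthProj R v : V) - w = (v - w) + -(v - orthProj R v) := by abel
  have h4 : inner ℍ (-(v - (orthProj R v : V))) ((orthProj R v : V) - w) = 0 := by
    rw [← star_inner, inner_neg_right, ← star_inner, h2]; simp
  conv_lhs => lhs; rw [h3]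
  rw [hinner_add_left, h1, h4, add_zero]

theorem orthProj_of_mem {R : Submodule ℍᵐᵒᵖ V} {v : V} (hv : v ∈ R) : (orthProj R v : V) = v :=
  coe_orthProj_eq hv fun r _ => by rw [sub_self, inner_zero_left]

theorem coe_orthProj_span_image {ι : Type*} [DecidableEq ι] {b : ι → V}
    (hb : ∀ i j, inner ℍ (b i) (b j) = if i = j then 1 else 0) (J : Finset ι) (v : V) :
    (orthProj (Submodule.span ℍᵐᵒᵖ (b '' J)) v : V) =
      ∑ i ∈ J, MulOpposite.op (inner ℍ (b i) v) • b i := by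
  refine coe_orthProj_eq (Submodule.sum_mem _ fun i hi =>
    Submodule.smul_mem _ _ (Submodule.subset_span ⟨i, hi, rfl⟩)) fun r hr => ?_
  refine inner_eq_zero_of_mem_span ?_ hr
  rintro _ ⟨i, hi, rfl⟩
  rw [← star_inner, inner_sub_right, inner_sum_right]
  have hi' : i ∈ J := hi
  simp [inner_smul_right, hb, hi']

theorem inner_orthProj_left (R : Submodule ℍᵐᵒᵖ V) (v : V) {w : V} (hw : w ∈ R) :
    inner ℍ (orthProj R v : V) w = inner ℍ v w := by
  have := inner_sub_orthProj R v w hw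
  rw [← star_inner, inner_sub_right] at this
  have h2 : inner ℍ w v = inner ℍ w (orthProj R v : V) :=
    sub_eq_zero.1 (star_eq_zero.1 this)
  rw [← star_inner, ← h2, star_inner]

theorem inner_orthProj_right (R : Submodule ℍᵐᵒᵖ V) (v : V) {w : V} (hw : w ∈ R) :
    inner ℍ w (orthProj R v : V) = inner ℍ w v := by
  rw [← star_inner, inner_orthProj_left R v hw, star_inner]

theorem inner_orthProj_comm (R : Submodule ℍᵐᵒᵖ V) (v w : V) :
    inner ℍ (orthProj R v : V) w = inner ℍ v (orthProj R w : V) := by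
  rw [← inner_orthProj_right R w (orthProj R v).2, inner_orthProj_left R v (orthProj R w).2]

theorem compression_selfAdjoint {k : V →ₗ[ℍᵐᵒᵖ] V}
    (hk : ∀ v w : V, inner ℍ (k v) w = inner ℍ v (k w)) (R : Submodule ℍᵐᵒᵖ V) (v w : R) :
    inner ℍ (compression k R v) w = inner ℍ v (compression k R w) := by
  change inner ℍ (orthProj R (k v) : V) (w : V) = inner ℍ (v : V) (orthProj R (k w) : V)
  rw [inner_orthProj_left _ _ w.2, inner_orthProj_right _ _ v.2, hk]

/-- The compression of `k` to `R`, extended by the identity on the orthogonal complement. -/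
def extendedCompression (k : V →ₗ[ℍᵐᵒᵖ] V) (R : Submodule ℍᵐᵒᵖ V) : V →ₗ[ℍᵐᵒᵖ] V :=
  R.subtype ∘ₗ orthProj R ∘ₗ k ∘ₗ R.subtype ∘ₗ orthProj R +
    (LinearMap.id - R.subtype ∘ₗ orthProj R)

theorem extendedCompression_apply (k : V →ₗ[ℍᵐᵒᵖ] V) (R : Submodule ℍᵐᵒᵖ V) (v : V) :
    extendedCompression k R v =
      (orthProj R (k (orthProj R v : V)) : V) + (v - (orthProj R v : V)) := rfl

theorem inner_extendedCompression (k : V →ₗ[ℍᵐᵒᵖ] V) (R : Submodule ℍᵐᵒᵖ V) (v w : V) :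
    inner ℍ v (extendedCompression k R w) =
      inner ℍ (orthProj R v : V) (k (orthProj R w : V)) +
        (inner ℍ v w - inner ℍ v (orthProj R w : V)) := by
  rw [extendedCompression_apply, hinner_add_right, inner_sub_right, inner_orthProj_comm]

theorem extendedCompression_selfAdjoint {k : V →ₗ[ℍᵐᵒᵖ] V}
    (hk : ∀ v w : V, inner ℍ (k v) w = inner ℍ v (k w)) (R : Submodule ℍᵐᵒᵖ V) (v w : V) :
    inner ℍ (extendedCompression k R v) w = inner ℍ v (extendedCompression k R w) := by
  rw [← star_inner, inner_extendedCompression, inner_extendedCompression, star_add, star_sub,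
    star_inner, star_inner, star_inner, hk, ← inner_orthProj_comm R v w]

variable (V) in
theorem onb_isOrthonormalBasis : IsOrthonormalBasis (onb V) :=
  (exists_isOrthonormalBasis V).choose_spec

/-- The Moore determinant of the compression of `k` to `R`. -/
def compressionDet (k : V →ₗ[ℍᵐᵒᵖ] V) (R : Submodule ℍᵐᵒᵖ V) : ℝ :=
  -- The basis of `V` is fixed and the size of the matrix does not depend on `R`. Continuity in `R`
  -- and the comparison with `principalMatrix` become direct.
  mooreDet (matrixOf (onb V) (extendedCompression k R))

theorem hasMooreDet_extendedCompression {k : V →ₗ[ℍᵐᵒᵖ] V}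
    (hk : ∀ v w : V, inner ℍ (k v) w = inner ℍ v (k w)) (R : Submodule ℍᵐᵒᵖ V) :
    HasMooreDet (extendedCompression k R) (compressionDet k R) :=
  hasMooreDet_of_selfAdjoint (extendedCompression_selfAdjoint hk R) (onb_isOrthonormalBasis V)

omit [Module.Finite ℍᵐᵒᵖ V] in
theorem isOrthonormalBasis_equiv {ι : Type*} [DecidableEq ι] {b : ι → V}
    (hb : ∀ i j, inner ℍ (b i) (b j) = if i = j then 1 else 0)
    (hs : Submodule.span ℍᵐᵒᵖ (Set.range b) = ⊤) {n : ℕ} (e : Fin n ≃ ι) :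
    IsOrthonormalBasis fun i => b (e i) := by
  refine ⟨fun i j => by simp [hb], ?_⟩
  rw [← hs, ← e.surjective.range_comp b]; rfl

omit [Module.Finite ℍᵐᵒᵖ V] in
theorem hasMooreDet_prod_fintype {ι : Type*} [Fintype ι] [DecidableEq ι] {A : V →ₗ[ℍᵐᵒᵖ] V}
    (hA : ∀ v w : V, inner ℍ (A v) w = inner ℍ v (A w)) {b : ι → V}
    (hb : ∀ i j, inner ℍ (b i) (b j) = if i = j then 1 else 0)
    (hs : Submodule.span ℍᵐᵒᵖ (Set.range b) = ⊤) {d : ι → ℝ}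
    (hd : ∀ i, A (b i) = MulOpposite.op (d i : ℍ) • b i) : HasMooreDet A (∏ i, d i) := by
  have e := (Fintype.equivFin ι).symm
  rw [← e.prod_comp]
  exact hasMooreDet_prod hA (isOrthonormalBasis_equiv hb hs e) fun i => hd _

/-- An orthonormal basis of a subspace and one of its orthogonal complement form an orthonormal
basis. -/
theorem orthonormal_sumElim {R : Submodule ℍᵐᵒᵖ V} {ι : Type*} [Fintype ι] [DecidableEq ι]
    {b : ι → V} (hb : ∀ i j, inner ℍ (b i) (b j) = if i = j then 1 else 0)
    (hs : Submodule.span ℍᵐᵒᵖ (Set.range b) = R) :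
    let c : ι ⊕ Fin (Module.finrank ℍᵐᵒᵖ (LinearMap.ker (orthProj R))) → V :=
      Sum.elim b fun i => (onb (LinearMap.ker (orthProj R)) i : V)
    (∀ i j, inner ℍ (c i) (c j) = if i = j then 1 else 0) ∧
      Submodule.span ℍᵐᵒᵖ (Set.range c) = ⊤ := by
  intro c
  have ho := onb_isOrthonormalBasis (LinearMap.ker (orthProj R))
  have hker : ∀ v ∈ LinearMap.ker (orthProj R), ∀ r ∈ R, inner ℍ r v = 0 := fun v hv r hr => by
    rw [← inner_orthProj_right R v hr, LinearMap.mem_ker.1 hv]; exact inner_zero_right _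
  have hbR : ∀ i, b i ∈ R := fun i => hs ▸ Submodule.subset_span ⟨i, rfl⟩
  refine ⟨?_, ?_⟩
  · rintro (i | i) (j | j)
    · simp [c, hb]
    · simpa [c] using hker _ (onb (LinearMap.ker (orthProj R)) j).2 _ (hbR i)
    · have := hker _ (onb (LinearMap.ker (orthProj R)) i).2 _ (hbR j)
      simp [c, ← star_inner (b j), this]
    · have : inner ℍ (onb (LinearMap.ker (orthProj R)) i : V)
          (onb (LinearMap.ker (orthProj R)) j : V) = if i = j then 1 else 0 := ho.1 i j
      simp [c, this]
  · have hker' : LinearMap.ker (orthProj R) ≤ Submodule.span ℍᵐᵒᵖ (Set.range c) := by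
      have h1 := congrArg (Submodule.map (LinearMap.ker (orthProj R)).subtype) ho.2
      rw [Submodule.map_span, Submodule.map_top, Submodule.range_subtype] at h1
      refine h1.symm.le.trans (Submodule.span_mono ?_)
      rintro _ ⟨_, ⟨i, rfl⟩, rfl⟩
      exact ⟨Sum.inr i, rfl⟩
    have hR : R ≤ Submodule.span ℍᵐᵒᵖ (Set.range c) := by
      refine hs.symm.le.trans (Submodule.span_mono ?_)
      rintro _ ⟨i, rfl⟩
      exact ⟨Sum.inl i, rfl⟩
    rw [eq_top_iff]
    intro v _
    rw [← add_sub_cancel (orthProj R v : V) v]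
    refine Submodule.add_mem _ (hR (orthProj R v).2) (hker' ?_)
    rw [LinearMap.mem_ker, map_sub]
    refine Subtype.ext ?_
    rw [Submodule.coe_sub, orthProj_of_mem (orthProj R v).2, sub_self]; rfl

omit [QuaternionicInnerProductSpace V] [Module.Finite ℍᵐᵒᵖ V] in
theorem span_coe_eq {R : Submodule ℍᵐᵒᵖ V} {ι : Type*} {b : ι → R}
    (hb : Submodule.span ℍᵐᵒᵖ (Set.range b) = ⊤) :
    Submodule.span ℍᵐᵒᵖ (Set.range fun i => (b i : V)) = R := by
  have h1 := congrArg (Submodule.map R.subtype) hb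
  rw [Submodule.map_span, Submodule.map_top, Submodule.range_subtype] at h1
  conv_rhs => rw [← h1]
  congr 1
  ext x
  simp

/-- An eigenbasis of the compression, completed by an orthonormal basis of the kernel of the
projection, diagonalises the extended compression. The eigenvalues added are all `1`, so the product
is unchanged. -/
theorem exists_compression_eigenbasis {k : V →ₗ[ℍᵐᵒᵖ] V}
    (hk : ∀ v w : V, inner ℍ (k v) w = inner ℍ v (k w)) (R : Submodule ℍᵐᵒᵖ V) :
    ∃ (b : Fin (Module.finrank ℍᵐᵒᵖ R) → R) (d : Fin (Module.finrank ℍᵐᵒᵖ R) → ℝ),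
      IsOrthonormalBasis b ∧ (∀ i, compression k R (b i) = MulOpposite.op (d i : ℍ) • b i) ∧
      compressionDet k R = ∏ i, d i := by
  obtain ⟨b, d, hb, hd⟩ := exists_eigenbasis (compression_selfAdjoint hk R)
  refine ⟨b, d, hb, hd, ?_⟩
  have hbc : ∀ i j, inner ℍ (b i : V) (b j : V) = if i = j then 1 else 0 := hb.1
  obtain ⟨h1, h2⟩ := orthonormal_sumElim hbc (span_coe_eq hb.2)
  have h3 := hasMooreDet_prod_fintype (extendedCompression_selfAdjoint hk R) h1 h2
    (d := Sum.elim d fun _ => 1) (by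
      rintro (i | i)
      · rw [Sum.elim_inl, Sum.elim_inl, extendedCompression_apply, orthProj_of_mem (b i).2,
          sub_self, add_zero]
        exact congrArg Subtype.val (hd i)
      · rw [Sum.elim_inr, Sum.elim_inr, extendedCompression_apply,
          LinearMap.mem_ker.1 (onb (LinearMap.ker (orthProj R)) i).2]
        simp)
  rw [(hasMooreDet_extendedCompression hk R).unique h3, Fintype.prod_sum_type]
  simp

theorem hasMooreDet_compression {k : V →ₗ[ℍᵐᵒᵖ] V}
    (hk : ∀ v w : V, inner ℍ (k v) w = inner ℍ v (k w)) (R : Submodule ℍᵐᵒᵖ V) :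
    HasMooreDet (compression k R) (compressionDet k R) := by
  obtain ⟨b, d, hb, hd, h⟩ := exists_compression_eigenbasis hk R
  rw [h]
  exact hasMooreDet_prod (compression_selfAdjoint hk R) hb hd

/-! ### Positivity -/

omit [Module.Finite ℍᵐᵒᵖ V] in
theorem re_inner_eigenbasis {n : ℕ} {A : V →ₗ[ℍᵐᵒᵖ] V} {b : Fin n → V}
    (hb : IsOrthonormalBasis b) {d : Fin n → ℝ}
    (hd : ∀ i, A (b i) = MulOpposite.op (d i : ℍ) • b i) (v : V) :
    (inner ℍ v (A v)).re = ∑ i, d i * ‖inner ℍ (b i) v‖ ^ 2 := by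
  have hv : v ∈ Submodule.span ℍᵐᵒᵖ (Set.range b) := hb.2 ▸ Submodule.mem_top
  have h1 : A v = ∑ i, MulOpposite.op ((d i : ℍ) * inner ℍ (b i) v) • b i := by
    conv_lhs => rw [← sum_inner_smul hb.1 hv, map_sum]
    refine Finset.sum_congr rfl fun i _ => ?_
    rw [map_smul, hd, smul_smul, MulOpposite.op_mul]
  have hre : ∀ (f : Fin n → ℍ), (∑ i, f i).re = ∑ i, (f i).re := fun f =>
    map_sum (⟨⟨fun x : ℍ => x.re, rfl⟩, fun _ _ => rfl⟩ : ℍ →+ ℝ) f Finset.univ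
  rw [h1, inner_sum_right, hre]
  refine Finset.sum_congr rfl fun i _ => ?_
  rw [inner_smul_right, Quaternion.coe_commutes, ← mul_assoc, ← star_inner (b i) v,
    Quaternion.star_mul_self, Quaternion.normSq_eq_norm_mul_self, ← Quaternion.coe_mul,
    Quaternion.re_coe]
  ring

omit [Module.Finite ℍᵐᵒᵖ V] in
theorem norm_sq_eq_sum {n : ℕ} {b : Fin n → V} (hb : IsOrthonormalBasis b) (v : V) :
    ‖v‖ ^ 2 = ∑ i, ‖inner ℍ (b i) v‖ ^ 2 := by
  have h := re_inner_eigenbasis (A := LinearMap.id) hb (d := fun _ => 1) (by simp) v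
  simp only [LinearMap.id_apply, one_mul, hinner_self, Quaternion.re_coe] at h
  exact h

/-- The condition on right eigenvalues is turned, through an eigenbasis, into bounds on the
quadratic form, here and in `IsKernel.re_inner_le`. Unlike eigenvalues, these pass to subspaces. -/
theorem IsKernel.re_inner_nonneg {k : V →ₗ[ℍᵐᵒᵖ] V} (hk : IsKernel k) (v : V) :
    0 ≤ (inner ℍ v (k v)).re := by
  obtain ⟨b, d, hb, hd⟩ := exists_eigenbasis hk.selfAdjoint
  rw [re_inner_eigenbasis hb hd]
  refine Finset.sum_nonneg fun i _ => mul_nonneg ?_ (by positivity)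
  obtain ⟨t, h0, -, ht⟩ := hk.eigenvalue (d i) (b i)
    ((linearIndependent_of_orthonormal hb.1).ne_zero i) (hd i)
  rwa [Quaternion.coe_injective ht]

theorem IsKernel.re_inner_le {k : V →ₗ[ℍᵐᵒᵖ] V} (hk : IsKernel k) (v : V) :
    (inner ℍ v (k v)).re ≤ ‖v‖ ^ 2 := by
  obtain ⟨b, d, hb, hd⟩ := exists_eigenbasis hk.selfAdjoint
  rw [re_inner_eigenbasis hb hd, norm_sq_eq_sum hb]
  refine Finset.sum_le_sum fun i _ => mul_le_of_le_one_left (by positivity) ?_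
  obtain ⟨t, -, h1, ht⟩ := hk.eigenvalue (d i) (b i)
    ((linearIndependent_of_orthonormal hb.1).ne_zero i) (hd i)
  rwa [Quaternion.coe_injective ht]

/-- An eigenvalue of the compression, with unit eigenvector `v` in `R`, is the value `⟨v, k v⟩` of
the quadratic form of `k`. -/
theorem IsKernel.compressionDet_nonneg {k : V →ₗ[ℍᵐᵒᵖ] V} (hk : IsKernel k)
    (R : Submodule ℍᵐᵒᵖ V) : 0 ≤ compressionDet k R := by
  obtain ⟨b, d, hb, hd, h⟩ := exists_compression_eigenbasis hk.selfAdjoint R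
  rw [h]
  refine Finset.prod_nonneg fun i _ => ?_
  have h1 : inner ℍ (b i : V) (compression k R (b i) : V) = d i := by
    rw [hd]
    have : inner ℍ (b i : V) (b i : V) = 1 :=
      (hb.1 i i).trans (if_pos rfl)
    rw [Submodule.coe_smul, inner_smul_right, this, one_mul]
  have h2 : inner ℍ (b i : V) (compression k R (b i) : V) = inner ℍ (b i : V) (k (b i)) :=
    inner_orthProj_right R _ (b i).2
  have h3 := hk.re_inner_nonneg (b i : V)
  rwa [← h2, h1, Quaternion.re_coe] at h3

omit [Module.Finite ℍᵐᵒᵖ V] in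
theorem linearIndependent_of_orthonormal_fintype {ι : Type*} [Fintype ι] [DecidableEq ι] {f : ι → V}
    (hf : ∀ a b, inner ℍ (f a) (f b) = if a = b then 1 else 0) : LinearIndependent ℍᵐᵒᵖ f := by
  have e := (Fintype.equivFin ι).symm
  rw [← linearIndependent_equiv e]
  exact linearIndependent_of_orthonormal fun i j => by simp [hf]

omit [Module.Finite ℍᵐᵒᵖ V] in
theorem finrank_span_image {ι : Type*} [Fintype ι] [DecidableEq ι] {b : ι → V}
    (hb : ∀ i j, inner ℍ (b i) (b j) = if i = j then 1 else 0) (J : Finset ι) :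
    Module.finrank ℍᵐᵒᵖ (Submodule.span ℍᵐᵒᵖ (b '' J)) = J.card := by
  have h := finrank_span_eq_card ((linearIndependent_of_orthonormal_fintype hb).comp
    (Subtype.val : J → ι) Subtype.val_injective)
  rw [Set.range_comp, Subtype.range_coe_subtype, Fintype.card_coe] at h
  exact h

omit [Module.Finite ℍᵐᵒᵖ V] in
theorem inner_eq_zero_of_mem_span_image {ι : Type*} [DecidableEq ι] {b : ι → V}
    (hb : ∀ i j, inner ℍ (b i) (b j) = if i = j then 1 else 0) {J : Set ι} {i : ι} (hi : i ∉ J)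
    {v : V} (hv : v ∈ Submodule.span ℍᵐᵒᵖ (b '' J)) : inner ℍ (b i) v = 0 := by
  refine inner_eq_zero_of_mem_span ?_ hv
  rintro _ ⟨j, hj, rfl⟩
  rw [hb, if_neg]
  rintro rfl
  exact hi hj

/-- On a subspace where the quadratic form of `A` is nonpositive, there are no more dimensions than
nonpositive eigenvalues. -/
theorem card_add_card_le {n : ℕ} {A : V →ₗ[ℍᵐᵒᵖ] V} {b c : Fin n → V}
    (hb : IsOrthonormalBasis b) (hc : IsOrthonormalBasis c) {d : Fin n → ℝ}
    (hd : ∀ i, A (c i) = MulOpposite.op (d i : ℍ) • c i) (ε : ℝ) {S P : Finset (Fin n)}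
    (hS : ∀ v ∈ Submodule.span ℍᵐᵒᵖ (b '' S), ε * (inner ℍ v (A v)).re ≤ 0)
    (hP : ∀ i ∈ P, 0 < ε * d i) : P.card + S.card ≤ n := by
  -- In the eigenbasis, the form of a common vector, multiplied by `ε`, is a sum of nonnegative
  -- terms that is nonpositive, so every coordinate vanishes. The sign `ε = ±1` serves to count
  -- positive and negative eigenvalues with the same argument.
  have hdisj : Disjoint (Submodule.span ℍᵐᵒᵖ (c '' P)) (Submodule.span ℍᵐᵒᵖ (b '' S)) := by
    rw [Submodule.disjoint_def]
    intro v hv hvS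
    have h1 := hS v hvS
    have hout : ∀ i, i ∉ P → inner ℍ (c i) v = 0 := fun i hi =>
      inner_eq_zero_of_mem_span_image hc.1 (J := (P : Set (Fin n))) hi hv
    have hterm : ∀ i ∈ Finset.univ, 0 ≤ ε * d i * ‖inner ℍ (c i) v‖ ^ 2 := fun i _ => by
      by_cases hi : i ∈ P
      · exact mul_nonneg (hP i hi).le (by positivity)
      · simp [hout i hi]
    rw [re_inner_eigenbasis hc hd, Finset.mul_sum] at h1
    simp only [← mul_assoc] at h1
    have h2 := (Finset.sum_eq_zero_iff_of_nonneg hterm).1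
      (le_antisymm h1 (Finset.sum_nonneg hterm))
    have h3 : ∀ i, inner ℍ (c i) v = 0 := fun i => by
      by_cases hi : i ∈ P
      · have := (mul_eq_zero.1 (h2 i (Finset.mem_univ i))).resolve_left (hP i hi).ne'
        exact norm_eq_zero.1 (pow_eq_zero_iff two_ne_zero |>.1 this)
      · exact hout i hi
    have h4 := norm_sq_eq_sum hc v
    simp only [h3] at h4
    exact norm_eq_zero.1 (by simpa using h4)
  have := Submodule.finrank_add_finrank_le_of_disjoint hdisj
  rwa [finrank_span_image hc.1, finrank_span_image hb.1, ← card_of_isOrthonormalBasis hb] at this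

/-- Here `A = k - P`, where `P` projects onto the span of the `b i` with `i ∉ K`. By `0 ≤ k ≤ 1` its
form is nonpositive on that span and nonnegative on the span of the other `b i`. If `A` is
invertible, it has therefore exactly `|Kᶜ|` negative eigenvalues, which gives the sign of the
determinant; if not, the determinant is zero. -/
theorem IsKernel.mooreDet_sub_diagonal_nonneg {k : V →ₗ[ℍᵐᵒᵖ] V} (hk : IsKernel k) {n : ℕ}
    {b : Fin n → V} (hb : IsOrthonormalBasis b) (K : Finset (Fin n)) :
    0 ≤ (-1) ^ Kᶜ.card *
      mooreDet (matrixOf b k - Matrix.diagonal fun i => if i ∈ K then 0 else 1) := by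
  let P : Submodule ℍᵐᵒᵖ V := Submodule.span ℍᵐᵒᵖ (b '' ((Kᶜ : Finset (Fin n)) : Set (Fin n)))
  have hPv : ∀ v, (orthProj P v : V) = ∑ i ∈ Kᶜ, MulOpposite.op (inner ℍ (b i) v) • b i :=
    coe_orthProj_span_image hb.1 _
  have hPmem : ∀ v ∈ Submodule.span ℍᵐᵒᵖ (b '' ((Kᶜ : Finset (Fin n)) : Set (Fin n))),
      (orthProj P v : V) = v := fun v hv => orthProj_of_mem hv
  clear_value P
  set A : V →ₗ[ℍᵐᵒᵖ] V := k - P.subtype ∘ₗ orthProj P with hAdef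
  have hAapp : ∀ v, A v = k v - (orthProj P v : V) := fun v => rfl
  have hA : ∀ v w : V, inner ℍ (A v) w = inner ℍ v (A w) := fun v w => by
    rw [← star_inner, hAapp, hAapp, inner_sub_right, inner_sub_right, star_sub, star_inner,
      star_inner, inner_orthProj_comm, hk.selfAdjoint]
  have hmat : matrixOf b k - Matrix.diagonal (fun i => if i ∈ K then (0 : ℍ) else 1) =
      matrixOf b A := by
    ext1 i j
    have : inner ℍ (b i) (orthProj P (b j) : V) =
        if i = j then (if i ∈ K then 0 else 1) else 0 := by
      rw [hPv, inner_sum_right]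
      simp only [inner_smul_right, hb.1]
      by_cases hij : i = j
      · subst hij; by_cases hi : i ∈ K <;> simp [hi]
      · simp [hij]
    rw [Matrix.sub_apply, matrixOf, matrixOf, Matrix.of_apply, Matrix.of_apply, hAapp,
      inner_sub_right, this, Matrix.diagonal_apply]
  have hn := card_of_isOrthonormalBasis hb
  obtain ⟨c, d, hc', hd⟩ := exists_eigenfamily hA n hn.le
  have hc := isOrthonormalBasis_of_card hc' hn
  rw [hmat, hasMooreDet_prod hA hc hd _ b hb]
  by_cases h0 : ∃ i, d i = 0
  · obtain ⟨i, hi⟩ := h0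
    rw [Finset.prod_eq_zero (Finset.mem_univ i) hi, mul_zero]
  push Not at h0
  -- At most `|K|` eigenvalues are positive by this bound and at most `|Kᶜ|` are negative by the
  -- next one. As none is zero, both are equalities.
  have h1 := card_add_card_le (A := A) hb hc hd 1 (S := Kᶜ)
    (P := Finset.univ.filter fun i => 0 < d i) (by
      intro v hv
      rw [one_mul, hAapp, hPmem v hv, inner_sub_right, hinner_self, Quaternion.re_sub,
        Quaternion.re_coe]
      linarith [hk.re_inner_le v]) (by simp)
  have h2 := card_add_card_le (A := A) hb hc hd (-1) (S := K)
    (P := Finset.univ.filter fun i => ¬ 0 < d i) (by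
      intro v hv
      have : (orthProj P v : V) = 0 := by
        rw [hPv]
        refine Finset.sum_eq_zero fun i hi => ?_
        rw [inner_eq_zero_of_mem_span_image hb.1 (J := (K : Set (Fin n))) (i := i)
          (fun h => Finset.mem_compl.1 hi h) hv, MulOpposite.op_zero, zero_smul]
      rw [hAapp, this, sub_zero]
      linarith [hk.re_inner_nonneg v]) (by
      intro i hi
      have := lt_of_le_of_ne (not_lt.1 (Finset.mem_filter.1 hi).2) (h0 i)
      linarith)
  have h3 := Finset.card_filter_add_card_filter_not (s := Finset.univ) (fun i => 0 < d i)
  have h4 := Finset.card_add_card_compl K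
  rw [Finset.card_univ, Fintype.card_fin] at h3
  rw [Fintype.card_fin] at h4
  have h5 : Kᶜ.card = (Finset.univ.filter fun i => ¬ 0 < d i).card := by omega
  rw [h5, ← Finset.prod_filter_mul_prod_filter_not Finset.univ (fun i => 0 < d i),
    mul_left_comm, ← Finset.prod_neg]
  refine mul_nonneg (Finset.prod_nonneg fun i hi => (Finset.mem_filter.1 hi).2.le)
    (Finset.prod_nonneg fun i hi => ?_)
  have := not_lt.1 (Finset.mem_filter.1 hi).2
  linarith

theorem compressionDet_span_image {k : V →ₗ[ℍᵐᵒᵖ] V}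
    (hk : ∀ v w : V, inner ℍ (k v) w = inner ℍ v (k w)) {n : ℕ} {b : Fin n → V}
    (hb : IsOrthonormalBasis b) (J : Finset (Fin n)) :
    compressionDet k (Submodule.span ℍᵐᵒᵖ (b '' J)) =
      mooreDet (principalMatrix (matrixOf b k) J) := by
  rw [← hasMooreDet_extendedCompression hk _ n b hb]
  congr 1
  have hin : ∀ i ∈ J, (orthProj (Submodule.span ℍᵐᵒᵖ (b '' J)) (b i) : V) = b i := fun i hi =>
    orthProj_of_mem (Submodule.subset_span ⟨i, hi, rfl⟩)
  have hout : ∀ i, i ∉ J → (orthProj (Submodule.span ℍᵐᵒᵖ (b '' J)) (b i) : V) = 0 :=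
    fun i hi => by
      rw [coe_orthProj_span_image hb.1]
      refine Finset.sum_eq_zero fun j hj => ?_
      rw [hb.1, if_neg (by rintro rfl; exact hi hj)]
      simp
  ext1 i j
  rw [matrixOf, Matrix.of_apply, inner_extendedCompression, principalMatrix, Matrix.of_apply]
  by_cases hi : i ∈ J <;> by_cases hj : j ∈ J
  · rw [hin i hi, hin j hj, sub_self, add_zero]
    simp [hi, hj, matrixOf]
  · rw [hout j hj, map_zero, inner_zero_right, inner_zero_right, hb.1]
    simp [hj]
  · rw [hout i hi, hin j hj, inner_zero_left, sub_self, add_zero]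
    have : i ≠ j := by rintro rfl; exact hi hj
    simp [hi, this]
  · rw [hout j hj, map_zero, inner_zero_right, inner_zero_right, hb.1]
    simp [hj]

/-- This is the nonnegativity of the weight of `K` in the determinantal process attached to the
basis `b`. The index type is transported to `Fin` because `mooreDet` is defined there. -/
theorem IsKernel.sum_alternating_nonneg {k : V →ₗ[ℍᵐᵒᵖ] V} (hk : IsKernel k) {ι : Type*}
    [Fintype ι] [DecidableEq ι] {b : ι → V}
    (hb : ∀ i j, inner ℍ (b i) (b j) = if i = j then 1 else 0)
    (hs : Submodule.span ℍᵐᵒᵖ (Set.range b) = ⊤) (K : Finset ι) :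
    0 ≤ ∑ J : Finset ι with K ⊆ J,
      (-1 : ℝ) ^ (J \ K).card * compressionDet k (Submodule.span ℍᵐᵒᵖ (b '' J)) := by
  have e := (Fintype.equivFin ι).symm
  have hbe := isOrthonormalBasis_equiv hb hs e
  have hmap : ∀ J : Finset (Fin (Fintype.card ι)),
      b '' (J.map e.toEmbedding : Finset ι) = (fun i => b (e i)) '' J := fun J => by
    rw [Finset.coe_map, Set.image_image]; rfl
  have h1 : ∑ J : Finset ι with K ⊆ J,
      (-1 : ℝ) ^ (J \ K).card * compressionDet k (Submodule.span ℍᵐᵒᵖ (b '' J)) =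
      ∑ J : Finset (Fin (Fintype.card ι)) with K.map e.symm.toEmbedding ⊆ J,
        (-1 : ℝ) ^ (J \ K.map e.symm.toEmbedding).card *
          compressionDet k (Submodule.span ℍᵐᵒᵖ ((fun i => b (e i)) '' J)) := by
    symm
    refine Finset.sum_bij' (fun J _ => J.map e.toEmbedding) (fun J _ => J.map e.symm.toEmbedding)
      ?_ ?_ ?_ ?_ ?_
    · intro J hJ
      have := Finset.map_subset_map (f := e.toEmbedding) |>.2 (Finset.mem_filter.1 hJ).2
      simpa [Finset.map_map] using this
    · intro J hJ
      simpa using (Finset.mem_filter.1 hJ).2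
    · intro J _; ext i; simp
    · intro J _; ext i; simp
    · intro J _
      rw [hmap]
      congr 2
      rw [← Finset.card_map e.toEmbedding]
      congr 1
      ext i
      simp
  rw [h1, sum_alternating_eq_powerset
    (fun J : Finset (Fin (Fintype.card ι)) =>
      compressionDet k (Submodule.span ℍᵐᵒᵖ ((fun i => b (e i)) '' J)))]
  simp only [compressionDet_span_image hk.selfAdjoint hbe]
  rw [sum_mooreDet_principalMatrix]
  exact hk.mooreDet_sub_diagonal_nonneg hbe _

end Projections

/-! ### Adapted bases, isometries and invariant measures -/

section Isometries

open QuaternionicInnerProductSpace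

variable {V : Type*} [NormedAddCommGroup V] [Module ℍᵐᵒᵖ V] [QuaternionicInnerProductSpace V]
variable {V' : Type*} [NormedAddCommGroup V'] [Module ℍᵐᵒᵖ V'] [QuaternionicInnerProductSpace V']
variable {s : ℕ} {ι ι' : Type*}

/-! ### Adapted orthonormal bases -/

/-- A family of pairwise orthogonal subspaces with sum `V`. -/
structure IsOrthogonalSplitting (F : Fin s → Submodule ℍᵐᵒᵖ V) : Prop where
  orthogonal : ∀ i j, i ≠ j → ∀ v ∈ F i, ∀ w ∈ F j, inner ℍ v w = 0
  iSup_eq_top : ⨆ i, F i = ⊤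

/-- An orthonormal basis `f` of `V`, with `f a` a vector of the part `F (l a)`. -/
structure IsAdaptedBasis [DecidableEq ι] (F : Fin s → Submodule ℍᵐᵒᵖ V) (l : ι → Fin s)
    (f : ι → V) : Prop where
  orthonormal : ∀ a b, inner ℍ (f a) (f b) = if a = b then 1 else 0
  span_eq_top : Submodule.span ℍᵐᵒᵖ (Set.range f) = ⊤
  mem : ∀ a, f a ∈ F (l a)

/-- This provides joint continuity of the scalar multiplication, needed for projections written in a
moving basis. -/
instance isBoundedSMul_op : IsBoundedSMul ℍᵐᵒᵖ V :=
  IsBoundedSMul.of_norm_smul_le fun q v => (norm_smul_op q.unop v).le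

namespace IsAdaptedBasis

variable [Fintype ι] [DecidableEq ι] [Fintype ι'] [DecidableEq ι']
  {F : Fin s → Submodule ℍᵐᵒᵖ V} {F' : Fin s → Submodule ℍᵐᵒᵖ V'} {l : ι → Fin s} {l' : ι' → Fin s}
  {f : ι → V} {f' : ι → V'}

theorem sum_inner_smul (hf : IsAdaptedBasis F l f) (v : V) :
    ∑ a, MulOpposite.op (inner ℍ (f a) v) • f a = v :=
  QuatDLP.sum_inner_smul hf.orthonormal (hf.span_eq_top ▸ Submodule.mem_top)

theorem part_eq_span (hF : IsOrthogonalSplitting F) (hf : IsAdaptedBasis F l f) (i : Fin s) :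
    F i = Submodule.span ℍᵐᵒᵖ (f '' {a | l a = i}) := by
  refine le_antisymm (fun v hv => ?_) (Submodule.span_le.2 ?_)
  · rw [← hf.sum_inner_smul v]
    refine Submodule.sum_mem _ fun a _ => ?_
    by_cases h : l a = i
    · exact Submodule.smul_mem _ _ (Submodule.subset_span ⟨a, h, rfl⟩)
    · rw [hF.orthogonal _ _ h _ (hf.mem a) v hv, MulOpposite.op_zero, zero_smul]
      exact Submodule.zero_mem _
  · rintro _ ⟨a, rfl, rfl⟩
    exact hf.mem a

theorem card_fiber (hF : IsOrthogonalSplitting F) (hf : IsAdaptedBasis F l f) (i : Fin s) :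
    Fintype.card {a // l a = i} = Module.finrank ℍᵐᵒᵖ (F i) := by
  have h := finrank_span_eq_card ((linearIndependent_of_orthonormal_fintype hf.orthonormal).comp
    (Subtype.val : {a // l a = i} → ι) Subtype.val_injective)
  rw [Set.range_comp, Subtype.range_coe_subtype] at h
  rw [hf.part_eq_span hF i, h]

theorem card_eq (hf : IsAdaptedBasis F l f) : Fintype.card ι = Module.finrank ℍᵐᵒᵖ V := by
  have h := finrank_span_eq_card (linearIndependent_of_orthonormal_fintype hf.orthonormal)
  rw [hf.span_eq_top, finrank_top] at h
  exact h.symm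

theorem of_card [Module.Finite ℍᵐᵒᵖ V]
    (h1 : ∀ a b, inner ℍ (f a) (f b) = if a = b then 1 else 0)
    (h2 : Fintype.card ι = Module.finrank ℍᵐᵒᵖ V) (h3 : ∀ a, f a ∈ F (l a)) :
    IsAdaptedBasis F l f :=
  ⟨h1, (linearIndependent_of_orthonormal_fintype h1).span_eq_top_of_card_eq_finrank' h2, h3⟩

/-- The isometry that maps an adapted basis to another one. -/
def isometry (hf : IsAdaptedBasis F l f) (hf' : IsAdaptedBasis F' l f') : V ≃ₗ[ℍᵐᵒᵖ] V' where
  toFun v := ∑ a, MulOpposite.op (inner ℍ (f a) v) • f' a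
  map_add' v w := by
    simp only [hinner_add_right, MulOpposite.op_add, add_smul, Finset.sum_add_distrib]
  map_smul' q v := by
    have h : ∀ u : V, inner ℍ u (q • v) = inner ℍ u v * q.unop := fun u => by
      rw [← inner_smul_right, MulOpposite.op_unop]
    simp only [h, MulOpposite.op_mul, MulOpposite.op_unop, mul_smul, Finset.smul_sum,
      RingHom.id_apply]
  invFun w := ∑ a, MulOpposite.op (inner ℍ (f' a) w) • f a
  left_inv v := by
    simp only [inner_sum_right, inner_smul_right, hf'.orthonormal]
    simpa using hf.sum_inner_smul v
  right_inv v := by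
    simp only [inner_sum_right, inner_smul_right, hf.orthonormal]
    simpa using hf'.sum_inner_smul v

theorem isometry_eq_sum (hf : IsAdaptedBasis F l f) (hf' : IsAdaptedBasis F' l f') (v : V) :
    hf.isometry hf' v = ∑ a, MulOpposite.op (inner ℍ (f a) v) • f' a := rfl

theorem isometry_apply (hf : IsAdaptedBasis F l f) (hf' : IsAdaptedBasis F' l f') (a : ι) :
    hf.isometry hf' (f a) = f' a := by
  rw [isometry_eq_sum, Finset.sum_eq_single a]
  · rw [hf.orthonormal, if_pos rfl, MulOpposite.op_one, one_smul]
  · intro b _ hb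
    rw [hf.orthonormal, if_neg hb, MulOpposite.op_zero, zero_smul]
  · simp

omit [DecidableEq ι] [DecidableEq ι'] in
theorem exists_equiv (h : ∀ i, Fintype.card {a // l a = i} = Fintype.card {a // l' a = i}) :
    ∃ e : ι ≃ ι', ∀ a, l' (e a) = l a := by
  refine ⟨(Equiv.sigmaFiberEquiv l).symm.trans
    ((Equiv.sigmaCongrRight fun i => Fintype.equivOfCardEq (h i)).trans
      (Equiv.sigmaFiberEquiv l')), fun a => ?_⟩
  exact (Fintype.equivOfCardEq (h (l a)) ⟨a, rfl⟩).2

omit [Fintype ι] [Fintype ι'] in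
theorem comp_equiv (hf : IsAdaptedBasis F l f) (e : ι' ≃ ι) :
    IsAdaptedBasis F (fun a => l (e a)) fun a => f (e a) := by
  refine ⟨fun a b => by simp [hf.orthonormal], ?_, fun a => hf.mem _⟩
  rw [← hf.span_eq_top, ← e.surjective.range_comp f]; rfl

end IsAdaptedBasis

/-- Linear isometries from `V` to `V'` that map each part of `F` to the corresponding part
of `F'`. -/
structure IsSplitIsometry (F : Fin s → Submodule ℍᵐᵒᵖ V) (F' : Fin s → Submodule ℍᵐᵒᵖ V')
    (φ : V ≃ₗ[ℍᵐᵒᵖ] V') : Prop where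
  inner_map : ∀ v w, inner ℍ (φ v) (φ w) = inner ℍ v w
  map_part : ∀ i, (F i).map (φ : V →ₗ[ℍᵐᵒᵖ] V') = F' i

theorem IsAdaptedBasis.isSplitIsometry [Fintype ι] [DecidableEq ι]
    {F : Fin s → Submodule ℍᵐᵒᵖ V} {F' : Fin s → Submodule ℍᵐᵒᵖ V'} {l : ι → Fin s}
    {f : ι → V} {f' : ι → V'} (hF : IsOrthogonalSplitting F) (hF' : IsOrthogonalSplitting F')
    (hf : IsAdaptedBasis F l f) (hf' : IsAdaptedBasis F' l f') :
    IsSplitIsometry F F' (hf.isometry hf') := by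
  refine ⟨fun v w => ?_, fun i => ?_⟩
  · rw [hf.isometry_eq_sum, inner_sum_left]
    conv_rhs => rw [← hf.sum_inner_smul v, inner_sum_left]
    refine Finset.sum_congr rfl fun a _ => ?_
    rw [inner_smul_left, inner_smul_left, hf.isometry_eq_sum, inner_sum_right]
    simp [inner_smul_right, hf'.orthonormal]
  · rw [hf.part_eq_span hF, hf'.part_eq_span hF', Submodule.map_span, Set.image_image]
    congr 1
    exact Set.image_congr fun a _ => hf.isometry_apply hf' a

namespace IsSplitIsometry

variable {F : Fin s → Submodule ℍᵐᵒᵖ V} {F' : Fin s → Submodule ℍᵐᵒᵖ V'} {φ : V ≃ₗ[ℍᵐᵒᵖ] V'}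

theorem norm_map (hφ : IsSplitIsometry F F' φ) (v : V) : ‖φ v‖ = ‖v‖ := by
  have h := hφ.inner_map v v
  rw [hinner_self, hinner_self] at h
  exact (pow_left_inj₀ (by positivity) (by positivity) two_ne_zero).1 (Quaternion.coe_injective h)

theorem continuous (hφ : IsSplitIsometry F F' φ) : Continuous φ :=
  AddMonoidHomClass.continuous_of_bound φ 1 fun v => by rw [one_mul, hφ.norm_map]

theorem symm (hφ : IsSplitIsometry F F' φ) : IsSplitIsometry F' F φ.symm := by
  refine ⟨fun v w => ?_, fun i => ?_⟩
  · rw [← hφ.inner_map, φ.apply_symm_apply, φ.apply_symm_apply]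
  · rw [← hφ.map_part i, ← Submodule.map_comp]
    have : (φ.symm : V' →ₗ[ℍᵐᵒᵖ] V) ∘ₗ (φ : V →ₗ[ℍᵐᵒᵖ] V') = LinearMap.id :=
      LinearMap.ext fun v => φ.symm_apply_apply v
    rw [this, Submodule.map_id]

theorem trans {V'' : Type*} [NormedAddCommGroup V''] [Module ℍᵐᵒᵖ V'']
    [QuaternionicInnerProductSpace V''] {F'' : Fin s → Submodule ℍᵐᵒᵖ V''}
    {ψ : V' ≃ₗ[ℍᵐᵒᵖ] V''} (hφ : IsSplitIsometry F F' φ) (hψ : IsSplitIsometry F' F'' ψ) :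
    IsSplitIsometry F F'' (φ.trans ψ) := by
  refine ⟨fun v w => ?_, fun i => ?_⟩
  · rw [LinearEquiv.trans_apply, LinearEquiv.trans_apply, hψ.inner_map, hφ.inner_map]
  · rw [← hψ.map_part i, ← hφ.map_part i, ← Submodule.map_comp]; rfl

/-- The element of the isometry group given by an isometry of `V` to itself. -/
def toGroup {φ : V ≃ₗ[ℍᵐᵒᵖ] V} (hφ : IsSplitIsometry F F φ) : isometryGroup F :=
  ⟨φ, hφ.inner_map, hφ.map_part⟩

theorem of_group (u : isometryGroup F) : IsSplitIsometry F F u.1 := ⟨u.2.1, u.2.2⟩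

/-- Isomorphic families have isomorphic isometry groups. -/
def conj (hφ : IsSplitIsometry F F' φ) : isometryGroup F ≃* isometryGroup F' where
  toFun u := ((hφ.symm.trans (of_group u)).trans hφ).toGroup
  invFun u := ((hφ.trans (of_group u)).trans hφ.symm).toGroup
  left_inv u := Subtype.ext <| LinearEquiv.ext fun v => by simp [toGroup]
  right_inv u := Subtype.ext <| LinearEquiv.ext fun v => by simp [toGroup]
  map_mul' u v := Subtype.ext <| LinearEquiv.ext fun w => by simp [toGroup]

theorem conj_apply (hφ : IsSplitIsometry F F' φ) (u : isometryGroup F) (v : V') :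
    (hφ.conj u).1 v = φ (u.1 (φ.symm v)) := rfl

end IsSplitIsometry

theorem continuous_isometryGroup_apply {F : Fin s → Submodule ℍᵐᵒᵖ V} (v : V) :
    Continuous fun u : isometryGroup F => u.1 v :=
  (continuous_apply v).comp continuous_induced_dom

theorem continuous_isometryGroup_iff {X : Type*} [TopologicalSpace X]
    {F : Fin s → Submodule ℍᵐᵒᵖ V} {g : X → isometryGroup F} :
    Continuous g ↔ ∀ v, Continuous fun x => (g x).1 v := by
  rw [continuous_induced_rng, continuous_pi_iff]; rfl

theorem IsSplitIsometry.continuous_conj {F : Fin s → Submodule ℍᵐᵒᵖ V}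
    {F' : Fin s → Submodule ℍᵐᵒᵖ V'} {φ : V ≃ₗ[ℍᵐᵒᵖ] V'} (hφ : IsSplitIsometry F F' φ) :
    Continuous hφ.conj :=
  continuous_isometryGroup_iff.2 fun v =>
    hφ.continuous.comp (continuous_isometryGroup_apply (φ.symm v))

theorem IsSplitIsometry.continuous_conj_symm {F : Fin s → Submodule ℍᵐᵒᵖ V}
    {F' : Fin s → Submodule ℍᵐᵒᵖ V'} {φ : V ≃ₗ[ℍᵐᵒᵖ] V'} (hφ : IsSplitIsometry F F' φ) :
    Continuous hφ.conj.symm :=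
  continuous_isometryGroup_iff.2 fun v =>
    hφ.symm.continuous.comp (continuous_isometryGroup_apply (φ v))

/-! ### Spans of adapted families as points of the Grassmannian -/

/-- The subspace spanned by the vectors indexed by `J` of a family of vectors of the parts. -/
def Gr.span (F : Fin s → Submodule ℍᵐᵒᵖ V) {x : ι → V} (hx : ∀ a, ∃ i, x a ∈ F i)
    (J : Finset ι) : Gr F :=
  ⟨Submodule.span ℍᵐᵒᵖ (x '' J), adapted_of_le <| by
    rw [Submodule.span_le]
    rintro _ ⟨a, ha, rfl⟩
    obtain ⟨i, hi⟩ := hx a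
    exact Submodule.mem_iSup_of_mem i ⟨Submodule.subset_span ⟨a, ha, rfl⟩, hi⟩⟩

variable [Module.Finite ℍᵐᵒᵖ V] [Module.Finite ℍᵐᵒᵖ V']

theorem continuous_gr_iff {X : Type*} [TopologicalSpace X] {F : Fin s → Submodule ℍᵐᵒᵖ V}
    {g : X → Gr F} : Continuous g ↔ ∀ v, Continuous fun x => (orthProj (g x).1 v : V) := by
  rw [continuous_induced_rng, continuous_pi_iff]; rfl

theorem continuous_orthProj_apply {F : Fin s → Submodule ℍᵐᵒᵖ V} (v : V) :
    Continuous fun Q : Gr F => (orthProj Q.1 v : V) :=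
  continuous_gr_iff.1 continuous_id v

/-- The projection onto the span of an orthonormal family is the explicit sum of `y a ⟨y a, v⟩`,
which is continuous in the family. -/
theorem continuous_grSpan [DecidableEq ι] {X : Type*} [TopologicalSpace X]
    {F : Fin s → Submodule ℍᵐᵒᵖ V} {y : X → ι → V} (hy : ∀ a, Continuous fun x => y x a)
    (ho : ∀ x a b, inner ℍ (y x a) (y x b) = if a = b then 1 else 0)
    (hm : ∀ x a, ∃ i, y x a ∈ F i) (J : Finset ι) :
    Continuous fun x => Gr.span F (hm x) J := by
  refine continuous_gr_iff.2 fun v => ?_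
  have h : ∀ x, (orthProj (Gr.span F (hm x) J).1 v : V) =
      ∑ a ∈ J, MulOpposite.op (inner ℍ (y x a) v) • y x a := fun x =>
    coe_orthProj_span_image (ho x) J v
  simp only [h]
  refine continuous_finsetSum _ fun a _ => ?_
  exact (MulOpposite.continuous_op.comp (continuous_inner_fun.comp
    ((hy a).prodMk continuous_const))).smul (hy a)

theorem orthonormal_coe_onb (R : Submodule ℍᵐᵒᵖ V) (i j : Fin (Module.finrank ℍᵐᵒᵖ R)) :
    inner ℍ (onb R i : V) (onb R j : V) = if i = j then 1 else 0 :=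
  (onb_isOrthonormalBasis R).1 i j

theorem span_coe_onb (R : Submodule ℍᵐᵒᵖ V) :
    Submodule.span ℍᵐᵒᵖ (Set.range fun i => (onb R i : V)) = R :=
  span_coe_eq (onb_isOrthonormalBasis R).2

theorem isAdaptedBasis_adaptedBasis {F : Fin s → Submodule ℍᵐᵒᵖ V}
    (hF : IsOrthogonalSplitting F) : IsAdaptedBasis F Sigma.fst (adaptedBasis F) := by
  refine ⟨?_, ?_, fun a => (onb (F a.1) a.2).2⟩
  · rintro ⟨i, a⟩ ⟨j, b⟩
    by_cases h : i = j
    · subst h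
      have := orthonormal_coe_onb (F i) a b
      simpa [adaptedBasis] using this
    · rw [adaptedBasis, adaptedBasis,
        hF.orthogonal i j h _ (onb (F i) a).2 _ (onb (F j) b).2, if_neg]
      exact fun h' => h (congrArg Sigma.fst h')
  · rw [eq_top_iff, ← hF.iSup_eq_top]
    refine iSup_le fun i => (span_coe_onb (F i)).symm.le.trans (Submodule.span_mono ?_)
    rintro _ ⟨a, rfl⟩
    exact ⟨⟨i, a⟩, rfl⟩

theorem coord_eq_span (F : Fin s → Submodule ℍᵐᵒᵖ V)
    (hm : ∀ (u : isometryGroup F) a, ∃ i, u.1 (adaptedBasis F a) ∈ F i)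
    (J : Finset (Σ i, Fin (Module.finrank ℍᵐᵒᵖ (F i)))) (u : isometryGroup F) :
    Gr.coord F J u = Gr.span F (hm u) J := by
  refine Subtype.ext ?_
  change Submodule.map _ _ = Submodule.span _ _
  rw [Submodule.map_span, Set.image_image]
  rfl

omit [Module.Finite ℍᵐᵒᵖ V] in
theorem mem_part_of_group {F : Fin s → Submodule ℍᵐᵒᵖ V} (u : isometryGroup F) {i : Fin s} {v : V}
    (hv : v ∈ F i) : u.1 v ∈ F i := by
  rw [← u.2.2 i]
  exact ⟨v, hv, rfl⟩

theorem continuous_coord {F : Fin s → Submodule ℍᵐᵒᵖ V} (hF : IsOrthogonalSplitting F)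
    (J : Finset (Σ i, Fin (Module.finrank ℍᵐᵒᵖ (F i)))) : Continuous (Gr.coord F J) := by
  have hm : ∀ (u : isometryGroup F) a, ∃ i, u.1 (adaptedBasis F a) ∈ F i := fun u a =>
    ⟨a.1, mem_part_of_group u (onb (F a.1) a.2).2⟩
  refine (continuous_congr (coord_eq_span F hm J)).2 ?_
  refine continuous_grSpan (fun a => continuous_isometryGroup_apply _) (fun u a b => ?_) hm J
  rw [u.2.1, (isAdaptedBasis_adaptedBasis hF).orthonormal]

/-! ### Haar measures -/

instance haarProb_isHaarMeasure (F : Fin s → Submodule ℍᵐᵒᵖ V) : (haarProb F).IsHaarMeasure := by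
  unfold haarProb; infer_instance

instance haarProb_isProbabilityMeasure (F : Fin s → Submodule ℍᵐᵒᵖ V) :
    IsProbabilityMeasure (haarProb F) := by
  refine ⟨?_⟩
  have := Measure.haarMeasure_self (G := isometryGroup F) (K₀ := ⊤)
  rwa [TopologicalSpace.PositiveCompacts.coe_top] at this

theorem IsSplitIsometry.map_conj_haarProb {F : Fin s → Submodule ℍᵐᵒᵖ V}
    {F' : Fin s → Submodule ℍᵐᵒᵖ V'} {φ : V ≃ₗ[ℍᵐᵒᵖ] V'} (hφ : IsSplitIsometry F F' φ) :
    (haarProb F).map hφ.conj = haarProb F' := by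
  have h1 : ((haarProb F).map hφ.conj).IsHaarMeasure :=
    hφ.conj.isHaarMeasure_map _ hφ.continuous_conj hφ.continuous_conj_symm
  have h2 : IsProbabilityMeasure ((haarProb F).map hφ.conj) :=
    Measure.isProbabilityMeasure_map hφ.continuous_conj.measurable.aemeasurable
  exact Measure.isHaarMeasure_eq_of_isProbabilityMeasure _ _

/-- A right translate of the Haar probability is again a Haar probability measure, hence the same
one. -/
instance haarProb_isMulRightInvariant (F : Fin s → Submodule ℍᵐᵒᵖ V) :
    (haarProb F).IsMulRightInvariant := by
  refine ⟨fun g => ?_⟩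
  have hc : Continuous fun u : isometryGroup F => u * g := continuous_id.mul continuous_const
  have h2 : IsProbabilityMeasure ((haarProb F).map fun u => u * g) :=
    Measure.isProbabilityMeasure_map hc.measurable.aemeasurable
  have h1 : ((haarProb F).map fun u => u * g).IsHaarMeasure :=
    Measure.isHaarMeasure_map_mul_right _ g
  exact Measure.isHaarMeasure_eq_of_isProbabilityMeasure _ _

instance gr_borelSpace (F : Fin s → Submodule ℍᵐᵒᵖ V) : BorelSpace (Gr F) := ⟨rfl⟩

/-- The invariant measure can be computed with any adapted basis, and on any isometric space. -/
theorem invariantMeasure_eq_sum [Fintype ι] [DecidableEq ι]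
    {F : Fin s → Submodule ℍᵐᵒᵖ V} {F' : Fin s → Submodule ℍᵐᵒᵖ V'}
    (hF : IsOrthogonalSplitting F) (hF' : IsOrthogonalSplitting F') {l : ι → Fin s} {f : ι → V}
    (hf : IsAdaptedBasis F l f) {φ : V ≃ₗ[ℍᵐᵒᵖ] V'} (hφ : IsSplitIsometry F F' φ)
    (hm : ∀ (h : isometryGroup F) a, ∃ i, φ (h.1 (f a)) ∈ F' i) :
    invariantMeasure F' =
      ∑ J : Finset ι, (haarProb F).map fun h => Gr.span F' (hm h) J := by
  have he := isAdaptedBasis_adaptedBasis hF'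
  obtain ⟨ε, hε⟩ := IsAdaptedBasis.exists_equiv (l := l)
    (l' := (Sigma.fst : (Σ i, Fin (Module.finrank ℍᵐᵒᵖ (F' i))) → Fin s)) fun i => by
      rw [hf.card_fiber hF, he.card_fiber hF', ← hφ.map_part i, LinearEquiv.finrank_map_eq]
  have he' : IsAdaptedBasis F' l fun a => adaptedBasis F' (ε a) := by
    have := he.comp_equiv ε
    rwa [funext hε] at this
  set ψ := hf.isometry he' with hψdef
  have hψ : IsSplitIsometry F F' ψ := hf.isSplitIsometry hF hF' he'
  -- The isometry `ψ` matches `f` with the basis used in the definition of the invariant measure,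
  -- while `φ` is arbitrary. They differ by the group element `g`, which left invariance of the Haar
  -- measure removes.
  set g : isometryGroup F := (hφ.trans hψ.symm).toGroup with hg
  have hgc : Continuous fun x : isometryGroup F => g * x := continuous_const.mul continuous_id
  unfold invariantMeasure
  rw [← (Equiv.finsetCongr ε).sum_comp]
  refine Finset.sum_congr rfl fun J _ => ?_
  rw [← hψ.map_conj_haarProb, Measure.map_map (continuous_coord hF' _).measurable
    hψ.continuous_conj.measurable]
  conv_lhs => rw [← map_mul_left_eq_self (haarProb F) g]
  rw [Measure.map_map ((continuous_coord hF' _).comp hψ.continuous_conj).measurable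
    hgc.measurable]
  congr 1
  funext h
  refine Subtype.ext ?_
  change Submodule.map _ _ = Submodule.span _ _
  rw [Submodule.map_span, Set.image_image, Equiv.finsetCongr_apply, Finset.coe_map,
    Set.image_image]
  congr 1
  refine Set.image_congr fun a _ => ?_
  change (hψ.conj (g * h)).1 (adaptedBasis F' (ε a)) = φ (h.1 (f a))
  rw [hψ.conj_apply]
  have h1 : ψ.symm (adaptedBasis F' (ε a)) = f a := by
    rw [LinearEquiv.symm_apply_eq, hψdef, IsAdaptedBasis.isometry_apply]
  rw [h1]
  change ψ (ψ.symm (φ (h.1 (f a)))) = _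
  rw [LinearEquiv.apply_symm_apply]

end Isometries

/-! ### Orbits of the isometry group and the incidence kernel -/

section Orbits

open QuaternionicInnerProductSpace

variable {V : Type*} [NormedAddCommGroup V] [Module ℍᵐᵒᵖ V] [QuaternionicInnerProductSpace V]
variable {s : ℕ}

theorem Splitting.isOrthogonalSplitting (σ : Splitting V s) : IsOrthogonalSplitting σ.parts :=
  ⟨σ.orthogonal, σ.iSup_eq_top⟩

/-- This is exactly the condition that `Q` be adapted. The induced parts can be null, which is why
`IsOrthogonalSplitting` asks for no positive dimension. -/
theorem IsOrthogonalSplitting.induced {F : Fin s → Submodule ℍᵐᵒᵖ V}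
    (hF : IsOrthogonalSplitting F) (Q : Gr F) : IsOrthogonalSplitting (induced F Q.1) := by
  refine ⟨fun i j hij v hv w hw => hF.orthogonal i j hij v hv w hw, ?_⟩
  refine Submodule.map_injective_of_injective Q.1.injective_subtype ?_
  rw [Submodule.map_iSup, Submodule.map_top, Submodule.range_subtype]
  conv_rhs => rw [Q.2]
  exact iSup_congr fun i => Submodule.map_comap_subtype _ _

variable [Module.Finite ℍᵐᵒᵖ V] {F : Fin s → Submodule ℍᵐᵒᵖ V}

/-! ### The orbits of the isometry group -/

/-- The isometry group and the finitely many coordinate subspaces reach every subspace. -/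
theorem exists_coord_eq (hF : IsOrthogonalSplitting F) (Q : Gr F) :
    ∃ K u, Gr.coord F K u = Q := by
  classical
  let G : Fin s → Submodule ℍᵐᵒᵖ V := fun i => Q.1 ⊓ F i
  let C : Fin s → Submodule ℍᵐᵒᵖ V := fun i => LinearMap.ker (orthProj (G i)) ⊓ F i
  -- In each part, a basis of `Q ∩ F i` is completed by one of its orthogonal complement in `F i`;
  -- the left summands then span `Q`.
  let y : (Σ i, Fin (Module.finrank ℍᵐᵒᵖ (G i)) ⊕ Fin (Module.finrank ℍᵐᵒᵖ (C i))) → V :=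
    fun b => Sum.elim (fun j => (onb (G b.1) j : V)) (fun j => (onb (C b.1) j : V)) b.2
  have hGC : ∀ i, ∀ v ∈ G i, ∀ w ∈ C i, inner ℍ v w = 0 := fun i v hv w hw => by
    rw [← inner_orthProj_right (G i) w hv, LinearMap.mem_ker.1 hw.1]
    exact inner_zero_right _
  have hmem : ∀ b, y b ∈ F b.1 := by
    rintro ⟨i, j | j⟩
    · exact (onb (G i) j).2.2
    · exact (onb (C i) j).2.2
  have hspanG : ∀ i, G i ≤ Submodule.span ℍᵐᵒᵖ (y '' {b | b.2.isLeft}) := fun i => by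
    refine (span_coe_onb (G i)).symm.le.trans (Submodule.span_mono ?_)
    rintro _ ⟨j, rfl⟩
    exact ⟨⟨i, Sum.inl j⟩, rfl, rfl⟩
  have hspanC : ∀ i, C i ≤ Submodule.span ℍᵐᵒᵖ (Set.range y) := fun i => by
    refine (span_coe_onb (C i)).symm.le.trans (Submodule.span_mono ?_)
    rintro _ ⟨j, rfl⟩
    exact ⟨⟨i, Sum.inr j⟩, rfl⟩
  have hy : IsAdaptedBasis F Sigma.fst y := by
    refine ⟨?_, ?_, hmem⟩
    · rintro ⟨i, a⟩ ⟨j, b⟩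
      by_cases h : i = j
      · subst h
        rcases a with a | a <;> rcases b with b | b
        · simpa [y] using orthonormal_coe_onb (G i) a b
        · simpa [y] using hGC i _ (onb (G i) a).2 _ (onb (C i) b).2
        · have := hGC i _ (onb (G i) b).2 _ (onb (C i) a).2
          rw [← star_inner, star_eq_zero] at this
          simpa [y] using this
        · simpa [y] using orthonormal_coe_onb (C i) a b
      · rw [hF.orthogonal i j h _ (hmem ⟨i, a⟩) _ (hmem ⟨j, b⟩), if_neg]
        exact fun h' => h (congrArg Sigma.fst h')
    · rw [eq_top_iff, ← hF.iSup_eq_top]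
      refine iSup_le fun i v hv => ?_
      rw [← add_sub_cancel (orthProj (G i) v : V) v]
      refine Submodule.add_mem _ (Submodule.span_mono (Set.image_subset_range _ _)
        (hspanG i (orthProj (G i) v).2)) (hspanC i ⟨?_, ?_⟩)
      · change orthProj (G i) _ = 0
        rw [map_sub]
        refine Subtype.ext ?_
        rw [Submodule.coe_sub, orthProj_of_mem (orthProj (G i) v).2, sub_self]; rfl
      · exact (F i).sub_mem hv (orthProj (G i) v).2.2
  have he := isAdaptedBasis_adaptedBasis hF
  obtain ⟨ε, hε⟩ := IsAdaptedBasis.exists_equiv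
    (l := (Sigma.fst : (Σ i, Fin (Module.finrank ℍᵐᵒᵖ (F i))) → Fin s))
    (l' := (Sigma.fst : (Σ i, Fin (Module.finrank ℍᵐᵒᵖ (G i)) ⊕
      Fin (Module.finrank ℍᵐᵒᵖ (C i))) → Fin s)) fun i => by
        rw [he.card_fiber hF, hy.card_fiber hF]
  have hy' : IsAdaptedBasis F Sigma.fst fun a => y (ε a) := by
    have := hy.comp_equiv ε
    rwa [funext hε] at this
  -- `K` consists of the indices matched with vectors of `Q`, and `u` is the isometry that realises
  -- the matching.
  refine ⟨Finset.univ.filter fun a => (ε a).2.isLeft, (he.isSplitIsometry hF hF hy').toGroup,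
    Subtype.ext ?_⟩
  change Submodule.map (he.isometry hy' : V →ₗ[ℍᵐᵒᵖ] V) _ = _
  rw [Submodule.map_span, Set.image_image]
  have h1 : (fun a => (he.isometry hy' : V →ₗ[ℍᵐᵒᵖ] V) (adaptedBasis F a)) = fun a => y (ε a) :=
    funext fun a => he.isometry_apply hy' a
  rw [h1]
  refine le_antisymm (Submodule.span_le.2 ?_) ?_
  · rintro _ ⟨a, ha, rfl⟩
    have ha' : (ε a).2.isLeft := by simpa using ha
    dsimp only
    generalize ε a = b at ha'
    obtain ⟨i, j | j⟩ := b
    · exact (onb (G i) j).2.1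
    · simp at ha'
  · conv_lhs => rw [Q.2]
    refine iSup_le fun i => (hspanG i).trans (Submodule.span_mono ?_)
    rintro _ ⟨b, hb, rfl⟩
    obtain ⟨a, rfl⟩ := ε.surjective b
    exact ⟨a, by simpa using hb, rfl⟩

variable (V) in
theorem polishSpace : PolishSpace V := by
  let _ := realNormedSpace V
  have : FiniteDimensional ℝ V := real_finite V
  have : CompleteSpace V := FiniteDimensional.complete ℝ V
  have : ProperSpace V := properSpace
  infer_instance

theorem eq_of_eq_on_onb {f g : V →ₗ[ℍᵐᵒᵖ] V} (h : ∀ i, f (onb V i) = g (onb V i)) : f = g :=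
  LinearMap.ext_on_range (onb_isOrthonormalBasis V).2 h

/-- A continuous injection of a compact space in a Hausdorff space is a closed embedding, here by
the images of the vectors of a basis. Polishness serves to handle Borel sets of products and to
descend measurability to the Grassmannian. -/
instance isometryGroup_polishSpace : PolishSpace (isometryGroup F) := by
  have := polishSpace V
  have hc : Continuous fun (u : isometryGroup F) i => u.1 (onb V i) :=
    continuous_pi fun i => continuous_isometryGroup_apply _
  refine (hc.isClosedEmbedding fun u v huv => Subtype.ext ?_).polishSpace
  have h := eq_of_eq_on_onb (f := (u.1 : V →ₗ[ℍᵐᵒᵖ] V)) (g := (v.1 : V →ₗ[ℍᵐᵒᵖ] V))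
    fun i => congrFun huv i
  exact LinearEquiv.ext fun x => LinearMap.congr_fun h x

theorem compactSpace_gr (hF : IsOrthogonalSplitting F) : CompactSpace (Gr F) := by
  refine ⟨?_⟩
  have : (Set.univ : Set (Gr F)) = ⋃ K, Set.range (Gr.coord F K) := by
    refine (Set.eq_univ_of_forall fun Q => ?_).symm
    obtain ⟨K, u, rfl⟩ := exists_coord_eq hF Q
    exact Set.mem_iUnion.2 ⟨K, u, rfl⟩
  rw [this]
  exact isCompact_iUnion fun K => isCompact_range (continuous_coord hF K)

theorem polishSpace_gr (hF : IsOrthogonalSplitting F) : PolishSpace (Gr F) := by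
  have := polishSpace V
  have := compactSpace_gr hF
  have hc : Continuous fun (Q : Gr F) i => (orthProj Q.1 (onb V i) : V) :=
    continuous_pi fun i => continuous_orthProj_apply _
  refine (hc.isClosedEmbedding fun Q Q' h => Subtype.ext ?_).polishSpace
  have h := eq_of_eq_on_onb (f := Q.1.subtype ∘ₗ orthProj Q.1) (g := Q'.1.subtype ∘ₗ orthProj Q'.1)
    fun i => congrFun h i
  have h' : ∀ v, (orthProj Q.1 v : V) = orthProj Q'.1 v := fun v => LinearMap.congr_fun h v
  refine le_antisymm (fun v hv => ?_) fun v hv => ?_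
  · rw [← orthProj_of_mem hv, h']
    exact (orthProj Q'.1 v).2
  · rw [← orthProj_of_mem hv, ← h']
    exact (orthProj Q.1 v).2

theorem orthProj_map_subtype (Q : Submodule ℍᵐᵒᵖ V) (R : Submodule ℍᵐᵒᵖ Q) (v : V) :
    (orthProj (R.map Q.subtype) v : V) = ((orthProj R (orthProj Q v) : Q) : V) := by
  refine coe_orthProj_eq ⟨_, (orthProj R (orthProj Q v)).2, rfl⟩ ?_
  rintro _ ⟨r, hr, rfl⟩
  have h1 := inner_sub_orthProj R (orthProj Q v) r hr
  have h2 := inner_sub_orthProj Q v r r.2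
  have h3 : v - ((orthProj R (orthProj Q v) : Q) : V) =
      (v - (orthProj Q v : V)) + ((orthProj Q v - (orthProj R (orthProj Q v) : Q) : Q) : V) := by
    rw [Submodule.coe_sub]; abel
  rw [h3, hinner_add_left]
  change inner ℍ (v - (orthProj Q v : V)) (r : V) + inner ℍ (orthProj Q v - _ : Q) r = 0
  rw [h1, h2, add_zero]

theorem continuous_incl (Q : Submodule ℍᵐᵒᵖ V) : Continuous (Gr.incl F Q) := by
  refine continuous_gr_iff.2 fun v => ?_
  have h : ∀ R : Gr (induced F Q), (orthProj (Gr.incl F Q R).1 v : V) =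
      ((orthProj R.1 (orthProj Q v) : Q) : V) := fun R => orthProj_map_subtype Q R.1 v
  simp only [h]
  exact continuous_subtype_val.comp (continuous_orthProj_apply _)

/-! ### Isometries of coordinate subspaces -/

/-- The subspace spanned by the vectors of the adapted basis indexed by `K`. -/
def coordSpan (F : Fin s → Submodule ℍᵐᵒᵖ V)
    (K : Finset (Σ i, Fin (Module.finrank ℍᵐᵒᵖ (F i)))) : Submodule ℍᵐᵒᵖ V :=
  Submodule.span ℍᵐᵒᵖ (adaptedBasis F '' K)

variable (K : Finset (Σ i, Fin (Module.finrank ℍᵐᵒᵖ (F i))))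

theorem adaptedBasis_mem_coordSpan {K : Finset (Σ i, Fin (Module.finrank ℍᵐᵒᵖ (F i)))}
    {a : Σ i, Fin (Module.finrank ℍᵐᵒᵖ (F i))} (ha : a ∈ K) :
    adaptedBasis F a ∈ coordSpan F K :=
  Submodule.subset_span ⟨a, ha, rfl⟩

theorem isOrthogonalSplitting_coordSpan (hF : IsOrthogonalSplitting F) :
    IsOrthogonalSplitting (induced F (coordSpan F K)) :=
  hF.induced (Gr.span F (fun a => ⟨a.1, (onb (F a.1) a.2).2⟩) K)

/-- The adapted basis of a coordinate subspace. -/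
def coordBasis (a : {a // a ∈ K}) : coordSpan F K :=
  ⟨adaptedBasis F a.1, adaptedBasis_mem_coordSpan a.2⟩

theorem isAdaptedBasis_coordBasis (hF : IsOrthogonalSplitting F) :
    IsAdaptedBasis (induced F (coordSpan F K)) (fun a : {a // a ∈ K} => a.1.1) (coordBasis K) := by
  have he := isAdaptedBasis_adaptedBasis hF
  refine ⟨fun a b => ?_, ?_, fun a => he.mem a.1⟩
  · have : inner ℍ (coordBasis K a) (coordBasis K b) = if a.1 = b.1 then 1 else 0 :=
      he.orthonormal a.1 b.1
    rw [this]
    simp only [Subtype.ext_iff]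
  · refine Submodule.map_injective_of_injective (coordSpan F K).injective_subtype ?_
    rw [Submodule.map_span, Submodule.map_top, Submodule.range_subtype]
    change _ = Submodule.span ℍᵐᵒᵖ (adaptedBasis F '' K)
    congr 1
    ext v
    constructor
    · rintro ⟨_, ⟨a, rfl⟩, rfl⟩
      exact ⟨a.1, a.2, rfl⟩
    · rintro ⟨a, ha, rfl⟩
      exact ⟨_, ⟨⟨a, ha⟩, rfl⟩, rfl⟩

open Classical in
/-- The image of the adapted basis by the extension of an isometry of a coordinate subspace. -/
def extendBasis (h : isometryGroup (induced F (coordSpan F K)))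
    (a : Σ i, Fin (Module.finrank ℍᵐᵒᵖ (F i))) : V :=
  if ha : a ∈ K then (h.1 (coordBasis K ⟨a, ha⟩) : V) else adaptedBasis F a

theorem isAdaptedBasis_extendBasis (hF : IsOrthogonalSplitting F)
    (h : isometryGroup (induced F (coordSpan F K))) :
    IsAdaptedBasis F Sigma.fst (extendBasis K h) := by
  have he := isAdaptedBasis_adaptedBasis hF
  have hzero : ∀ a, a ∉ K → ∀ x : coordSpan F K, inner ℍ (adaptedBasis F a) (x : V) = 0 :=
    fun a ha x => inner_eq_zero_of_mem_span_image he.orthonormal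
      (J := (K : Set (Σ i, Fin (Module.finrank ℍᵐᵒᵖ (F i))))) ha x.2
  refine IsAdaptedBasis.of_card (fun a b => ?_) he.card_eq fun a => ?_
  · by_cases ha : a ∈ K <;> by_cases hb : b ∈ K
    · rw [extendBasis, extendBasis, dif_pos ha, dif_pos hb]
      exact (h.2.1 _ _).trans (he.orthonormal a b)
    · rw [extendBasis, extendBasis, dif_pos ha, dif_neg hb, ← star_inner, hzero b hb, star_zero,
        if_neg]
      rintro rfl
      exact hb ha
    · rw [extendBasis, extendBasis, dif_neg ha, dif_pos hb, hzero a ha, if_neg]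
      rintro rfl
      exact ha hb
    · rw [extendBasis, extendBasis, dif_neg ha, dif_neg hb, he.orthonormal]
  · by_cases ha : a ∈ K
    · rw [extendBasis, dif_pos ha]
      have : h.1 (coordBasis K ⟨a, ha⟩) ∈ induced F (coordSpan F K) a.1 :=
        mem_part_of_group h (he.mem a)
      exact this
    · rw [extendBasis, dif_neg ha]
      exact he.mem a

/-- The extension of an isometry of a coordinate subspace by the identity. -/
def extend (hF : IsOrthogonalSplitting F) (h : isometryGroup (induced F (coordSpan F K))) :
    isometryGroup F :=
  ((isAdaptedBasis_adaptedBasis hF).isSplitIsometry hF hF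
    (isAdaptedBasis_extendBasis K hF h)).toGroup

theorem extend_apply (hF : IsOrthogonalSplitting F)
    (h : isometryGroup (induced F (coordSpan F K)))
    (a : Σ i, Fin (Module.finrank ℍᵐᵒᵖ (F i))) :
    (extend K hF h).1 (adaptedBasis F a) = extendBasis K h a :=
  (isAdaptedBasis_adaptedBasis hF).isometry_apply (isAdaptedBasis_extendBasis K hF h) a

theorem continuous_extend (hF : IsOrthogonalSplitting F) : Continuous (extend K hF) := by
  refine continuous_isometryGroup_iff.2 fun v => ?_
  change Continuous fun h => ∑ a, MulOpposite.op (inner ℍ (adaptedBasis F a) v) • extendBasis K h a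
  refine continuous_finsetSum _ fun a _ => Continuous.const_smul ?_ _
  by_cases ha : a ∈ K
  · simp only [extendBasis, dif_pos ha]
    exact continuous_subtype_val.comp (continuous_isometryGroup_apply _)
  · simp only [extendBasis, dif_neg ha]
    exact continuous_const

/-- Extended by the identity, an isometry of `E_K` preserves every `E_J` with `J ⊇ K`: the basis
vectors in `K` stay in `E_K` and the others are fixed. -/
theorem coord_mul_extend (hF : IsOrthogonalSplitting F)
    {J : Finset (Σ i, Fin (Module.finrank ℍᵐᵒᵖ (F i)))} (hKJ : K ⊆ J) (u : isometryGroup F)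
    (h : isometryGroup (induced F (coordSpan F K))) :
    Gr.coord F J (u * extend K hF h) = Gr.coord F J u := by
  have h1 : (coordSpan F J).map ((extend K hF h).1 : V →ₗ[ℍᵐᵒᵖ] V) = coordSpan F J := by
    refine Submodule.eq_of_le_of_finrank_eq ?_ (LinearEquiv.finrank_map_eq _ _)
    rw [coordSpan, Submodule.map_span, Submodule.span_le]
    rintro _ ⟨_, ⟨a, ha, rfl⟩, rfl⟩
    change (extend K hF h).1 (adaptedBasis F a) ∈ coordSpan F J
    rw [extend_apply]
    by_cases haK : a ∈ K
    · rw [extendBasis, dif_pos haK]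
      exact Submodule.span_mono (Set.image_mono (Finset.coe_subset.2 hKJ)) (h.1 _).2
    · rw [extendBasis, dif_neg haK]
      exact adaptedBasis_mem_coordSpan ha
  refine Subtype.ext ?_
  change (coordSpan F J).map ((u.1 : V →ₗ[ℍᵐᵒᵖ] V) ∘ₗ ((extend K hF h).1 : V →ₗ[ℍᵐᵒᵖ] V)) =
    (coordSpan F J).map (u.1 : V →ₗ[ℍᵐᵒᵖ] V)
  rw [Submodule.map_comp, h1]

/-! ### The incidence kernel -/

/-- The invariant measure of the Grassmannian of `Q`, seen as a measure on that of `V`. -/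
def incidenceKernel (F : Fin s → Submodule ℍᵐᵒᵖ V) (Q : Gr F) : Measure (Gr F) :=
  (invariantMeasure (induced F Q.1)).map (Gr.incl F Q.1)

omit [Module.Finite ℍᵐᵒᵖ V] in
theorem isSplitIsometry_submoduleMap (u : isometryGroup F) (Q : Submodule ℍᵐᵒᵖ V) :
    IsSplitIsometry (induced F Q) (induced F (Q.map (u.1 : V →ₗ[ℍᵐᵒᵖ] V)))
      (u.1.submoduleMap Q) := by
  refine ⟨fun v w => u.2.1 v w, fun i => ?_⟩
  ext ⟨w, hw⟩
  constructor
  · rintro ⟨v, hv, h⟩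
    have h' : u.1 (v : V) = w := congrArg Subtype.val h
    change w ∈ F i
    rw [← h']
    exact mem_part_of_group u hv
  · intro hwi
    obtain ⟨v, hv, rfl⟩ := hw
    refine ⟨⟨v, hv⟩, ?_, rfl⟩
    change v ∈ F i
    have h2 : u.1 v ∈ F i := hwi
    rw [← u.2.2 i] at h2
    obtain ⟨v', hv', h3⟩ := h2
    rwa [← u.1.injective h3]

/-- The restriction of `u` identifies `E_K` with its image, so the invariant measure there can be
computed with the isometry group and the coordinate basis of `E_K`. The point of the right side is
that a single group element `u * extend K hF h` appears, to which invariance can be applied. -/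
theorem incidenceKernel_coord (hF : IsOrthogonalSplitting F) (u : isometryGroup F) :
    incidenceKernel F (Gr.coord F K u) = ∑ L ∈ K.powerset,
      (haarProb (induced F (coordSpan F K))).map fun h => Gr.coord F L (u * extend K hF h) := by
  classical
  have hK := isOrthogonalSplitting_coordSpan K hF
  have hb := isAdaptedBasis_coordBasis K hF
  have hφ := isSplitIsometry_submoduleMap u (coordSpan F K)
  have hF' : IsOrthogonalSplitting (induced F ((coordSpan F K).map (u.1 : V →ₗ[ℍᵐᵒᵖ] V))) :=
    hF.induced (Gr.coord F K u)
  have hmi : ∀ (h : isometryGroup (induced F (coordSpan F K))) a,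
      u.1.submoduleMap (coordSpan F K) (h.1 (coordBasis K a)) ∈
        induced F ((coordSpan F K).map (u.1 : V →ₗ[ℍᵐᵒᵖ] V)) a.1.1 := fun h a => by
    rw [← hφ.map_part]
    exact ⟨_, mem_part_of_group h (hb.mem a), rfl⟩
  have hm : ∀ (h : isometryGroup (induced F (coordSpan F K))) a, ∃ i,
      u.1.submoduleMap (coordSpan F K) (h.1 (coordBasis K a)) ∈
        induced F ((coordSpan F K).map (u.1 : V →ₗ[ℍᵐᵒᵖ] V)) i := fun h a => ⟨_, hmi h a⟩
  have hcont : ∀ J : Finset {a // a ∈ K}, Continuous fun h => Gr.span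
      (induced F ((coordSpan F K).map (u.1 : V →ₗ[ℍᵐᵒᵖ] V))) (hm h) J := fun J =>
    continuous_grSpan (fun a => hφ.continuous.comp (continuous_isometryGroup_apply _))
      (fun h a b => (hφ.inner_map _ _).trans ((h.2.1 _ _).trans (hb.orthonormal a b))) hm J
  change (invariantMeasure (induced F ((coordSpan F K).map (u.1 : V →ₗ[ℍᵐᵒᵖ] V)))).map
    (Gr.incl F ((coordSpan F K).map (u.1 : V →ₗ[ℍᵐᵒᵖ] V))) = _
  rw [invariantMeasure_eq_sum hK hF' hb hφ hm,
    Measure.map_finset_sum (continuous_incl _).measurable.aemeasurable]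
  refine Finset.sum_bij' (fun J _ => J.map (Function.Embedding.subtype _))
    (fun L _ => L.subtype (· ∈ K)) ?_ (fun _ _ => Finset.mem_univ _) ?_ ?_ ?_
  · intro J _
    rw [Finset.mem_powerset]
    intro a ha
    obtain ⟨b, -, rfl⟩ := Finset.mem_map.1 ha
    exact b.2
  · intro J _; ext a; simp
  · intro L hL
    exact Finset.subtype_map_of_mem fun a ha => Finset.mem_powerset.1 hL ha
  · intro J _
    rw [Measure.map_map (continuous_incl _).measurable (hcont J).measurable]
    congr 1
    funext h
    refine Subtype.ext ?_
    change Submodule.map _ (Submodule.span _ _) = Submodule.map _ (Submodule.span _ _)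
    rw [Submodule.map_span, Submodule.map_span, Set.image_image, Set.image_image, Finset.coe_map,
      Set.image_image]
    congr 1
    refine Set.image_congr fun a _ => ?_
    change u.1 (h.1 (coordBasis K a) : V) = u.1 ((extend K hF h).1 (adaptedBasis F a.1))
    rw [extend_apply, extendBasis, dif_pos a.2]

end Orbits

/-! ### The incidence transform: measurability, injectivity and existence of the determinantal
measure -/

section Measures

open QuaternionicInnerProductSpace

variable {V : Type*} [NormedAddCommGroup V] [Module ℍᵐᵒᵖ V] [QuaternionicInnerProductSpace V]
  [Module.Finite ℍᵐᵒᵖ V] {s : ℕ} {F : Fin s → Submodule ℍᵐᵒᵖ V}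

theorem continuous_mul_extend (hF : IsOrthogonalSplitting F)
    (K : Finset (Σ i, Fin (Module.finrank ℍᵐᵒᵖ (F i)))) :
    Continuous fun p : isometryGroup F × isometryGroup (induced F (coordSpan F K)) =>
      p.1 * extend K hF p.2 :=
  continuous_fst.mul ((continuous_extend K hF).comp continuous_snd)

theorem incidenceKernel_coord_apply (hF : IsOrthogonalSplitting F)
    (K : Finset (Σ i, Fin (Module.finrank ℍᵐᵒᵖ (F i)))) (u : isometryGroup F) {B : Set (Gr F)}
    (hB : MeasurableSet B) :
    incidenceKernel F (Gr.coord F K u) B = ∑ L ∈ K.powerset,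
      haarProb (induced F (coordSpan F K)) {h | Gr.coord F L (u * extend K hF h) ∈ B} := by
  rw [incidenceKernel_coord K hF u, Measure.finsetSum_apply]
  refine Finset.sum_congr rfl fun L _ => ?_
  rw [Measure.map_apply _ hB]
  · rfl
  · exact ((continuous_coord hF L).comp
      (continuous_const.mul (continuous_extend K hF))).measurable

/-- The kernel is explicit only as a function of `(u, K)`. Measurability descends along the Borel
surjection `(u, K) ↦ u(E_K)` because its source is standard Borel. -/
theorem measurable_incidenceKernel (hF : IsOrthogonalSplitting F) :
    Measurable (incidenceKernel F) := by
  have := polishSpace_gr hF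
  let _ : MeasurableSpace (Finset (Σ i, Fin (Module.finrank ℍᵐᵒᵖ (F i)))) := ⊤
  let c : isometryGroup F × Finset (Σ i, Fin (Module.finrank ℍᵐᵒᵖ (F i))) → Gr F :=
    fun p => Gr.coord F p.2 p.1
  have hc : Measurable c := measurable_from_prod_countable_left fun K =>
    (continuous_coord hF K).measurable
  have hs : Function.Surjective c := fun Q => by
    obtain ⟨K, u, h⟩ := exists_coord_eq hF Q
    exact ⟨(u, K), h⟩
  refine (Measurable.measurable_comp_iff_of_surjective hc hs).1 ?_
  refine measurable_from_prod_countable_left fun K => Measure.measurable_of_measurable_coe _ ?_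
  intro B hB
  change Measurable fun u => incidenceKernel F (Gr.coord F K u) B
  simp only [incidenceKernel_coord_apply hF K _ hB]
  refine Finset.measurable_fun_sum _ fun L _ => ?_
  exact measurable_measure_prodMk_left (hB.preimage
    ((continuous_coord hF L).comp (continuous_mul_extend hF K)).measurable)

theorem incidenceMeasure_apply (hF : IsOrthogonalSplitting F) (μ : Measure (Gr F))
    {B : Set (Gr F)} (hB : MeasurableSet B) :
    incidenceMeasure μ B = ∫⁻ Q, incidenceKernel F Q B ∂μ :=
  Measure.bind_apply hB (measurable_incidenceKernel hF).aemeasurable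

/-! ### Uniqueness -/

theorem finrank_coord (hF : IsOrthogonalSplitting F)
    (K : Finset (Σ i, Fin (Module.finrank ℍᵐᵒᵖ (F i)))) (u : isometryGroup F) :
    Module.finrank ℍᵐᵒᵖ (Gr.coord F K u).1 = K.card :=
  (LinearEquiv.finrank_map_eq u.1 _).trans
    (finrank_span_image (isAdaptedBasis_adaptedBasis hF).orthonormal K)

/-- The set of all subspaces of dimension `d`. -/
def dimSet (F : Fin s → Submodule ℍᵐᵒᵖ V) (d : ℕ) : Set (Gr F) :=
  {Q | Module.finrank ℍᵐᵒᵖ Q.1 = d}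

theorem measurableSet_dimSet (hF : IsOrthogonalSplitting F) (d : ℕ) :
    MeasurableSet (dimSet F d) := by
  have := polishSpace_gr hF
  have h : dimSet F d = ⋃ K ∈ {K : Finset (Σ i, Fin (Module.finrank ℍᵐᵒᵖ (F i))) | K.card = d},
      Set.range (Gr.coord F K) := by
    ext Q
    simp only [Set.mem_iUnion, dimSet]
    constructor
    · intro hQ
      obtain ⟨K, u, rfl⟩ := exists_coord_eq hF Q
      exact ⟨K, (finrank_coord hF K u).symm.trans hQ, u, rfl⟩
    · rintro ⟨K, hK, u, rfl⟩
      exact (finrank_coord hF K u).trans hK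
  rw [h]
  exact MeasurableSet.biUnion (Set.to_countable _) fun K _ =>
    (isCompact_range (continuous_coord hF K)).isClosed.measurableSet

/-- The total mass at `Q = u(E_K)` is the number of subsets of `K`. The uniform bound provides the
finiteness needed for subtraction in the uniqueness proof. -/
theorem incidenceKernel_le (hF : IsOrthogonalSplitting F) (Q : Gr F) (B : Set (Gr F)) :
    incidenceKernel F Q B ≤ 2 ^ Module.finrank ℍᵐᵒᵖ V := by
  obtain ⟨K, u, rfl⟩ := exists_coord_eq hF Q
  refine (measure_mono (Set.subset_univ B)).trans ?_
  rw [incidenceKernel_coord_apply hF K u MeasurableSet.univ]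
  simp only [Set.mem_univ, Set.ofPred_true, measure_univ, Finset.sum_const, Finset.card_powerset,
    nsmul_eq_mul, mul_one]
  rw [← (isAdaptedBasis_adaptedBasis hF).card_eq]
  exact_mod_cast Nat.pow_le_pow_right two_pos (Finset.card_le_univ K)

/-- Proper subspaces of `Q` have dimension less than `d`, and the term of `Q` itself, given by `L =
K`, is a point mass of weight one. This is the unitriangularity of `Z`. -/
theorem incidenceKernel_dimSet (hF : IsOrthogonalSplitting F) {Q : Gr F} {d : ℕ}
    (hQ : Module.finrank ℍᵐᵒᵖ Q.1 ≤ d) {B : Set (Gr F)} (hB : MeasurableSet B) :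
    incidenceKernel F Q (B ∩ dimSet F d) = (B ∩ dimSet F d).indicator 1 Q := by
  obtain ⟨K, u, rfl⟩ := exists_coord_eq hF Q
  rw [finrank_coord hF] at hQ
  rw [incidenceKernel_coord_apply hF K u (hB.inter (measurableSet_dimSet hF d)),
    Finset.sum_eq_single_of_mem K (Finset.mem_powerset_self K)]
  · simp only [coord_mul_extend K hF subset_rfl]
    by_cases h : Gr.coord F K u ∈ B ∩ dimSet F d
    · simp [h]
    · simp [h]
  · intro L hL hne
    have hlt : L.card < K.card := Finset.card_lt_card
      (lt_of_le_of_ne (Finset.mem_powerset.1 hL) hne)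
    have : {h | Gr.coord F L (u * extend K hF h) ∈ B ∩ dimSet F d} = ∅ := by
      refine Set.eq_empty_of_forall_notMem fun h hh => ?_
      have h2 : Module.finrank ℍᵐᵒᵖ (Gr.coord F L (u * extend K hF h)).1 = d := hh.2
      rw [finrank_coord hF] at h2
      omega
    rw [this, measure_empty]

/-- The incidence measure determines the measure. -/
theorem incidenceMeasure_injective (hF : IsOrthogonalSplitting F) {μ μ' : Measure (Gr F)}
    [IsFiniteMeasure μ] [IsFiniteMeasure μ'] (h : incidenceMeasure μ = incidenceMeasure μ') :
    μ = μ' := by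
  -- Descending induction on the dimension `d`, run as an induction on `m`; the base case has `d >
  -- dim V`, where `dimSet F d` is empty.
  have hrec : ∀ m d, Module.finrank ℍᵐᵒᵖ V < d + m →
      μ.restrict (dimSet F d) = μ'.restrict (dimSet F d) := by
    intro m
    induction m with
    | zero =>
      intro d hd
      have : dimSet F d = ∅ := Set.eq_empty_of_forall_notMem fun Q hQ => by
        have h1 := Submodule.finrank_le Q.1
        have h2 : Module.finrank ℍᵐᵒᵖ Q.1 = d := hQ
        omega
      rw [this, Measure.restrict_empty, Measure.restrict_empty]
    | succ m ih =>
      intro d hd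
      let U : Set (Gr F) := ⋃ e : {e // d < e}, dimSet F e
      have hU : μ.restrict U = μ'.restrict U :=
        Measure.restrict_iUnion_congr.2 fun e => ih e (by have := e.2; omega)
      have hUm : MeasurableSet U := MeasurableSet.iUnion fun e => measurableSet_dimSet hF e
      have hUc : ∀ Q ∈ Uᶜ, Module.finrank ℍᵐᵒᵖ Q.1 ≤ d := fun Q hQ =>
        not_lt.1 fun hlt => hQ (Set.mem_iUnion.2 ⟨⟨_, hlt⟩, rfl⟩)
      ext B hB
      rw [Measure.restrict_apply hB, Measure.restrict_apply hB]
      have hBd := hB.inter (measurableSet_dimSet hF d)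
      have hsub : B ∩ dimSet F d ⊆ Uᶜ := by
        rintro Q ⟨-, hQ⟩ hQU
        obtain ⟨e, he⟩ := Set.mem_iUnion.1 hQU
        have h1 : Module.finrank ℍᵐᵒᵖ Q.1 = d := hQ
        have h2 : Module.finrank ℍᵐᵒᵖ Q.1 = e := he
        have := e.2
        omega
      -- Only dimensions larger than `d`, settled by the induction hypothesis, and `ρ` itself
      -- contribute to the incidence measure in dimension `d`.
      have key : ∀ ρ : Measure (Gr F), incidenceMeasure ρ (B ∩ dimSet F d) =
          ∫⁻ Q in U, incidenceKernel F Q (B ∩ dimSet F d) ∂ρ + ρ (B ∩ dimSet F d) := fun ρ => by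
        rw [incidenceMeasure_apply hF ρ hBd, ← lintegral_add_compl _ hUm]
        congr 1
        rw [setLIntegral_congr_fun hUm.compl fun Q hQ => incidenceKernel_dimSet hF (hUc Q hQ) hB,
          lintegral_indicator_one hBd, Measure.restrict_apply hBd,
          Set.inter_eq_self_of_subset_left hsub]
      have h1 := congrArg (fun ρ : Measure (Gr F) => ρ (B ∩ dimSet F d)) h
      simp only [key, hU] at h1
      refine (ENNReal.add_right_inj (ne_of_lt ?_)).1 h1
      calc ∫⁻ Q in U, incidenceKernel F Q (B ∩ dimSet F d) ∂μ'
          ≤ ∫⁻ _ in U, 2 ^ Module.finrank ℍᵐᵒᵖ V ∂μ' :=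
            lintegral_mono fun Q => incidenceKernel_le hF Q _
        _ < ∞ := by
            rw [lintegral_const]
            exact ENNReal.mul_lt_top (by simp) (measure_lt_top _ _)
  have huniv : (⋃ d, dimSet F d) = Set.univ :=
    Set.eq_univ_of_forall fun Q => Set.mem_iUnion.2 ⟨_, rfl⟩
  rw [← Measure.restrict_univ (μ := μ), ← Measure.restrict_univ (μ := μ'), ← huniv]
  exact Measure.restrict_iUnion_congr.2 fun d => hrec (Module.finrank ℍᵐᵒᵖ V + 1) d (by omega)

/-! ### Continuity of the determinants -/

theorem continuous_mooreDet {X : Type*} [TopologicalSpace X] {n : ℕ}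
    {M : X → Matrix (Fin n) (Fin n) ℍ} (hM : ∀ i j, Continuous fun x => M x i j) :
    Continuous fun x => mooreDet (M x) := by
  simp only [mooreDet_eq]
  refine continuous_finsetSum _ fun π _ => continuous_const.mul ?_
  obtain ⟨R, -, hR⟩ := exists_isTransversal π ∅ (by simp)
  simp only [hR.permWeight_eq]
  refine continuous_finsetProd _ fun i _ => Quaternion.continuous_re.comp ?_
  exact continuous_list_prod (f := fun t x => M x ((π ^ t) i) ((π ^ (t + 1)) i)) _
    fun t _ => hM _ _

theorem continuous_quaternionLinearMap (k : V →ₗ[ℍᵐᵒᵖ] V) : Continuous k := by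
  have hb := onb_isOrthonormalBasis V
  have h : ∀ v, k v = ∑ i, MulOpposite.op (inner ℍ (onb V i) v) • k (onb V i) := fun v => by
    conv_lhs => rw [← sum_inner_smul hb.1 (v := v) (hb.2 ▸ Submodule.mem_top), map_sum]
    simp only [map_smul]
  rw [continuous_congr h]
  refine continuous_finsetSum _ fun i _ => ?_
  exact (MulOpposite.continuous_op.comp (continuous_inner_fun.comp
    (continuous_const.prodMk continuous_id))).smul continuous_const

theorem continuous_compressionDet (k : V →ₗ[ℍᵐᵒᵖ] V) :
    Continuous fun Q : Gr F => compressionDet k Q.1 := by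
  refine continuous_mooreDet fun i j => ?_
  simp only [matrixOf, Matrix.of_apply, inner_extendedCompression]
  have h := fun v => continuous_orthProj_apply (F := F) v
  exact (continuous_inner_fun.comp ((h _).prodMk
    ((continuous_quaternionLinearMap k).comp (h _)))).add (continuous_const.sub
      (continuous_inner_fun.comp (continuous_const.prodMk (h _))))

/-- This normalises the total mass of the determinantal measure. -/
theorem compressionDet_bot (k : V →ₗ[ℍᵐᵒᵖ] V) : compressionDet k ⊥ = 1 := by
  have h : ∀ v, (orthProj (⊥ : Submodule ℍᵐᵒᵖ V) v : V) = 0 := fun v =>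
    (Submodule.mem_bot _).1 (orthProj (⊥ : Submodule ℍᵐᵒᵖ V) v).2
  rw [compressionDet, matrixOf_eigenbasis (onb_isOrthonormalBasis V).1 (d := fun _ => 1),
    mooreDet_diagonal, Finset.prod_const_one]
  intro i
  rw [extendedCompression_apply, h, h]
  simp

/-! ### Existence -/

/-- The density of the determinantal measure on the orbit of the coordinate subspace `E_K`. -/
def orbitDensity (k : V →ₗ[ℍᵐᵒᵖ] V) (K : Finset (Σ i, Fin (Module.finrank ℍᵐᵒᵖ (F i))))
    (u : isometryGroup F) : ℝ :=
  ∑ J : Finset (Σ i, Fin (Module.finrank ℍᵐᵒᵖ (F i))) with K ⊆ J,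
    (-1 : ℝ) ^ (J \ K).card * compressionDet k (Gr.coord F J u).1

theorem orbitDensity_nonneg (hF : IsOrthogonalSplitting F) {k : V →ₗ[ℍᵐᵒᵖ] V} (hk : IsKernel k)
    (K : Finset (Σ i, Fin (Module.finrank ℍᵐᵒᵖ (F i)))) (u : isometryGroup F) :
    0 ≤ orbitDensity k K u := by
  have he := isAdaptedBasis_adaptedBasis hF
  have ho : ∀ a b, inner ℍ (u.1 (adaptedBasis F a)) (u.1 (adaptedBasis F b)) =
      if a = b then 1 else 0 := fun a b => (u.2.1 _ _).trans (he.orthonormal a b)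
  have hb := IsAdaptedBasis.of_card (F := F) (l := Sigma.fst) ho he.card_eq
    fun a => mem_part_of_group u (he.mem a)
  have h := hk.sum_alternating_nonneg hb.orthonormal hb.span_eq_top K
  have hJ : ∀ J : Finset (Σ i, Fin (Module.finrank ℍᵐᵒᵖ (F i))), (Gr.coord F J u).1 =
      Submodule.span ℍᵐᵒᵖ ((fun a => u.1 (adaptedBasis F a)) '' J) := fun J => by
    change Submodule.map _ _ = _
    rw [Submodule.map_span, Set.image_image]
    rfl
  simpa only [orbitDensity, hJ] using h

theorem continuous_orbitDensity (hF : IsOrthogonalSplitting F) (k : V →ₗ[ℍᵐᵒᵖ] V)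
    (K : Finset (Σ i, Fin (Module.finrank ℍᵐᵒᵖ (F i)))) :
    Continuous (orbitDensity (F := F) k K) :=
  continuous_finsetSum _ fun J _ => continuous_const.mul
    ((continuous_compressionDet k).comp (continuous_coord hF J))

theorem orbitDensity_mul_extend (hF : IsOrthogonalSplitting F) (k : V →ₗ[ℍᵐᵒᵖ] V)
    (K : Finset (Σ i, Fin (Module.finrank ℍᵐᵒᵖ (F i)))) (u : isometryGroup F)
    (h : isometryGroup (induced F (coordSpan F K))) :
    orbitDensity k K (u * extend K hF h) = orbitDensity k K u := by
  refine Finset.sum_congr rfl fun J hJ => ?_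
  rw [coord_mul_extend K hF (Finset.mem_filter.1 hJ).2]

theorem sum_orbitDensity (k : V →ₗ[ℍᵐᵒᵖ] V)
    (L : Finset (Σ i, Fin (Module.finrank ℍᵐᵒᵖ (F i)))) (u : isometryGroup F) :
    ∑ K : Finset (Σ i, Fin (Module.finrank ℍᵐᵒᵖ (F i))) with L ⊆ K, orbitDensity k K u =
      compressionDet k (Gr.coord F L u).1 :=
  sum_sum_alternating (fun J => compressionDet k (Gr.coord F J u).1) L

/-- The kernel at `u(E_K)` averages over `u * extend K hF h`. As `g` ignores `h`, the whole
integrand depends on this product alone; after Fubini, right invariance of the Haar measure replaces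
it by `u` for each fixed `h`. -/
theorem lintegral_mul_incidenceKernel (hF : IsOrthogonalSplitting F)
    (K : Finset (Σ i, Fin (Module.finrank ℍᵐᵒᵖ (F i)))) {g : isometryGroup F → ℝ≥0∞}
    (hg : Measurable g) (hgK : ∀ u h, g (u * extend K hF h) = g u) {B : Set (Gr F)}
    (hB : MeasurableSet B) :
    ∫⁻ u, g u * incidenceKernel F (Gr.coord F K u) B ∂haarProb F =
      ∑ L ∈ K.powerset, ∫⁻ u, g u * B.indicator 1 (Gr.coord F L u) ∂haarProb F := by
  have hmeas : ∀ L, Measurable fun u => g u * B.indicator 1 (Gr.coord F L u) := fun L =>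
    hg.mul ((measurable_one.indicator hB).comp (continuous_coord hF L).measurable)
  have h1 : ∀ u, g u * incidenceKernel F (Gr.coord F K u) B = ∑ L ∈ K.powerset,
      ∫⁻ h, g (u * extend K hF h) * B.indicator 1 (Gr.coord F L (u * extend K hF h))
        ∂haarProb (induced F (coordSpan F K)) := fun u => by
    rw [incidenceKernel_coord_apply hF K u hB, Finset.mul_sum]
    refine Finset.sum_congr rfl fun L _ => ?_
    have hc : Continuous fun h => Gr.coord F L (u * extend K hF h) :=
      (continuous_coord hF L).comp (continuous_const.mul (continuous_extend K hF))
    simp only [hgK]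
    have hm : Measurable fun h =>
        B.indicator (1 : Gr F → ℝ≥0∞) (Gr.coord F L (u * extend K hF h)) :=
      (measurable_one.indicator hB).comp hc.measurable
    rw [lintegral_const_mul _ hm]
    congr 1
    exact (lintegral_indicator_one (hB.preimage hc.measurable)).symm
  simp only [h1]
  have hjoint : ∀ L, Measurable fun p :
      isometryGroup F × isometryGroup (induced F (coordSpan F K)) =>
      g (p.1 * extend K hF p.2) * B.indicator 1 (Gr.coord F L (p.1 * extend K hF p.2)) :=
    fun L => (hmeas L).comp (continuous_mul_extend hF K).measurable
  rw [lintegral_finsetSum _ fun L _ => (hjoint L).lintegral_prod_right']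
  refine Finset.sum_congr rfl fun L _ => ?_
  rw [lintegral_lintegral_swap (hjoint L).aemeasurable]
  have h2 : ∀ h, ∫⁻ u, g (u * extend K hF h) * B.indicator 1 (Gr.coord F L (u * extend K hF h))
      ∂haarProb F = ∫⁻ u, g u * B.indicator 1 (Gr.coord F L u) ∂haarProb F := fun h =>
    lintegral_mul_right_eq_self (fun u => g u * B.indicator 1 (Gr.coord F L u)) (extend K hF h)
  simp only [h2, lintegral_const, measure_univ, mul_one]

/-- The determinantal measure with kernel `k`. -/
def determinantalMeasure (F : Fin s → Submodule ℍᵐᵒᵖ V) (k : V →ₗ[ℍᵐᵒᵖ] V) : Measure (Gr F) :=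
  ∑ K : Finset (Σ i, Fin (Module.finrank ℍᵐᵒᵖ (F i))),
    ((haarProb F).withDensity fun u => ENNReal.ofReal (orbitDensity k K u)).map (Gr.coord F K)

theorem sum_ofReal_orbitDensity (hF : IsOrthogonalSplitting F) {k : V →ₗ[ℍᵐᵒᵖ] V}
    (hk : IsKernel k) (L : Finset (Σ i, Fin (Module.finrank ℍᵐᵒᵖ (F i)))) (u : isometryGroup F) :
    ∑ K : Finset (Σ i, Fin (Module.finrank ℍᵐᵒᵖ (F i))) with L ⊆ K,
      ENNReal.ofReal (orbitDensity k K u) =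
      ENNReal.ofReal (compressionDet k (Gr.coord F L u).1) := by
  rw [← sum_orbitDensity, ENNReal.ofReal_sum_of_nonneg fun K _ => orbitDensity_nonneg hF hk K u]

/-- For every `u` the weights of all the `K` add up to `1`: this is the Möbius identity with `L =
∅`, where the subspace is null and its determinant is `1`. -/
theorem isProbabilityMeasure_determinantalMeasure (hF : IsOrthogonalSplitting F)
    {k : V →ₗ[ℍᵐᵒᵖ] V} (hk : IsKernel k) : IsProbabilityMeasure (determinantalMeasure F k) := by
  refine ⟨?_⟩
  have h1 : ∀ K, ((haarProb F).withDensity fun u => ENNReal.ofReal (orbitDensity k K u)).map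
      (Gr.coord F K) Set.univ = ∫⁻ u, ENNReal.ofReal (orbitDensity k K u) ∂haarProb F := fun K => by
    rw [Measure.map_apply (continuous_coord hF K).measurable MeasurableSet.univ, Set.preimage_univ,
      withDensity_apply _ MeasurableSet.univ, Measure.restrict_univ]
  rw [determinantalMeasure, Measure.finsetSum_apply]
  simp only [h1]
  rw [← lintegral_finsetSum _ fun K _ =>
    (continuous_orbitDensity hF k K).measurable.ennreal_ofReal]
  have h2 : ∀ u : isometryGroup F, ∑ K : Finset (Σ i, Fin (Module.finrank ℍᵐᵒᵖ (F i))),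
      ENNReal.ofReal (orbitDensity k K u) = 1 := fun u => by
    have h := sum_ofReal_orbitDensity hF hk ∅ u
    have h3 : (Gr.coord F ∅ u).1 = ⊥ := by
      change Submodule.map _ (Submodule.span _ _) = _
      simp
    rw [h3, compressionDet_bot, ENNReal.ofReal_one] at h
    simpa using h
  simp only [h2, lintegral_one, measure_univ]

/-- Both sides become sums of the same integrals over pairs `L ⊆ K`, one grouped by `K` and the
other by `L`. -/
theorem incidenceMeasure_determinantalMeasure (hF : IsOrthogonalSplitting F)
    {k : V →ₗ[ℍᵐᵒᵖ] V} (hk : IsKernel k) :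
    incidenceMeasure (determinantalMeasure F k) =
      (invariantMeasure F).withDensity fun R => ENNReal.ofReal (compressionDet k R.1) := by
  ext B hB
  have hN : Measurable fun Q => incidenceKernel F Q B :=
    (Measure.measurable_coe hB).comp (measurable_incidenceKernel hF)
  have hD : Measurable fun Q : Gr F => ENNReal.ofReal (compressionDet k Q.1) :=
    (continuous_compressionDet k).measurable.ennreal_ofReal
  have hg : ∀ K, Measurable fun u : isometryGroup F => ENNReal.ofReal (orbitDensity k K u) :=
    fun K => (continuous_orbitDensity hF k K).measurable.ennreal_ofReal
  have hI : ∀ L, Measurable fun u => B.indicator (1 : Gr F → ℝ≥0∞) (Gr.coord F L u) := fun L =>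
    (measurable_one.indicator hB).comp (continuous_coord hF L).measurable
  rw [incidenceMeasure_apply hF _ hB, withDensity_apply _ hB, ← lintegral_indicator hB,
    determinantalMeasure, invariantMeasure, lintegral_finsetSum_measure,
    lintegral_finsetSum_measure]
  have h1 : ∀ K, ∫⁻ Q, incidenceKernel F Q B ∂((haarProb F).withDensity fun u =>
      ENNReal.ofReal (orbitDensity k K u)).map (Gr.coord F K) =
      ∑ L ∈ K.powerset, ∫⁻ u, ENNReal.ofReal (orbitDensity k K u) *
        B.indicator 1 (Gr.coord F L u) ∂haarProb F := fun K => by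
    have hNK : Measurable fun u => incidenceKernel F (Gr.coord F K u) B :=
      hN.comp (continuous_coord hF K).measurable
    rw [lintegral_map hN (continuous_coord hF K).measurable,
      lintegral_withDensity_eq_lintegral_mul _ (hg K) hNK]
    exact lintegral_mul_incidenceKernel hF K (hg K)
      (fun u h => by rw [orbitDensity_mul_extend hF]) hB
  simp only [h1]
  have h2 : ∀ L, ∫⁻ Q, B.indicator (fun R : Gr F => ENNReal.ofReal (compressionDet k R.1)) Q
      ∂(haarProb F).map (Gr.coord F L) =
      ∑ K : Finset (Σ i, Fin (Module.finrank ℍᵐᵒᵖ (F i))) with L ⊆ K,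
        ∫⁻ u, ENNReal.ofReal (orbitDensity k K u) * B.indicator 1 (Gr.coord F L u)
          ∂haarProb F := fun L => by
    have hm : ∀ K, Measurable fun u : isometryGroup F =>
        ENNReal.ofReal (orbitDensity k K u) * B.indicator 1 (Gr.coord F L u) :=
      fun K => (hg K).mul (hI L)
    rw [lintegral_map (hD.indicator hB) (continuous_coord hF L).measurable,
      ← lintegral_finsetSum _ fun K _ => hm K]
    refine lintegral_congr fun u => ?_
    rw [← Finset.sum_mul, sum_ofReal_orbitDensity hF hk]
    by_cases h : Gr.coord F L u ∈ B
    · simp [h]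
    · simp [h]
  simp only [h2]
  refine Finset.sum_comm' fun K L => ?_
  simp

end Measures

end QuatDLP

end

theorem mainTheorem11 {E : Type*} [NormedAddCommGroup E] [Module ℍᵐᵒᵖ E]
    [QuatDLP.QuaternionicInnerProductSpace E] [Module.Finite ℍᵐᵒᵖ E]
    (s : ℕ) (σ : QuatDLP.Splitting E s) (k : E →ₗ[ℍᵐᵒᵖ] E) (hk : QuatDLP.IsKernel k) :
    ∃! μ : MeasureTheory.Measure (QuatDLP.Gr σ.parts), QuatDLP.IsDLP σ k μ := by
  have hF := σ.isOrthogonalSplitting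
  refine ⟨QuatDLP.determinantalMeasure σ.parts k,
    ⟨QuatDLP.isProbabilityMeasure_determinantalMeasure hF hk,
      fun R => QuatDLP.compressionDet k R.1,
      fun R => QuatDLP.hasMooreDet_compression hk.selfAdjoint R.1,
      fun R => hk.compressionDet_nonneg R.1,
      (QuatDLP.continuous_compressionDet k).measurable,
      QuatDLP.incidenceMeasure_determinantalMeasure hF hk⟩, ?_⟩
  rintro μ ⟨hμ, D, hD, -, -, h⟩
  -- The function `D` is existentially quantified in `IsDLP`, but an orthonormal basis of `R`
  -- exists, so the value of the Moore determinant is forced.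
  have hDk : D = fun R => QuatDLP.compressionDet k R.1 := funext fun R =>
    (hD R).unique (QuatDLP.hasMooreDet_compression hk.selfAdjoint R.1)
  have := QuatDLP.isProbabilityMeasure_determinantalMeasure hF hk
  refine QuatDLP.incidenceMeasure_injective hF ?_
  rw [h, QuatDLP.incidenceMeasure_determinantalMeasure hF hk, hDk]
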